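/- For integers $1\le n\le m$ and an $m\times m$ unitary matrix $A=(a_{ij})$, let $\Phi_{m,n}$ be the set of non-decreasing arrays $\mathbf z=(z_1,\dots,z_n)$ with entries in $\{1,\dots,m\}$, and let the boson sampling distribution be the probability distribution on $\Phi_{m,n}$ given by $$q(\mathbf z\mid A)=\frac{1}{\prod_{j=1}^m s_j!}\Bigl|\sum_{\sigma\in S_n}\prod_{k=1}^n a_{z_k,\sigma(k)}\Bigr|^2,\qquad s_j=\#\{k: z_k=j\}.$$ Consider randomized algorithms on a unit-cost random access machine with exact complex arithmetic (field operations, conjugation, and comparison of real parts of complex numbers; copying, increment, decrement and comparison of non-negative integers, which can also be converted to complex numbers and used as array indices; drawing of independent uniform random numbers in $[0,1]$), with read-only access to $m$, $n$ and the first $n$ columns of $A$, and with a write-only output. Each operation takes one unit of time, and space is the number of memory cells used (variables and array cells), not counting the input. There is one such algorithm with the following properties. 1. For all $1\le n\le m$ and every $m\times m$ unitary matrix $A$, the algorithm always halts, and for each $\mathbf z\in\Phi_{m,n}$ its output is $\mathbf z$ with probability exactly $q(\mathbf z\mid A)$. 2. The space it uses beyond the input is $O(m)$: there is a constant $C$ such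 that it is at most $Cm$ for all $1\le n\le m$, all $m \times m$ unitary $A$ and all outcomes of the random numbers. 3. For $m=n$, its expected running time, averaged over a Haar random $n\times n$ unitary matrix $A$ and over the random numbers of the algorithm, is $O(n\rho^n)$ with $\rho=27/16\approx 1.69$: there is a constant $C$ such that it is at most $C\,n\,\rho^n$ for all $n\ge1$. -/

import Mathlib

open MeasureTheory
open scoped ENNReal

noncomputable section

/-! ### Haar measure on the unitary group -/

instance unitaryGroupCompactSpace (m : ℕ) : CompactSpace (Matrix.unitaryGroup (Fin m) ℂ) := by
  refine (isCompact_iff_compactSpace (s := {U | U ∈ Matrix.unitaryGroup (Fin m) ℂ})).mp ?_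
  have hK : IsCompact (Set.univ.pi fun _ : Fin m => Set.univ.pi fun _ : Fin m =>
      Metric.closedBall (0 : ℂ) 1) :=
    isCompact_univ_pi fun _ => isCompact_univ_pi fun _ => isCompact_closedBall _ _
  refine hK.of_isClosed_subset
    (isClosed_unitary (R := Matrix (Fin m) (Fin m) ℂ)) ?_
  intro U hU i _ j _
  simpa using entry_norm_bound_of_unitary hU i j

instance unitaryGroupMeasurableSpace (m : ℕ) : MeasurableSpace (Matrix.unitaryGroup (Fin m) ℂ) :=
  borel _

instance unitaryGroupBorelSpace (m : ℕ) : BorelSpace (Matrix.unitaryGroup (Fin m) ℂ) := ⟨rfl⟩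

/-- The Haar probability measure on the group of `m × m` unitary matrices. -/
def haarUnitary (m : ℕ) : Measure (Matrix.unitaryGroup (Fin m) ℂ) :=
  Measure.haarMeasure ⊤

/-! ### The boson sampling distribution -/

/-- The first `n` columns of an `m × m` matrix. -/
def firstColumns {m n : ℕ} (h : n ≤ m) (A : Matrix (Fin m) (Fin m) ℂ) :
    Matrix (Fin m) (Fin n) ℂ :=
  A.submatrix id (Fin.castLE h)

/-- The boson sampling weight of a multiset of size `n` with elements in `Fin m`, represented by a
non-decreasing array `z`: the squared modulus of the permanent of the matrix whose `k`-th row is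
row `z k` of `A`, divided by the product of the factorials of the multiplicities of `z`. -/
def bosonPMF {m n : ℕ} (A : Matrix (Fin m) (Fin n) ℂ) (z : Fin n →o Fin m) : ℝ :=
  ‖(A.submatrix z id).permanent‖ ^ 2 /
    ((∏ j : Fin m, (Finset.univ.filter fun k => z k = j).card.factorial : ℕ) : ℝ)

/-! ### The machine model

A randomized unit-cost random access machine with exact complex arithmetic. A program is a
while-program with `d` variables for natural numbers (used as counters and indices), `d` variables
for complex numbers, `d` arrays of natural numbers and `d` arrays of complex numbers, all
initially zero. Natural numbers can only be set to constants or to the input dimensions, copied,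
increased or decreased by one and compared, so they stay below the input dimensions plus a
constant plus the running time. The only random primitive draws a number uniformly from `[0,1]`.
The input matrix is read-only and the output is write-only. -/

/-- Instructions. The targets are the leftmost arguments. -/
inductive Instr (d : ℕ) : Type
  /-- set an integer variable to a constant -/
  | iconst (x : Fin d) (c : ℕ)
  /-- copy an integer variable -/
  | icopy (x y : Fin d)
  /-- add one -/
  | inc (x : Fin d)
  /-- subtract one (zero stays zero) -/
  | dec (x : Fin d)
  /-- the number of rows of the input matrix -/
  | rows (x : Fin d)
  /-- the number of columns of the input matrix -/
  | cols (x : Fin d)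
  /-- read the cell of the integer array `a` whose index is the value of the variable `i` -/
  | iget (x a i : Fin d)
  /-- write the integer variable `x` to that cell -/
  | iput (a i x : Fin d)
  /-- convert the value of the integer variable `y` to a complex number -/
  | ccast (x y : Fin d)
  /-- copy a complex variable -/
  | ccopy (x y : Fin d)
  /-- complex addition -/
  | add (x y z : Fin d)
  /-- complex subtraction -/
  | sub (x y z : Fin d)
  /-- complex multiplication -/
  | mul (x y z : Fin d)
  /-- complex division -/
  | div (x y z : Fin d)
  /-- complex conjugation -/
  | conj (x y : Fin d)
  /-- read the cell of the complex array `a` whose index is the value of the variable `i` -/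
  | cget (x a i : Fin d)
  /-- write the complex variable `x` to that cell -/
  | cput (a i x : Fin d)
  /-- read the entry of the input matrix in the row and column given by the variables `i`, `j` -/
  | input (x i j : Fin d)
  /-- draw a fresh random number, uniform on `[0,1]` -/
  | rand (x : Fin d)
  /-- append the value of an integer variable to the output -/
  | emit (x : Fin d)

/-- Tests: `<` and `=` of integer variables, and `<` for the real parts of complex variables. -/
inductive Test (d : ℕ) : Type
  | ilt (x y : Fin d)
  | ieq (x y : Fin d)
  | clt (x y : Fin d)

/-- Programs. -/
inductive Prog (d : ℕ) : Type
  | instr (i : Instr d)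
  | seq (p q : Prog d)
  | ite (t : Test d) (p q : Prog d)
  | while (t : Test d) (p : Prog d)

/-- The contents of the memory, together with the number of random numbers drawn so far, the
output so far, the number `clock` of instructions and tests executed so far, and the smallest
number `top` such that all array cells accessed so far have an index below `top`. -/
structure MState (d : ℕ) : Type where
  ivar : Fin d → ℕ
  cvar : Fin d → ℂ
  iarr : Fin d → ℕ → ℕ
  carr : Fin d → ℕ → ℂ
  drawn : ℕ
  out : List ℕ
  clock : ℕ
  top : ℕ

/-- The initial state. -/
def MState.init (d : ℕ) : MState d where
  ivar _ := 0
  cvar _ := 0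
  iarr _ _ := 0
  carr _ _ := 0
  drawn := 0
  out := []
  clock := 0
  top := 0

/-- The number of memory cells that have to be provided up to now: `2 * d` variables and `2 * d`
arrays of length `top`. -/
def MState.space {d : ℕ} (s : MState d) : ℕ :=
  2 * d + 2 * d * s.top

namespace MState

variable {d : ℕ} (s : MState d)

/-- One unit of time passes. -/
def tick : MState d := { s with clock := s.clock + 1 }

/-- Record an access to the cells with index `k`. -/
def touch (k : ℕ) : MState d := { s with top := max s.top (k + 1) }

def setI (x : Fin d) (v : ℕ) : MState d := { s with ivar := Function.update s.ivar x v }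

def setC (x : Fin d) (v : ℂ) : MState d := { s with cvar := Function.update s.cvar x v }

def setIArr (a : Fin d) (k v : ℕ) : MState d :=
  { s with iarr := Function.update s.iarr a (Function.update (s.iarr a) k v) }

def setCArr (a : Fin d) (k : ℕ) (v : ℂ) : MState d :=
  { s with carr := Function.update s.carr a (Function.update (s.carr a) k v) }

end MState

/-- The entry of the input matrix in row `i` and column `j`, zero if it does not exist. -/
def entryOrZero {m n : ℕ} (A : Matrix (Fin m) (Fin n) ℂ) (i j : ℕ) : ℂ :=
  if h : i < m ∧ j < n then A ⟨i, h.1⟩ ⟨j, h.2⟩ else 0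

/-- The effect of an instruction (apart from the passing of time) on input `A`, where `ω` is the
sequence of random numbers. -/
def Instr.effect {d m n : ℕ} (A : Matrix (Fin m) (Fin n) ℂ) (ω : ℕ → unitInterval)
    (s : MState d) : Instr d → MState d
  | .iconst x c => s.setI x c
  | .icopy x y => s.setI x (s.ivar y)
  | .inc x => s.setI x (s.ivar x + 1)
  | .dec x => s.setI x (s.ivar x - 1)
  | .rows x => s.setI x m
  | .cols x => s.setI x n
  | .iget x a i => (s.setI x (s.iarr a (s.ivar i))).touch (s.ivar i)
  | .iput a i x => (s.setIArr a (s.ivar i) (s.ivar x)).touch (s.ivar i)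
  | .ccast x y => s.setC x (s.ivar y : ℂ)
  | .ccopy x y => s.setC x (s.cvar y)
  | .add x y z => s.setC x (s.cvar y + s.cvar z)
  | .sub x y z => s.setC x (s.cvar y - s.cvar z)
  | .mul x y z => s.setC x (s.cvar y * s.cvar z)
  | .div x y z => s.setC x (s.cvar y / s.cvar z)
  | .conj x y => s.setC x (starRingEnd ℂ (s.cvar y))
  | .cget x a i => (s.setC x (s.carr a (s.ivar i))).touch (s.ivar i)
  | .cput a i x => (s.setCArr a (s.ivar i) (s.cvar x)).touch (s.ivar i)
  | .input x i j => s.setC x (entryOrZero A (s.ivar i) (s.ivar j))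
  | .rand x => { s.setC x (((ω s.drawn : unitInterval) : ℝ) : ℂ) with drawn := s.drawn + 1 }
  | .emit x => { s with out := s.out ++ [s.ivar x] }

/-- A test succeeds. -/
def Test.Holds {d : ℕ} (s : MState d) : Test d → Prop
  | .ilt x y => s.ivar x < s.ivar y
  | .ieq x y => s.ivar x = s.ivar y
  | .clt x y => (s.cvar x).re < (s.cvar y).re

/-- `Run A ω p s s'`: on input `A` with random numbers `ω`, the program `p`, started in the state
`s`, halts in the state `s'`. Every instruction and every test takes one unit of time. -/
inductive Run {d m n : ℕ} (A : Matrix (Fin m) (Fin n) ℂ) (ω : ℕ → unitInterval) :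
    Prog d → MState d → MState d → Prop
  | instr (i : Instr d) (s : MState d) : Run A ω (.instr i) s (i.effect A ω s).tick
  | seq {p q : Prog d} {s s' s'' : MState d} :
      Run A ω p s s' → Run A ω q s' s'' → Run A ω (.seq p q) s s''
  | ite_true {t : Test d} {p q : Prog d} {s s' : MState d} :
      t.Holds s → Run A ω p s.tick s' → Run A ω (.ite t p q) s s'
  | ite_false {t : Test d} {p q : Prog d} {s s' : MState d} :
      ¬ t.Holds s → Run A ω q s.tick s' → Run A ω (.ite t p q) s s'
  | while_true {t : Test d} {p : Prog d} {s s' s'' : MState d} :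
      t.Holds s → Run A ω p s.tick s' → Run A ω (.while t p) s' s'' →
        Run A ω (.while t p) s s''
  | while_false {t : Test d} {p : Prog d} {s : MState d} :
      ¬ t.Holds s → Run A ω (.while t p) s s.tick

/-- The program `p` halts on input `A` with random numbers `ω`, and `s` is its final state. -/
def HaltsIn {d m n : ℕ} (p : Prog d) (A : Matrix (Fin m) (Fin n) ℂ) (ω : ℕ → unitInterval)
    (s : MState d) : Prop :=
  Run A ω p (MState.init d) s

/-- The running time of `p` on input `A` with random numbers `ω`, infinite if `p` does not halt
(the final state is unique if it exists). -/
def runTime {d m n : ℕ} (p : Prog d) (A : Matrix (Fin m) (Fin n) ℂ) (ω : ℕ → unitInterval) :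
    ℝ≥0∞ :=
  ⨅ (s : MState d) (_ : HaltsIn p A ω s), (s.clock : ℝ≥0∞)

/-- The law of a sequence of independent random numbers, uniform on `[0,1]`. -/
def uniformSeq : Measure (ℕ → unitInterval) :=
  Measure.infinitePi fun _ => (volume : Measure unitInterval)

end

/-! Let `amp a m σ c` be the coefficient of x^σ in the product over j in c of the linear forms ∑
a_ij x_i, and `weight` the number σ!·|amp|², where σ! is the product of the factorials of the
occupation numbers. A permanent with rows repeated according to σ is σ!·amp (`permanent_eq`), so for
c = all n columns `weight` is the boson sampling probability (`bosonPMF_eq_weight`).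

The sampler keeps a set c of columns and a multiset σ of rows. Each step adds a uniformly random
unused column to c, then a row i with probability proportional to |∑_{l∈c} a_il per(σ, c∖l)|². By
Laplace expansion (`amp_add_single`) this is a multiple of (σ_i+1)·weight(σ+e_i, c). The claim is
that the state after k steps has probability weight(σ, c)/C(n,k) (`chain_law`). The reason is that,
by orthonormality of the columns, the normalising constant of the row draw is σ!·∑_{l∈c} weight(σ,
c∖l) (`OrthonormalCols.sum_rowWeight`). The same sum appears when the law of the previous state is
summed over the column l added last, so the two cancel (`sum_step_eq`).

All minors per(σ, c∖l) come from one sum over 0 ≤ t ≤ σ with ∏(σ_i+1) terms. The signed binomial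
coefficients form a mixed finite difference of order σ, which kills every monomial of degree |σ|
except x^σ (`sum_signedChoose_mul_eval`, `ryser_eq`). For each t, prefix and suffix products give
the terms of all minors in O(n) operations. The t are run through by an odometer, whose amortised
cost is O(m+n) per term (`advance_spec`, `minors_spec`); only array cells with index below m are
used.

For Haar random A with m = n, the mean of weight(σ, c) is the same for all σ of size |c|
(`integral_weight_eq`). Indeed, phase invariance makes different coefficients orthogonal, and
rotating a real vector x to an axis shows that the mean of |∏_j ∑_i a_ij x_i|² is a constant times
(∑ x_i²)^|c|; comparing coefficients gives the claim. Hence σ is uniform on multisets of size k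
after k steps (`lintegral_haar_chain`), and the mean number of terms is C(2n-1+k,k)/C(n-1+k,k). For
k < n these numbers grow by a factor of at least 3/2 per step, and at k = n the value is at most
2(27/16)^(n-1). So their sum is O((27/16)^n), and each term costs O(n). -/

/-! ### Determinism, frame conditions and loop rules for the machine -/

section Machine

variable {d m n : ℕ} {A : Matrix (Fin m) (Fin n) ℂ} {ω : ℕ → unitInterval}

/-- Programs are deterministic. -/
theorem Run.det {p : Prog d} {s s₁ s₂ : MState d} (h₁ : Run A ω p s s₁) (h₂ : Run A ω p s s₂) :
    s₁ = s₂ := by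
  induction h₁ generalizing s₂ with
  | instr i s => cases h₂; rfl
  | seq _ _ ih₁ ih₂ =>
    cases h₂ with
    | seq a b => exact ih₂ (ih₁ a ▸ b)
  | ite_true ht _ ih =>
    cases h₂ with
    | ite_true _ a => exact ih a
    | ite_false hf _ => exact absurd ht hf
  | ite_false hf _ ih =>
    cases h₂ with
    | ite_true ht _ => exact absurd ht hf
    | ite_false _ a => exact ih a
  | while_true ht _ _ ih₁ ih₂ =>
    cases h₂ with
    | while_true _ a b => exact ih₂ (ih₁ a ▸ b)
    | while_false hf => exact absurd ht hf
  | while_false hf =>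
    cases h₂ with
    | while_true ht _ _ => exact absurd ht hf
    | while_false _ => rfl

/-- The integer variable `y` is a target of the instruction. -/
def Instr.writesI (y : Fin d) : Instr d → Bool
  | .iconst x _ | .icopy x _ | .inc x | .dec x | .rows x | .cols x | .iget x _ _ => decide (y = x)
  | _ => false

/-- The complex variable `y` is a target of the instruction. -/
def Instr.writesC (y : Fin d) : Instr d → Bool
  | .ccast x _ | .ccopy x _ | .add x _ _ | .sub x _ _ | .mul x _ _ | .div x _ _ | .conj x _
  | .cget x _ _ | .input x _ _ | .rand x => decide (y = x)
  | _ => false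

/-- The integer array `b` is a target of the instruction. -/
def Instr.writesIArr (b : Fin d) : Instr d → Bool
  | .iput a _ _ => decide (b = a)
  | _ => false

/-- The complex array `b` is a target of the instruction. -/
def Instr.writesCArr (b : Fin d) : Instr d → Bool
  | .cput a _ _ => decide (b = a)
  | _ => false

/-- The instruction draws a random number. -/
def Instr.draws : Instr d → Bool
  | .rand _ => true
  | _ => false

/-- The instruction produces output. -/
def Instr.emits : Instr d → Bool
  | .emit _ => true
  | _ => false

/-- Some instruction of the program satisfies `f`. -/
def Prog.any (f : Instr d → Bool) : Prog d → Bool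
  | .instr i => f i
  | .seq p q => p.any f || q.any f
  | .ite _ p q => p.any f || q.any f
  | .while _ p => p.any f

/-- Only the variables and arrays that are targets in the program `p` differ between `s` and
`s'`. -/
structure Frame (p : Prog d) (s s' : MState d) : Prop where
  ivar : ∀ y, p.any (Instr.writesI y) = false → s'.ivar y = s.ivar y
  cvar : ∀ y, p.any (Instr.writesC y) = false → s'.cvar y = s.cvar y
  iarr : ∀ y, p.any (Instr.writesIArr y) = false → s'.iarr y = s.iarr y
  carr : ∀ y, p.any (Instr.writesCArr y) = false → s'.carr y = s.carr y
  drawn : p.any Instr.draws = false → s'.drawn = s.drawn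
  out : p.any Instr.emits = false → s'.out = s.out

theorem Frame.rfl' {p : Prog d} {s : MState d} : Frame p s s :=
  ⟨fun _ _ => rfl, fun _ _ => rfl, fun _ _ => rfl, fun _ _ => rfl, fun _ => rfl, fun _ => rfl⟩

theorem Frame.trans {p : Prog d} {s s' s'' : MState d} (h : Frame p s s') (h' : Frame p s' s'') :
    Frame p s s'' :=
  ⟨fun y hy => (h'.ivar y hy).trans (h.ivar y hy), fun y hy => (h'.cvar y hy).trans (h.cvar y hy),
    fun y hy => (h'.iarr y hy).trans (h.iarr y hy), fun y hy => (h'.carr y hy).trans (h.carr y hy),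
    fun hy => (h'.drawn hy).trans (h.drawn hy), fun hy => (h'.out hy).trans (h.out hy)⟩

theorem Frame.mono {p q : Prog d} {s s' : MState d} (h : Frame p s s')
    (hpq : ∀ f : Instr d → Bool, q.any f = false → p.any f = false) : Frame q s s' :=
  ⟨fun y hy => h.ivar y (hpq _ hy), fun y hy => h.cvar y (hpq _ hy),
    fun y hy => h.iarr y (hpq _ hy), fun y hy => h.carr y (hpq _ hy),
    fun hy => h.drawn (hpq _ hy), fun hy => h.out (hpq _ hy)⟩

theorem Frame.tick {p : Prog d} {s s' : MState d} (h : Frame p s s') : Frame p s s'.tick :=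
  ⟨h.ivar, h.cvar, h.iarr, h.carr, h.drawn, h.out⟩

theorem Frame.of_tick {p : Prog d} {s s' : MState d} (h : Frame p s.tick s') : Frame p s s' :=
  ⟨h.ivar, h.cvar, h.iarr, h.carr, h.drawn, h.out⟩

theorem Frame.effect (i : Instr d) (s : MState d) :
    Frame (.instr i) s (i.effect A ω s).tick := by
  constructor <;> intros <;> cases i <;>
    simp_all [Prog.any, Instr.writesI, Instr.writesC, Instr.writesIArr, Instr.writesCArr,
      Instr.draws, Instr.emits, Instr.effect, MState.tick, MState.touch, MState.setI,
      MState.setC, MState.setIArr, MState.setCArr]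

/-- What a program may change is decided by a Boolean computation on its syntax. Specifications
therefore need not list what stays fixed; it is recovered later with `rfl` as side condition. -/
theorem Run.frame {p : Prog d} {s s' : MState d} (h : Run A ω p s s') : Frame p s s' := by
  induction h with
  | instr i s => exact .effect i s
  | seq _ _ ih₁ ih₂ =>
    exact Frame.trans (Frame.mono ih₁ fun f hf => (Bool.or_eq_false_iff.mp hf).1)
      (Frame.mono ih₂ fun f hf => (Bool.or_eq_false_iff.mp hf).2)
  | ite_true _ _ ih =>
    exact Frame.of_tick (Frame.mono ih fun f hf => (Bool.or_eq_false_iff.mp hf).1)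
  | ite_false _ _ ih =>
    exact Frame.of_tick (Frame.mono ih fun f hf => (Bool.or_eq_false_iff.mp hf).2)
  | while_true _ _ _ ih₁ ih₂ =>
    exact Frame.trans (Frame.of_tick (ih₁.mono fun f hf => hf)) ih₂
  | while_false _ => exact Frame.rfl'.tick

/-- The program `p`, started in `s`, halts in a state that satisfies `Q`. -/
def Reaches (A : Matrix (Fin m) (Fin n) ℂ) (ω : ℕ → unitInterval) (p : Prog d)
    (Q : MState d → Prop) (s : MState d) : Prop :=
  ∃ s', Run A ω p s s' ∧ Q s'

/-- With the rules for sequences and branches, this makes loop-free code equivalent to a condition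
on the start state, so that `simp only` executes it symbolically. Only loops need invariants. -/
theorem reaches_instr {i : Instr d} {Q : MState d → Prop} {s : MState d} :
    Reaches A ω (.instr i) Q s ↔ Q (i.effect A ω s).tick := by
  constructor
  · rintro ⟨s', h, hQ⟩
    cases h; exact hQ
  · exact fun h => ⟨_, .instr i s, h⟩

theorem reaches_seq {p q : Prog d} {Q : MState d → Prop} {s : MState d} :
    Reaches A ω (.seq p q) Q s ↔ Reaches A ω p (Reaches A ω q Q) s := by
  constructor
  · rintro ⟨s', h, hQ⟩
    cases h with
    | seq a b => exact ⟨_, a, _, b, hQ⟩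
  · rintro ⟨s', a, s'', b, hQ⟩
    exact ⟨s'', .seq a b, hQ⟩

theorem reaches_ite {t : Test d} {p q : Prog d} {Q : MState d → Prop} {s : MState d} :
    Reaches A ω (.ite t p q) Q s ↔
      (t.Holds s → Reaches A ω p Q s.tick) ∧ (¬ t.Holds s → Reaches A ω q Q s.tick) := by
  constructor
  · rintro ⟨s', h, hQ⟩
    cases h with
    | ite_true ht a => exact ⟨fun _ => ⟨_, a, hQ⟩, fun hf => absurd ht hf⟩
    | ite_false hf a => exact ⟨fun ht => absurd ht hf, fun _ => ⟨_, a, hQ⟩⟩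
  · rintro ⟨h₁, h₂⟩
    by_cases ht : t.Holds s
    · obtain ⟨s', a, hQ⟩ := h₁ ht
      exact ⟨s', .ite_true ht a, hQ⟩
    · obtain ⟨s', a, hQ⟩ := h₂ ht
      exact ⟨s', .ite_false ht a, hQ⟩

theorem Reaches.mono {p : Prog d} {Q Q' : MState d → Prop} {s : MState d}
    (h : Reaches A ω p Q s) (hQ : ∀ s', Frame p s s' → Q s' → Q' s') : Reaches A ω p Q' s := by
  obtain ⟨s', a, b⟩ := h
  exact ⟨s', a, hQ s' a.frame b⟩

/-- Loop rule: `I` is an invariant with the iteration number as a parameter, and at most `N`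
iterations are possible. -/
theorem reaches_while {t : Test d} {p : Prog d} (I : ℕ → MState d → Prop) (N : ℕ)
    {Q : MState d → Prop} {s₀ : MState d} (h₀ : I 0 s₀)
    (hstep : ∀ i s, Frame (.while t p) s₀ s → I i s → t.Holds s →
      i < N ∧ Reaches A ω p (I (i + 1)) s.tick)
    (hQ : ∀ i s, Frame (.while t p) s₀ s → I i s → ¬ t.Holds s → Q s.tick) :
    Reaches A ω (.while t p) Q s₀ := by
  -- Here `j` is fuel. With `N + 1` units, running out means `i = N + 1`, where a successful test
  -- contradicts `i < N`.
  have key : ∀ j i s, i + j = N + 1 → Frame (.while t p) s₀ s → I i s →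
      Reaches A ω (.while t p) Q s := by
    intro j
    induction j with
    | zero =>
      intro i s hij hF hI
      by_cases ht : t.Holds s
      · have := (hstep i s hF hI ht).1
        omega
      · exact ⟨_, .while_false ht, hQ i s hF hI ht⟩
    | succ j ih =>
      intro i s hij hF hI
      by_cases ht : t.Holds s
      · obtain ⟨-, s', hr, hI'⟩ := hstep i s hF hI ht
        obtain ⟨s'', hr', hq⟩ := ih (i + 1) s' (by omega)
          (hF.trans (Frame.of_tick (Frame.mono hr.frame fun f hf => hf))) hI'
        exact ⟨s'', .while_true ht hr hr', hq⟩
      · exact ⟨_, .while_false ht, hQ i s hF hI ht⟩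
  exact key (N + 1) 0 s₀ (by omega) .rfl' h₀

/-- `for x := 0 to b - 1 do p`. -/
def forLoop (x b : Fin d) (p : Prog d) : Prog d :=
  .seq (.instr (.iconst x 0)) (.while (.ilt x b) (.seq p (.instr (.inc x))))

/-- Rule for `forLoop` with an invariant `I`. -/
theorem reaches_for {x b : Fin d} {p : Prog d} (I : ℕ → MState d → Prop) {N : ℕ}
    {s₀ : MState d} (hN : s₀.ivar b = N) (hxb : b ≠ x)
    (hx : p.any (Instr.writesI x) = false) (hb : p.any (Instr.writesI b) = false)
    (h₀ : I 0 (s₀.setI x 0).tick)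
    (hstep : ∀ i s, i < N → Frame (forLoop x b p) s₀ s → s.ivar x = i → I i s →
      Reaches A ω p (fun s' => I (i + 1) (s'.setI x (i + 1)).tick) s.tick)
    {Q : MState d → Prop}
    (hQ : ∀ s, Frame (forLoop x b p) s₀ s → I N s → Q s.tick) :
    Reaches A ω (forLoop x b p) Q s₀ := by
  rw [forLoop, reaches_seq, reaches_instr]
  have hb' : (forLoop x b p).any (Instr.writesI b) = false := by
    simp [forLoop, Prog.any, hb, Instr.writesI, hxb]
  have hF₀ : Frame (forLoop x b p) s₀ (s₀.setI x 0).tick :=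
    (Frame.effect (A := A) (ω := ω) (.iconst x 0) s₀).mono fun f hf =>
      (Bool.or_eq_false_iff.mp hf).1
  have hF : ∀ s, Frame (.while (.ilt x b) (.seq p (.instr (.inc x)))) (s₀.setI x 0).tick s →
      Frame (forLoop x b p) s₀ s := fun s hs =>
    hF₀.trans (hs.mono fun f hf => (Bool.or_eq_false_iff.mp hf).2)
  refine reaches_while (fun i s => s.ivar x = i ∧ i ≤ N ∧ I i s) N
    ⟨by simp [Instr.effect, MState.tick, MState.setI], Nat.zero_le _, h₀⟩ ?_ ?_
  · rintro i s hs ⟨hxi, hiN, hI⟩ ht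
    have hs' := hF s hs
    have hlt : i < N := by
      have : s.ivar x < s.ivar b := ht
      rwa [hxi, hs'.ivar b hb', hN] at this
    refine ⟨hlt, ?_⟩
    rw [reaches_seq]
    refine (hstep i s hlt hs' hxi hI).mono fun s' hp hI' => ?_
    rw [reaches_instr]
    have hx' : s'.ivar x = i := (hp.ivar x hx).trans hxi
    simp only [Instr.effect, hx']
    exact ⟨by simp [MState.tick, MState.setI], hlt, hI'⟩
  · rintro i s hs ⟨hxi, hiN, hI⟩ ht
    have hs' := hF s hs
    have : ¬ s.ivar x < s.ivar b := ht
    rw [hxi, hs'.ivar b hb', hN] at this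
    obtain rfl : i = N := by omega
    exact hQ s hs' hI

/-- Rule for `forLoop` with an invariant `I` and a bound `T` for the time of an iteration; no cells
with an index `M` or higher are accessed. -/
theorem reaches_for_time {x b : Fin d} {p : Prog d} (I : ℕ → MState d → Prop) {N : ℕ} (T M : ℕ)
    {s₀ : MState d} (hN : s₀.ivar b = N) (hxb : b ≠ x)
    (hx : p.any (Instr.writesI x) = false) (hb : p.any (Instr.writesI b) = false)
    (htop : s₀.top ≤ M) (h₀ : I 0 (s₀.setI x 0).tick)
    (hstep : ∀ i s, i < N → Frame (forLoop x b p) s₀ s → s.ivar x = i → I i s → s.top ≤ M →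
      Reaches A ω p (fun s' => I (i + 1) (s'.setI x (i + 1)).tick ∧
        s'.clock ≤ s.clock + 1 + T ∧ s'.top ≤ M) s.tick)
    {Q : MState d → Prop}
    (hQ : ∀ s, Frame (forLoop x b p) s₀ s → I N s → s.top ≤ M →
      s.clock + 1 ≤ s₀.clock + (N * (T + 2) + 2) → Q s.tick) :
    Reaches A ω (forLoop x b p) Q s₀ := by
  -- An iteration costs the body plus one test and one increment, hence `T + 2`. The extra one is
  -- the initialisation; the final failing test is charged at the exit.
  refine reaches_for (fun i s => I i s ∧ s.top ≤ M ∧ s.clock ≤ s₀.clock + (i * (T + 2) + 1)) hN hxb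
    hx hb ⟨h₀, htop, ?_⟩ ?_ ?_
  · simp [MState.tick, MState.setI]
  · rintro i s hi hF hxi ⟨hI, ht, hc⟩
    refine (hstep i s hi hF hxi hI ht).mono fun s' _ h => ⟨h.1, h.2.2, ?_⟩
    have h2 := h.2.1
    simp only [MState.tick, MState.setI, add_mul] at h2 ⊢
    omega
  · rintro s hF ⟨hI, ht, hc⟩
    exact hQ s hF hI ht (by omega)

end Machine

/-! ### The program -/

/-! ### Fields of an updated state as rewriting rules. -/

section SimpLemmas

variable {d : ℕ} (s : MState d) (x y : Fin d) (k v : ℕ) (z : ℂ)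

@[simp] theorem MState.tick_ivar : s.tick.ivar = s.ivar := rfl
@[simp] theorem MState.tick_cvar : s.tick.cvar = s.cvar := rfl
@[simp] theorem MState.tick_iarr : s.tick.iarr = s.iarr := rfl
@[simp] theorem MState.tick_carr : s.tick.carr = s.carr := rfl
@[simp] theorem MState.tick_drawn : s.tick.drawn = s.drawn := rfl
@[simp] theorem MState.tick_out : s.tick.out = s.out := rfl
@[simp] theorem MState.tick_clock : s.tick.clock = s.clock + 1 := rfl
@[simp] theorem MState.tick_top : s.tick.top = s.top := rfl
@[simp] theorem MState.touch_ivar : (s.touch k).ivar = s.ivar := rfl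
@[simp] theorem MState.touch_cvar : (s.touch k).cvar = s.cvar := rfl
@[simp] theorem MState.touch_iarr : (s.touch k).iarr = s.iarr := rfl
@[simp] theorem MState.touch_carr : (s.touch k).carr = s.carr := rfl
@[simp] theorem MState.touch_drawn : (s.touch k).drawn = s.drawn := rfl
@[simp] theorem MState.touch_out : (s.touch k).out = s.out := rfl
@[simp] theorem MState.touch_clock : (s.touch k).clock = s.clock := rfl
@[simp] theorem MState.touch_top : (s.touch k).top = max s.top (k + 1) := rfl
@[simp] theorem MState.setI_ivar :
    (s.setI x v).ivar y = if y = x then v else s.ivar y := Function.update_apply ..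
@[simp] theorem MState.setI_cvar : (s.setI x v).cvar = s.cvar := rfl
@[simp] theorem MState.setI_iarr : (s.setI x v).iarr = s.iarr := rfl
@[simp] theorem MState.setI_carr : (s.setI x v).carr = s.carr := rfl
@[simp] theorem MState.setI_drawn : (s.setI x v).drawn = s.drawn := rfl
@[simp] theorem MState.setI_out : (s.setI x v).out = s.out := rfl
@[simp] theorem MState.setI_clock : (s.setI x v).clock = s.clock := rfl
@[simp] theorem MState.setI_top : (s.setI x v).top = s.top := rfl
@[simp] theorem MState.setC_cvar :
    (s.setC x z).cvar y = if y = x then z else s.cvar y := Function.update_apply ..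
@[simp] theorem MState.setC_ivar : (s.setC x z).ivar = s.ivar := rfl
@[simp] theorem MState.setC_iarr : (s.setC x z).iarr = s.iarr := rfl
@[simp] theorem MState.setC_carr : (s.setC x z).carr = s.carr := rfl
@[simp] theorem MState.setC_drawn : (s.setC x z).drawn = s.drawn := rfl
@[simp] theorem MState.setC_out : (s.setC x z).out = s.out := rfl
@[simp] theorem MState.setC_clock : (s.setC x z).clock = s.clock := rfl
@[simp] theorem MState.setC_top : (s.setC x z).top = s.top := rfl
@[simp] theorem MState.setIArr_iarr : (s.setIArr x k v).iarr y =
    if y = x then Function.update (s.iarr x) k v else s.iarr y := Function.update_apply ..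
@[simp] theorem MState.setIArr_ivar : (s.setIArr x k v).ivar = s.ivar := rfl
@[simp] theorem MState.setIArr_cvar : (s.setIArr x k v).cvar = s.cvar := rfl
@[simp] theorem MState.setIArr_carr : (s.setIArr x k v).carr = s.carr := rfl
@[simp] theorem MState.setIArr_drawn : (s.setIArr x k v).drawn = s.drawn := rfl
@[simp] theorem MState.setIArr_out : (s.setIArr x k v).out = s.out := rfl
@[simp] theorem MState.setIArr_clock : (s.setIArr x k v).clock = s.clock := rfl
@[simp] theorem MState.setIArr_top : (s.setIArr x k v).top = s.top := rfl
@[simp] theorem MState.setCArr_carr : (s.setCArr x k z).carr y =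
    if y = x then Function.update (s.carr x) k z else s.carr y := Function.update_apply ..
@[simp] theorem MState.setCArr_ivar : (s.setCArr x k z).ivar = s.ivar := rfl
@[simp] theorem MState.setCArr_cvar : (s.setCArr x k z).cvar = s.cvar := rfl
@[simp] theorem MState.setCArr_iarr : (s.setCArr x k z).iarr = s.iarr := rfl
@[simp] theorem MState.setCArr_drawn : (s.setCArr x k z).drawn = s.drawn := rfl
@[simp] theorem MState.setCArr_out : (s.setCArr x k z).out = s.out := rfl
@[simp] theorem MState.setCArr_clock : (s.setCArr x k z).clock = s.clock := rfl
@[simp] theorem MState.setCArr_top : (s.setCArr x k z).top = s.top := rfl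

end SimpLemmas

namespace BosonSampling

/-- A sequence of instructions. -/
def block {d : ℕ} (i : Instr d) : List (Instr d) → Prog d
  | [] => .instr i
  | j :: l => .seq (.instr i) (block j l)

/-- An instruction without effect. -/
def skip : Prog 16 := .instr (.icopy 15 15)

/- Integer variables: 0 is `m`, 1 is `n`, 2 is zero, 3 is one, 4 is the step counter, 5 and 6 are
loop counters, 7 is the sampled index, 8 to 10 are temporary, 11 tells whether the odometer is
running, 12 is the number of weights of the sampler.
Complex variables: 0 is zero, 1 is one, the others are temporary.
Integer arrays: 0 is the multiset sampled so far, 1 is the odometer, 2 marks the chosen columns.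
Complex arrays: 0 holds weights, 1 the linear forms at the odometer, 2 prefix products, 3 the
minors, 4 signed binomial coefficients. -/

/-- The weights of the columns: one for those not chosen yet. -/
def colWeights : Prog 16 :=
  forLoop 6 1 (.seq (.instr (.iget 10 2 6)) (.seq
    (.ite (.ieq 10 2) (.instr (.ccopy 5 1)) (.instr (.ccopy 5 0))) (.instr (.cput 0 6 5))))

/-- Sample an index according to the weights. -/
def sample : Prog 16 :=
  .seq (.instr (.ccopy 2 0)) (.seq
  (forLoop 5 12 (block (.cget 5 0 5) [.add 2 2 5])) (.seq
  (block (.rand 3) [.mul 3 3 2, .ccopy 4 0, .iconst 7 0]) (.seq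
  (forLoop 5 12 (.seq (block (.cget 5 0 5) [.add 4 4 5])
    (.ite (.clt 3 4) skip (.instr (.inc 7)))))
  (.ite (.ilt 7 12) skip (.instr (.dec 7))))))

/-- Start the odometer. -/
def startOdometer : Prog 16 :=
  .seq (forLoop 5 0 (block (.iput 1 5 2) [.cput 4 5 1]))
    (forLoop 6 1 (block (.cput 1 6 0) [.cput 3 6 0]))

/-- The product of the signed binomial coefficients. -/
def termCoeff : Prog 16 :=
  .seq (.instr (.ccopy 9 1)) (forLoop 5 0 (block (.cget 5 4 5) [.mul 9 9 5]))

/-- The products of the linear forms of the chosen columns in front of a column. -/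
def prefixProds : Prog 16 :=
  .seq (.instr (.ccopy 8 1)) (forLoop 6 1 (.seq (block (.cput 2 6 8) [.iget 10 2 6])
    (.ite (.ieq 10 2) skip (block (.cget 5 1 6) [.mul 8 8 5]))))

/-- Add the current term to the minors. -/
def addTerm : Prog 16 :=
  -- Integer variable 6 runs down from n. Complex variable 9 enters as the coefficient of the term
  -- and collects the linear forms of the chosen columns behind column 6; times the prefix product
  -- it is the term without that column.
  .seq (.instr (.icopy 6 1)) (forLoop 5 1 (.seq
    (block (.dec 6) [.cget 5 2 6, .mul 5 5 9, .cget 6 3 6, .add 6 6 5, .cput 3 6 6, .iget 10 2 6])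
    (.ite (.ieq 10 2) skip (block (.cget 5 1 6) [.mul 9 9 5]))))

/-- Increase the digit 5 of the odometer. -/
def bumpDigit : Prog 16 :=
  .seq (block (.ccast 5 8) [.ccast 6 9, .sub 6 5 6, .inc 8, .iput 1 5 8, .ccast 5 8, .div 6 6 5,
    .cget 7 4 5, .mul 7 7 6, .cput 4 5 7, .iconst 11 1])
  (forLoop 6 1 (block (.input 5 5 6) [.cget 6 1 6, .add 6 6 5, .cput 1 6 6]))

/-- Set the digit 5 of the odometer to zero. -/
def resetDigit : Prog 16 :=
  .seq (block (.iput 1 5 2) [.cput 4 5 1, .ccast 7 9])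
  (forLoop 6 1 (block (.input 5 5 6) [.mul 5 5 7, .cget 6 1 6, .sub 6 6 5, .cput 1 6 6]))

/-- Advance the odometer. -/
def advance : Prog 16 :=
  -- Flag 11 is zero while the carry is still travelling, and still zero at the end exactly on
  -- overflow. Digits with bound zero are skipped, so only non-zero digits are ever reset; the
  -- amortised bound needs this.
  .seq (.instr (.iconst 11 0)) (forLoop 5 0 (.ite (.ieq 11 2)
    (.seq (block (.iget 8 1 5) [.iget 9 0 5])
      (.ite (.ilt 8 9) bumpDigit (.ite (.ilt 2 9) resetDigit skip)))
    skip))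

/-- The minors. -/
def minors : Prog 16 :=
  .seq startOdometer (.seq (.instr (.iconst 11 1))
    (.while (.ieq 11 3) (.seq termCoeff (.seq prefixProds (.seq addTerm advance)))))

/-- The weights of the rows. -/
def rowWeights : Prog 16 :=
  forLoop 5 0 (.seq (.instr (.ccopy 2 0)) (.seq
    (forLoop 6 1 (.seq (.instr (.iget 10 2 6))
      (.ite (.ieq 10 2) skip (block (.input 5 5 6) [.cget 6 3 6, .mul 5 5 6, .add 2 2 5]))))
    (block (.conj 3 2) [.mul 2 2 3, .cput 0 5 2])))

/-- One step of the sampling algorithm. -/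
def step : Prog 16 :=
  .seq (.instr (.icopy 12 1)) (.seq colWeights (.seq sample (.seq (.instr (.iput 2 7 3)) (.seq minors
  (.seq rowWeights (.seq (.instr (.icopy 12 0)) (.seq sample
  (block (.iget 8 0 7) [.inc 8, .iput 0 7 8]))))))))

/-- Output of the sampled multiset in increasing order. -/
def output : Prog 16 :=
  forLoop 5 0 (.seq (.instr (.iget 8 0 5)) (forLoop 6 8 (.instr (.emit 5))))

/-- The sampling algorithm. -/
def sampler : Prog 16 :=
  .seq (block (.rows 0) [.cols 1, .iconst 3 1, .ccast 1 3]) (.seq (forLoop 4 1 step) output)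

/-! ### Its correctness -/

/-- The constants are in place. -/
structure Base (m n : ℕ) (s : MState 16) : Prop where
  rows : s.ivar 0 = m
  cols : s.ivar 1 = n
  izero : s.ivar 2 = 0
  ione : s.ivar 3 = 1
  czero : s.cvar 0 = 0
  cone : s.cvar 1 = 1

/-- The program does not change the constants. -/
def KeepsBase (p : Prog 16) : Prop :=
  p.any (Instr.writesI 0) = false ∧ p.any (Instr.writesI 1) = false ∧
  p.any (Instr.writesI 2) = false ∧ p.any (Instr.writesI 3) = false ∧
  p.any (Instr.writesC 0) = false ∧ p.any (Instr.writesC 1) = false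

theorem Base.frame {m n : ℕ} {p : Prog 16} {s s' : MState 16} (h : Base m n s)
    (hF : Frame p s s') (hp : KeepsBase p) : Base m n s' :=
  ⟨(hF.ivar 0 hp.1).trans h.rows, (hF.ivar 1 hp.2.1).trans h.cols,
    (hF.ivar 2 hp.2.2.1).trans h.izero, (hF.ivar 3 hp.2.2.2.1).trans h.ione,
    (hF.cvar 0 hp.2.2.2.2.1).trans h.czero, (hF.cvar 1 hp.2.2.2.2.2).trans h.cone⟩

theorem Base.tick {m n : ℕ} {s : MState 16} (h : Base m n s) : Base m n s.tick :=
  ⟨h.rows, h.cols, h.izero, h.ione, h.czero, h.cone⟩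

theorem Base.setC {m n : ℕ} {s : MState 16} (h : Base m n s) {x : Fin 16} (hx : 2 ≤ x) (v : ℂ) :
    Base m n (s.setC x v).tick := by
  have h0 : (0 : Fin 16) ≠ x := by rintro rfl; exact absurd hx (by decide)
  have h1 : (1 : Fin 16) ≠ x := by rintro rfl; exact absurd hx (by decide)
  exact ⟨h.rows, h.cols, h.izero, h.ione, by simpa [h0] using h.czero, by simpa [h1] using h.cone⟩

theorem Base.setI {m n : ℕ} {s : MState 16} (h : Base m n s) {x : Fin 16} (hx : 4 ≤ x) (v : ℕ) :
    Base m n (s.setI x v).tick := by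
  have h0 : (0 : Fin 16) ≠ x := by rintro rfl; exact absurd hx (by decide)
  have h1 : (1 : Fin 16) ≠ x := by rintro rfl; exact absurd hx (by decide)
  have h2 : (2 : Fin 16) ≠ x := by rintro rfl; exact absurd hx (by decide)
  have h3 : (3 : Fin 16) ≠ x := by rintro rfl; exact absurd hx (by decide)
  exact ⟨by simpa [h0] using h.rows, by simpa [h1] using h.cols, by simpa [h2] using h.izero,
    by simpa [h3] using h.ione, h.czero, h.cone⟩

variable {m n : ℕ} {A : Matrix (Fin m) (Fin n) ℂ} {ω : ℕ → unitInterval} {s : MState 16}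

theorem reaches_skip {Q : MState 16 → Prop} :
    Reaches A ω skip Q s ↔ Q (s.setI 15 (s.ivar 15)).tick := reaches_instr

-- This is the goal left by a loop that writes cell `i` in iteration `i`, once simp has turned `j <
-- i + 1` into `j ≤ i`: it splits into the old invariant and the value just written.
@[simp] theorem forall_le_update_iff {α : Type*} (f g : ℕ → α) (i : ℕ) (v : α) :
    (∀ j ≤ i, Function.update f i v j = g j) ↔ (∀ j < i, f j = g j) ∧ v = g i := by
  refine ⟨fun h => ⟨fun j hj => ?_, by simpa using h i le_rfl⟩, fun h j hj => ?_⟩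
  · simpa [hj.ne] using h j hj.le
  · rcases hj.lt_or_eq with hj | rfl
    · simpa [hj.ne] using h.1 j hj
    · simpa using h.2

theorem colWeights_spec (hnm : n ≤ m) (hB : Base m n s) (ht : s.top ≤ m) :
    Reaches A ω colWeights (fun s' => (∀ j < n, s'.carr 0 j = if s.iarr 2 j = 0 then 1 else 0) ∧
      s'.clock ≤ s.clock + (n * 6 + 2) ∧ s'.top ≤ m) s := by
  refine reaches_for_time
    (fun i s' => ∀ j < i, s'.carr 0 j = if s.iarr 2 j = 0 then 1 else 0) 4 m hB.cols (by decide)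
    rfl rfl ht (by simp) ?_ ?_
  · intro i s' hi hF hx hI ht'
    have hB' := hB.frame hF ⟨rfl, rfl, rfl, rfl, rfl, rfl⟩
    have hf := hF.iarr 2 rfl
    simp only [reaches_seq, reaches_instr, reaches_ite, Instr.effect, Test.Holds]
    simp [hf, hB'.izero, hB'.cone, hB'.czero, hx]
    constructor <;> intro h <;> exact ⟨⟨hI, by simp [h]⟩, by omega, by omega⟩
  · intro s' hF hI ht' hc
    exact ⟨hI, hc, ht'⟩

/-- The index that the sampler chooses for the weights `w 0, …, w (N - 1)` if the random number
is `u`. -/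
noncomputable def pick (w : ℕ → ℝ) (N : ℕ) (u : ℝ) : ℕ :=
  -- For non-negative weights the count reaches `N`, and the cap acts, only if `u = 1` or the total
  -- weight is zero. The cap keeps the index valid for all random numbers.
  min ((Finset.range N).filter fun i =>
    ∑ q ∈ Finset.range (i + 1), w q ≤ u * ∑ q ∈ Finset.range N, w q).card (N - 1)

theorem pick_lt (w : ℕ → ℝ) {N : ℕ} (hN : 0 < N) (u : ℝ) : pick w N u < N :=
  (min_le_right _ _).trans_lt (Nat.sub_lt hN one_pos)

theorem sample_spec {N : ℕ} {w : ℕ → ℝ} (hN : s.ivar 12 = N) (hN0 : 0 < N) (hNm : N ≤ m)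
    (hB : Base m n s) (ht : s.top ≤ m) (hw : ∀ i < N, s.carr 0 i = (w i : ℂ)) :
    Reaches A ω sample (fun s' => s'.ivar 7 = pick w N (ω s.drawn) ∧ s'.drawn = s.drawn + 1 ∧
      s'.clock ≤ s.clock + (10 * N + 20) ∧ s'.top ≤ m) s := by
  rw [sample, reaches_seq, reaches_instr, reaches_seq]
  simp only [Instr.effect, hB.czero]
  refine reaches_for_time
    (fun i s' => s'.cvar 2 = ((∑ q ∈ Finset.range i, w q : ℝ) : ℂ)) 2 m (by simpa using hN)
    (by decide) rfl rfl (by exact ht) (by simp) ?_ ?_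
  · intro i s' hi hF hx hI ht'
    have hf : s'.carr 0 = s.carr 0 := hF.carr 0 rfl
    simp only [block, reaches_seq, reaches_instr, Instr.effect]
    simp [hf, hx, hI, hw i hi, Finset.sum_range_succ]
    omega
  intro s₁ hF₁ hI₁ ht₁ hc₁
  simp only [block, reaches_seq, reaches_instr, Instr.effect]
  have hB₁ : Base m n s₁ := (hB.setC (by decide) _).frame hF₁
    ⟨rfl, rfl, rfl, rfl, rfl, rfl⟩
  have hd₁ : s₁.drawn = s.drawn := hF₁.drawn rfl
  have hf₁ : s₁.carr 0 = s.carr 0 := hF₁.carr 0 rfl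
  have hN₁ : s₁.ivar 12 = N := by rw [hF₁.ivar 12 rfl]; simpa using hN
  simp at hc₁
  refine reaches_for_time (N := N)
    (fun i s' => s'.cvar 4 = ((∑ q ∈ Finset.range i, w q : ℝ) : ℂ) ∧
      s'.ivar 7 = ∑ i ∈ Finset.range i,
        if ∑ q ∈ Finset.range (i + 1), w q ≤ ω s.drawn * ∑ q ∈ Finset.range N, w q then 1 else 0)
    4 m (by simpa using hN₁) (by decide) rfl rfl (by exact ht₁) (by simp [hB₁.czero]) ?_ ?_
  · rintro i s' hi hF hx ⟨hI, hI'⟩ ht'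
    have hf : s'.carr 0 = s.carr 0 := (hF.carr 0 rfl).trans hf₁
    have hu : s'.cvar 3 = ((ω s.drawn * ∑ q ∈ Finset.range N, w q : ℝ) : ℂ) := by
      rw [hF.cvar 3 rfl]
      simp [hd₁, hI₁]
    simp only [reaches_seq, reaches_instr, reaches_ite, Instr.effect, Test.Holds, reaches_skip]
    simp only [Finset.sum_range_succ _ i]
    simp [hf, hx, hI, hw i hi, hu, -Finset.sum_boole, hI']
    constructor <;> intro h
    · exact ⟨h, by omega, by omega⟩
    · exact ⟨h, by omega, by omega⟩
  rintro s₂ hF₂ ⟨-, hI₂⟩ ht₂ hc₂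
  have hN₂ : s₂.ivar 12 = N := by rw [hF₂.ivar 12 rfl]; simpa using hN₁
  have hd₂ : s₂.drawn = s.drawn + 1 := by rw [hF₂.drawn rfl]; simp [hd₁]
  simp only [reaches_instr, reaches_ite, Instr.effect, Test.Holds, reaches_skip]
  simp at hc₂
  rw [← Finset.card_filter] at hI₂
  simp [hN₂, hd₂, hI₂, ht₂, pick]
  -- The count is at most `N`, so a single decrement realises the cap `N - 1`.
  have hle := Finset.card_filter_le (Finset.range N)
    (fun i => ∑ q ∈ Finset.range (i + 1), w q ≤ ω s.drawn * ∑ q ∈ Finset.range N, w q)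
  rw [Finset.card_range] at hle
  constructor <;> intro h <;> constructor <;> omega

end BosonSampling

/-! ### Subroutines for one term of the Ryser sum and for changing one digit. -/

namespace BosonSampling

variable {m n : ℕ} {A : Matrix (Fin m) (Fin n) ℂ} {ω : ℕ → unitInterval} {s : MState 16}

theorem startOdometer_spec (hnm : n ≤ m) (hB : Base m n s) (ht : s.top ≤ m) :
    Reaches A ω startOdometer (fun s' => (∀ i < m, s'.iarr 1 i = 0 ∧ s'.carr 4 i = 1) ∧
      (∀ j < n, s'.carr 1 j = 0 ∧ s'.carr 3 j = 0) ∧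
      s'.clock ≤ s.clock + (4 * m + 4 * n + 4) ∧ s'.top ≤ m) s := by
  rw [startOdometer, reaches_seq]
  refine reaches_for_time
    (fun i s' => (∀ j < i, s'.iarr 1 j = 0) ∧ (∀ j < i, s'.carr 4 j = 1)) 2 m hB.rows (by decide)
    rfl rfl ht (by simp) ?_ ?_
  · rintro i s' hi hF hx ⟨hI₁, hI₂⟩ ht'
    have hB' := hB.frame hF ⟨rfl, rfl, rfl, rfl, rfl, rfl⟩
    simp only [block, reaches_seq, reaches_instr, Instr.effect]
    simp [hB'.izero, hB'.cone, hx]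
    exact ⟨⟨hI₁, hI₂⟩, by omega⟩
  rintro s₁ hF₁ ⟨hI₁, hI₂⟩ ht₁ hc₁
  have hB₁ := (hB.frame hF₁ ⟨rfl, rfl, rfl, rfl, rfl, rfl⟩).tick
  refine reaches_for_time
    (fun i s' => (∀ j < i, s'.carr 1 j = 0) ∧ (∀ j < i, s'.carr 3 j = 0)) 2 m hB₁.cols (by decide)
    rfl rfl (by exact ht₁) (by simp) ?_ ?_
  · rintro i s' hi hF hx ⟨hI₁, hI₂⟩ ht'
    have hB' := hB₁.frame hF ⟨rfl, rfl, rfl, rfl, rfl, rfl⟩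
    simp only [block, reaches_seq, reaches_instr, Instr.effect]
    simp [hB'.czero, hx]
    exact ⟨⟨hI₁, hI₂⟩, by omega⟩
  rintro s₂ hF₂ ⟨hI₃, hI₄⟩ ht₂ hc₂
  have h1 : s₂.iarr 1 = s₁.iarr 1 := hF₂.iarr 1 rfl
  have h2 : s₂.carr 4 = s₁.carr 4 := hF₂.carr 4 rfl
  simp at hc₂
  simp [h1, h2]
  exact ⟨fun i hi => ⟨hI₁ i hi, hI₂ i hi⟩, fun i hi => ⟨hI₃ i hi, hI₄ i hi⟩, by omega, ht₂⟩

theorem termCoeff_spec {β : ℕ → ℂ} (hβ : ∀ i < m, s.carr 4 i = β i) (hB : Base m n s)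
    (ht : s.top ≤ m) :
    Reaches A ω termCoeff (fun s' => s'.cvar 9 = ∏ i ∈ Finset.range m, β i ∧
      s'.clock ≤ s.clock + (4 * m + 3) ∧ s'.top ≤ m) s := by
  rw [termCoeff, reaches_seq, reaches_instr]
  simp only [Instr.effect, hB.cone]
  refine reaches_for_time
    (fun i s' => s'.cvar 9 = ∏ i ∈ Finset.range i, β i) 2 m (by exact hB.rows) (by decide)
    rfl rfl (by exact ht) (by simp) ?_ ?_
  · rintro i s' hi hF hx hI ht'
    have hf : s'.carr 4 = s.carr 4 := hF.carr 4 rfl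
    simp only [block, reaches_seq, reaches_instr, Instr.effect]
    simp [hx, hf, hβ i hi, hI, Finset.prod_range_succ]
    omega
  · intro s' hF hI ht' hc
    simp at hc
    refine ⟨hI, ?_, ht'⟩
    simp
    omega

/-- The factor that column `j` contributes to a term. -/
def factor (c : Finset ℕ) (v : ℕ → ℂ) (j : ℕ) : ℂ := if j ∈ c then v j else 1

/-- The array 2 marks the columns in `c`. -/
def Marks (n : ℕ) (c : Finset ℕ) (s : MState 16) : Prop :=
  ∀ j < n, s.iarr 2 j = if j ∈ c then 1 else 0

theorem prefixProds_spec {c : Finset ℕ} {v : ℕ → ℂ} (hv : ∀ j < n, s.carr 1 j = v j)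
    (hc : Marks n c s) (hnm : n ≤ m) (hB : Base m n s) (ht : s.top ≤ m) :
    Reaches A ω prefixProds
      (fun s' => (∀ j < n, s'.carr 2 j = ∏ q ∈ Finset.range j, factor c v q) ∧
        s'.clock ≤ s.clock + (7 * n + 3) ∧ s'.top ≤ m) s := by
  rw [prefixProds, reaches_seq, reaches_instr]
  simp only [Instr.effect, hB.cone]
  have hB₁ : Base m n (s.setC 8 1).tick := hB.setC (by decide) _
  refine reaches_for_time
    (fun i s' => s'.cvar 8 = ∏ q ∈ Finset.range i, factor c v q ∧
      ∀ j < i, s'.carr 2 j = ∏ q ∈ Finset.range j, factor c v q) 5 m (by exact hB.cols) (by decide)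
    rfl rfl (by exact ht) (by simp) ?_ ?_
  · rintro i s' hi hF hx ⟨hI, hI'⟩ ht'
    have hB' := hB₁.frame hF ⟨rfl, rfl, rfl, rfl, rfl, rfl⟩
    have hf : s'.iarr 2 = s.iarr 2 := hF.iarr 2 rfl
    have hf' : s'.carr 1 = s.carr 1 := hF.carr 1 rfl
    have hci := hc i hi
    simp only [block, reaches_seq, reaches_instr, reaches_ite, reaches_skip, Instr.effect,
      Test.Holds]
    simp only [Finset.prod_range_succ _ i]
    simp [hx, hf, hf', hv i hi, hI, hB'.izero, hci]
    constructor <;> intro h <;> exact ⟨⟨by simp [h, factor], hI'⟩, by omega, by omega⟩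
  · rintro s' hF ⟨-, hI⟩ ht' hc
    simp at hc
    refine ⟨hI, ?_, ht'⟩
    simp
    omega

theorem addTerm_spec {c : Finset ℕ} {v P : ℕ → ℂ} {co : ℂ} (hv : ∀ j < n, s.carr 1 j = v j)
    (hP : ∀ j < n, s.carr 2 j = P j) (hco : s.cvar 9 = co)
    (hc : Marks n c s) (hnm : n ≤ m) (hB : Base m n s) (ht : s.top ≤ m) :
    Reaches A ω addTerm
      (fun s' => (∀ j < n, s'.carr 3 j =
          s.carr 3 j + P j * (co * ∏ q ∈ Finset.Ico (j + 1) n, factor c v q)) ∧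
        s'.clock ≤ s.clock + (12 * n + 3) ∧ s'.top ≤ m) s := by
  rw [addTerm, reaches_seq, reaches_instr]
  simp only [Instr.effect, hB.cols]
  have hB₁ : Base m n (s.setI 6 n).tick := hB.setI (by decide) _
  refine reaches_for_time
    (fun i s' => s'.ivar 6 = n - i ∧ s'.cvar 9 = co * ∏ q ∈ Finset.Ico (n - i) n, factor c v q ∧
      ∀ j < n, s'.carr 3 j = if n - i ≤ j then
        s.carr 3 j + P j * (co * ∏ q ∈ Finset.Ico (j + 1) n, factor c v q) else s.carr 3 j)
    10 m (by exact hB.cols) (by decide)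
    rfl rfl (by exact ht) (by simp [hco]; intros; omega) ?_ ?_
  · rintro i s' hi hF hx ⟨hI₀, hI, hI'⟩ ht'
    have hB' := hB₁.frame hF ⟨rfl, rfl, rfl, rfl, rfl, rfl⟩
    have hf : s'.iarr 2 = s.iarr 2 := hF.iarr 2 rfl
    have hf' : s'.carr 1 = s.carr 1 := hF.carr 1 rfl
    have hf2 : s'.carr 2 = s.carr 2 := hF.carr 2 rfl
    -- Iteration `i` treats column `r = n - 1 - i`; the name avoids truncated subtraction.
    obtain ⟨r, hr⟩ : ∃ r, n - i = r + 1 := ⟨n - i - 1, by omega⟩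
    have hr' : n - (i + 1) = r := by omega
    have hrn : r < n := by omega
    have hcr := hc r hrn
    have hIr := hI' r hrn
    rw [hr] at hI₀ hI hIr
    rw [if_neg (by omega)] at hIr
    simp only [block, reaches_seq, reaches_instr, reaches_ite, reaches_skip, Instr.effect,
      Test.Holds]
    have hprod : ∏ q ∈ Finset.Ico r n, factor c v q =
        factor c v r * ∏ q ∈ Finset.Ico (r + 1) n, factor c v q :=
      Finset.prod_eq_prod_Ico_succ_bot hrn _
    have harr : ∀ j < n, Function.update (s'.carr 3) r (s.carr 3 r + P r *
          (co * ∏ q ∈ Finset.Ico (r + 1) n, factor c v q)) j = if r ≤ j then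
        s.carr 3 j + P j * (co * ∏ q ∈ Finset.Ico (j + 1) n, factor c v q) else s.carr 3 j := by
      intro j hj
      rcases eq_or_ne j r with rfl | hne
      · simp
      · have hle : r + 1 ≤ j ↔ r ≤ j := by omega
        rw [Function.update_of_ne hne, hI' j hj, hr]
        simp only [hle]
    simp [hf, hf', hf2, hv r hrn, hP r hrn, hI, hI₀, hr', hB'.izero, hcr, hIr, hprod]
    constructor <;> intro h
    · exact ⟨⟨by simp [h, factor], harr⟩, by omega, by omega⟩
    · exact ⟨⟨by simp [h, factor]; ring, harr⟩, by omega, by omega⟩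
  · rintro s' hF ⟨-, -, hI⟩ ht' hc
    simp at hc
    refine ⟨fun j hj => by simpa using hI j hj, ?_, ht'⟩
    simp
    omega

theorem bumpDigit_spec {i x b : ℕ} (hi : s.ivar 5 = i) (hx : s.ivar 8 = x) (hb : s.ivar 9 = b)
    (him : i < m) (hnm : n ≤ m) (hB : Base m n s) (ht : s.top ≤ m) :
    Reaches A ω bumpDigit (fun s' => s'.iarr 1 = Function.update (s.iarr 1) i (x + 1) ∧
        s'.carr 4 = Function.update (s.carr 4) i (s.carr 4 i * (((x : ℂ) - b) / (x + 1))) ∧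
        s'.ivar 11 = 1 ∧ (∀ j < n, s'.carr 1 j = s.carr 1 j + entryOrZero A i j) ∧
        s'.clock ≤ s.clock + (8 * n + 20) ∧ s'.top ≤ m) s := by
  simp only [bumpDigit, block, reaches_seq, reaches_instr, Instr.effect]
  refine reaches_for_time
    (fun r s' => ∀ j < n, s'.carr 1 j =
      if j < r then s.carr 1 j + entryOrZero A i j else s.carr 1 j)
    4 m (by simpa using hB.cols) (by decide) rfl rfl (by simp [hi]; omega) (by simp) ?_ ?_
  · rintro r s' hr hF hxr hI ht'
    have h5 : s'.ivar 5 = i := by rw [hF.ivar 5 rfl]; simpa using hi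
    have hIr := hI r hr
    rw [if_neg (lt_irrefl _)] at hIr
    simp only [reaches_seq, reaches_instr, Instr.effect]
    simp [hxr, h5, hIr]
    refine ⟨fun j hj => ?_, by omega, by omega⟩
    rcases eq_or_ne j r with rfl | hne
    · simp
    · rw [Function.update_of_ne hne, hI j hj]
      split_ifs <;> first | rfl | omega
  · rintro s' hF hI ht' hc
    have h1 := hF.iarr 1 rfl
    have h4 := hF.carr 4 rfl
    have h11 := hF.ivar 11 rfl
    simp [hi, hx, hb] at h1 h4 h11 hc
    refine ⟨by simpa using h1, by simpa using h4, by simpa using h11, fun j hj => ?_, ?_, ht'⟩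
    · simpa [hj] using hI j hj
    · change s'.clock + 1 ≤ _
      omega

theorem resetDigit_spec {i b : ℕ} (hi : s.ivar 5 = i) (hb : s.ivar 9 = b)
    (him : i < m) (hnm : n ≤ m) (hB : Base m n s) (ht : s.top ≤ m) :
    Reaches A ω resetDigit (fun s' => s'.iarr 1 = Function.update (s.iarr 1) i 0 ∧
        s'.carr 4 = Function.update (s.carr 4) i 1 ∧
        (∀ j < n, s'.carr 1 j = s.carr 1 j - entryOrZero A i j * b) ∧
        s'.clock ≤ s.clock + (8 * n + 20) ∧ s'.top ≤ m) s := by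
  simp only [resetDigit, block, reaches_seq, reaches_instr, Instr.effect]
  refine reaches_for_time
    (fun r s' => ∀ j < n, s'.carr 1 j =
      if j < r then s.carr 1 j - entryOrZero A i j * b else s.carr 1 j)
    5 m (by simpa using hB.cols) (by decide) rfl rfl (by simp [hi]; omega) (by simp) ?_ ?_
  · rintro r s' hr hF hxr hI ht'
    have h5 : s'.ivar 5 = i := by rw [hF.ivar 5 rfl]; simpa using hi
    have h7 : s'.cvar 7 = b := by rw [hF.cvar 7 rfl]; simp [hb]
    have hIr := hI r hr
    rw [if_neg (lt_irrefl _)] at hIr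
    simp only [reaches_seq, reaches_instr, Instr.effect]
    simp [hxr, h5, hIr, h7]
    refine ⟨fun j hj => ?_, by omega, by omega⟩
    rcases eq_or_ne j r with rfl | hne
    · simp
    · rw [Function.update_of_ne hne, hI j hj]
      split_ifs <;> first | rfl | omega
  · rintro s' hF hI ht' hc
    have h1 := hF.iarr 1 rfl
    have h4 := hF.carr 4 rfl
    simp [hi, hB.izero, hB.cone] at h1 h4 hc
    refine ⟨by simpa using h1, by simpa using h4, fun j hj => ?_, ?_, ht'⟩
    · simpa [hj] using hI j hj
    · change s'.clock + 1 ≤ _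
      omega

end BosonSampling

/-! ### The odometer and its amortised cost. -/

namespace BosonSampling

variable {m n : ℕ} {A : Matrix (Fin m) (Fin n) ℂ} {ω : ℕ → unitInterval} {s : MState 16}

/-- A signed binomial coefficient. -/
def signedChoose (a b : ℕ) : ℂ := (-1) ^ b * (a.choose b : ℂ)

/-- From (b+1)·C(a,b+1) = (a-b)·C(a,b), with the sign absorbed. It lets an increment of a digit
update its coefficient with one division and one multiplication. -/
theorem signedChoose_succ {a b : ℕ} (h : b < a) :
    signedChoose a (b + 1) = signedChoose a b * (((b : ℂ) - a) / (b + 1)) := by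
  have h1 : ((a.choose (b + 1) : ℕ) : ℂ) * (b + 1) = a.choose b * (a - b) := by
    have := congrArg (Nat.cast : ℕ → ℂ) (Nat.choose_succ_right_eq a b)
    push_cast [Nat.cast_sub h.le] at this
    exact this
  have h2 : (b + 1 : ℂ) ≠ 0 := by exact_mod_cast Nat.succ_ne_zero b
  rw [signedChoose, signedChoose, mul_div_assoc', eq_div_iff h2, pow_succ]
  linear_combination (-(-1) ^ b : ℂ) * h1

/-- The state of the odometer: digits `T` with bounds `σ`. -/
structure Digits (A : Matrix (Fin m) (Fin n) ℂ) (σ T : ℕ → ℕ) (s : MState 16) : Prop where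
  digit : ∀ i < m, s.iarr 1 i = T i
  coeff : ∀ i < m, s.carr 4 i = signedChoose (σ i) (T i)
  form : ∀ j < n, s.carr 1 j = ∑ i ∈ Finset.range m, (T i : ℂ) * entryOrZero A i j

theorem Digits.frame {σ T : ℕ → ℕ} {s' : MState 16} {p : Prog 16} (h : Digits A σ T s)
    (hF : Frame p s s') (h1 : p.any (Instr.writesIArr 1) = false)
    (h2 : p.any (Instr.writesCArr 4) = false) (h3 : p.any (Instr.writesCArr 1) = false) :
    Digits A σ T s' :=
  ⟨by rw [hF.iarr 1 h1]; exact h.digit, by rw [hF.carr 4 h2]; exact h.coeff,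
    by rw [hF.carr 1 h3]; exact h.form⟩

/-- The number of non-zero digits. -/
def numNonzero (m : ℕ) (T : ℕ → ℕ) : ℕ := ∑ i ∈ Finset.range m, if T i = 0 then 0 else 1

/-- The old and new summands are placed on opposite sides, so no subtraction is needed; the identity
serves both the count of non-zero digits in ℕ and the linear forms in ℂ. -/
theorem sum_update_add {M : Type*} [AddCommMonoid M] (f : ℕ → ℕ → M) (T : ℕ → ℕ) {i : ℕ} (v : ℕ)
    (hi : i < m) : ∑ q ∈ Finset.range m, f (Function.update T i v q) q + f (T i) i =
      ∑ q ∈ Finset.range m, f (T q) q + f v i := by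
  rw [← Finset.add_sum_erase _ _ (Finset.mem_range.mpr hi),
    ← Finset.add_sum_erase _ (fun q => f (T q) q) (Finset.mem_range.mpr hi)]
  have : ∑ q ∈ (Finset.range m).erase i, f (Function.update T i v q) q =
      ∑ q ∈ (Finset.range m).erase i, f (T q) q :=
    Finset.sum_congr rfl fun q hq => by rw [Function.update_of_ne (Finset.ne_of_mem_erase hq)]
  rw [this, Function.update_self]
  abel

theorem numNonzero_update (T : ℕ → ℕ) {i : ℕ} (v : ℕ) (hi : i < m) :
    numNonzero m (Function.update T i v) + (if T i = 0 then 0 else 1) =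
      numNonzero m T + (if v = 0 then 0 else 1) :=
  sum_update_add (fun a _ => if a = 0 then 0 else 1) T v hi

/-- A change of one digit shifts each linear form by a multiple of one matrix entry, so the forms
are maintained in O(n) operations instead of being recomputed. -/
theorem Digits.update {σ T : ℕ → ℕ} {s' : MState 16} {i v : ℕ} (h : Digits A σ T s) (hi : i < m)
    (h1 : s'.iarr 1 = Function.update (s.iarr 1) i v)
    (h4 : s'.carr 4 = Function.update (s.carr 4) i (signedChoose (σ i) v))
    (hf : ∀ j < n, s'.carr 1 j = s.carr 1 j + ((v : ℂ) - T i) * entryOrZero A i j) :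
    Digits A σ (Function.update T i v) s' := by
  refine ⟨fun q hq => ?_, fun q hq => ?_, fun j hj => ?_⟩
  · rw [h1]
    rcases eq_or_ne q i with rfl | hne
    · simp
    · simpa [hne] using h.digit q hq
  · rw [h4]
    rcases eq_or_ne q i with rfl | hne
    · simp
    · simpa [hne] using h.coeff q hq
  · have := sum_update_add (fun a q => (a : ℂ) * entryOrZero A q j) T v hi
    rw [hf j hj, h.form j hj]
    linear_combination -this

/-- The successor of the digits `t` if `p` is the first position that is not at its bound. -/
def nextDigits (p : ℕ) (t : ℕ → ℕ) (q : ℕ) : ℕ := if q < p then 0 else if q = p then t p + 1 else t q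

/-- Amortisation with potential `8 * n + 20` per non-zero digit. A reset digit was at a positive
bound, so the drop of the potential pays for it. The one increment costs that amount and may raise
the potential by it, hence the factor 2. The scan over all digits accounts for `10 * m + 10`. -/
theorem advance_spec {σ t : ℕ → ℕ} (hσ : ∀ i < m, s.iarr 0 i = σ i) (hD : Digits A σ t s)
    (htσ : ∀ i < m, t i ≤ σ i) (hnm : n ≤ m) (hB : Base m n s) (ht : s.top ≤ m) :
    Reaches A ω advance (fun s' => s'.top ≤ m ∧
      ((s'.ivar 11 = 0 ∧ (∀ i < m, t i = σ i) ∧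
        s'.clock ≤ s.clock + (8 * n + 20) * numNonzero m t + (10 * m + 10)) ∨
      (s'.ivar 11 = 1 ∧ ∃ p < m, t p < σ p ∧ (∀ i < p, t i = σ i) ∧
        Digits A σ (nextDigits p t) s' ∧
        s'.clock + (8 * n + 20) * numNonzero m (nextDigits p t) ≤
          s.clock + (8 * n + 20) * numNonzero m t + (10 * m + 10 + 2 * (8 * n + 20))))) s := by
  rw [advance, reaches_seq, reaches_instr]
  simp only [Instr.effect]
  have hB₀ : Base m n (s.setI 11 0).tick := hB.setI (by decide) _
  set L := 8 * n + 20 with hL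
  -- Either the carry has passed all positions below `i`, which are now zero, or it was absorbed at
  -- some `p < i` and the digits are already those of the successor.
  refine reaches_for (fun i s' => s'.top ≤ m ∧
    ((s'.ivar 11 = 0 ∧ (∀ q < i, t q = σ q) ∧
      Digits A σ (fun q => if q < i then 0 else t q) s' ∧
      s'.clock + L * numNonzero m (fun q => if q < i then 0 else t q) ≤
        s.clock + L * numNonzero m t + (10 * i + 2)) ∨
    (s'.ivar 11 = 1 ∧ ∃ p < i, t p < σ p ∧ (∀ q < p, t q = σ q) ∧
      Digits A σ (nextDigits p t) s' ∧ s'.clock + L * numNonzero m (nextDigits p t) ≤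
        s.clock + L * numNonzero m t + (10 * i + 2 + 2 * L))))
    (by exact hB.rows) (by decide) rfl rfl ?_ ?_ ?_
  · refine ⟨ht, Or.inl ⟨by simp, by simp, ?_, ?_⟩⟩
    · simpa using ⟨hD.digit, hD.coeff, hD.form⟩
    · change s.clock + 1 + 1 + L * numNonzero m (fun q => t q) ≤ _
      change s.clock + 1 + 1 + L * numNonzero m t ≤ _
      omega
  · rintro i s₁ hi hF hx ⟨ht₁, hI⟩
    have hB₁ := hB₀.frame hF ⟨rfl, rfl, rfl, rfl, rfl, rfl⟩
    have hσ₁ : s₁.iarr 0 = s.iarr 0 := hF.iarr 0 rfl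
    rw [reaches_ite]
    refine ⟨fun h => ?_, fun h => ?_⟩
    · replace h : s₁.ivar 11 = s₁.ivar 2 := h
      rw [hB₁.izero] at h
      rcases hI with ⟨-, hq, hD₁, hc₁⟩ | ⟨h', -⟩
      swap
      · omega
      set T : ℕ → ℕ := fun q => if q < i then 0 else t q with hT
      have hTi : T i = t i := by simp [hT]
      have hTup : Function.update T i 0 = fun q => if q < i + 1 then 0 else t q := by
        funext q
        rcases eq_or_ne q i with rfl | hne
        · simp
        · have : q < i + 1 ↔ q < i := by omega
          simp [hT, hne, this]
      have hTup' : Function.update T i (t i + 1) = nextDigits i t := by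
        funext q
        rcases eq_or_ne q i with rfl | hne
        · simp [nextDigits]
        · simp [hT, hne, nextDigits]
      rw [reaches_seq]
      have hblock : Reaches A ω (block (.iget 8 1 5) [.iget 9 0 5]) (fun s' => s'.ivar 8 = t i ∧
          s'.ivar 9 = σ i ∧ s'.clock = s₁.clock + 4 ∧ s'.top ≤ m) s₁.tick.tick := by
        simp only [block, reaches_seq, reaches_instr, Instr.effect]
        simp [hx, hD₁.digit i hi, hσ₁, hσ i hi, hTi]
        omega
      refine hblock.mono ?_
      rintro s₂ hF₂ ⟨h8, h9, hc₂, ht₂⟩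
      have hB₂ := hB₁.tick.tick.frame hF₂ ⟨rfl, rfl, rfl, rfl, rfl, rfl⟩
      have hx₂ : s₂.ivar 5 = i := (hF₂.ivar 5 rfl).trans hx
      have hD₂ : Digits A σ T s₂ :=
        Digits.frame (s := s₁.tick.tick) ⟨hD₁.digit, hD₁.coeff, hD₁.form⟩ hF₂ rfl rfl rfl
      have h11 : s₂.ivar 11 = 0 := (hF₂.ivar 11 rfl).trans h
      rw [reaches_ite]
      refine ⟨fun hlt => ?_, fun hlt => ?_⟩
      · replace hlt : s₂.ivar 8 < s₂.ivar 9 := hlt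
        rw [h8, h9] at hlt
        refine (bumpDigit_spec (s := s₂.tick) (i := i) hx₂ h8 h9 hi hnm hB₂.tick ht₂).mono ?_
        rintro s₃ - ⟨e1, e4, e11, ef, ec, et⟩
        have hD₃ := hD₂.update (v := t i + 1) hi e1
          (by rw [e4, signedChoose_succ hlt, ← hTi]; exact congrArg _ (by rw [← hD₂.coeff i hi]; rfl))
          (fun j hj => by rw [ef j hj, hTi]; push_cast; simp)
        rw [hTup'] at hD₃
        refine ⟨et, Or.inr ⟨by simpa using e11, i, by omega, hlt, hq,
          ⟨hD₃.digit, hD₃.coeff, hD₃.form⟩, ?_⟩⟩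
        have hN := numNonzero_update T (t i + 1) hi
        rw [hTup', if_neg (Nat.succ_ne_zero _)] at hN
        have hN' : numNonzero m (nextDigits i t) ≤ numNonzero m T + 1 := by omega
        have hN'' := Nat.mul_le_mul_left L hN'
        rw [mul_add, mul_one] at hN''
        simp at ec ⊢
        omega
      · replace hlt : ¬ s₂.ivar 8 < s₂.ivar 9 := hlt
        rw [h8, h9] at hlt
        have heq : t i = σ i := le_antisymm (htσ i hi) (not_lt.mp hlt)
        have hq' : ∀ q < i + 1, t q = σ q := fun q hqi => by
          rcases Nat.lt_succ_iff_lt_or_eq.mp hqi with h | rfl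
          · exact hq q h
          · exact heq
        rw [reaches_ite]
        refine ⟨fun hpos => ?_, fun hpos => ?_⟩
        · replace hpos : s₂.ivar 2 < s₂.ivar 9 := hpos
          rw [hB₂.izero, h9] at hpos
          refine (resetDigit_spec (s := s₂.tick.tick) (i := i) (b := σ i) hx₂ h9 hi hnm
            hB₂.tick.tick ht₂).mono ?_
          rintro s₃ hF₃ ⟨e1, e4, ef, ec, et⟩
          have hD₃ := hD₂.update (v := 0) hi e1
            (by rw [e4]; simp [signedChoose])
            (fun j hj => by rw [ef j hj, hTi, heq]; push_cast; simp; ring)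
          rw [hTup] at hD₃
          have e11 : s₃.ivar 11 = 0 := (hF₃.ivar 11 rfl).trans h11
          refine ⟨et, Or.inl ⟨by simpa using e11, hq', ⟨hD₃.digit, hD₃.coeff, hD₃.form⟩, ?_⟩⟩
          have hN := numNonzero_update T 0 hi
          rw [hTup, if_neg (by omega), if_pos rfl] at hN
          have hN'' := congrArg (L * ·) hN
          simp only [mul_add, mul_one] at hN''
          simp only [MState.setI_clock, MState.tick_clock] at ec ⊢
          omega
        · replace hpos : ¬ s₂.ivar 2 < s₂.ivar 9 := hpos
          rw [hB₂.izero, h9] at hpos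
          have hz : t i = 0 := by omega
          have hTT : (fun q => if q < i + 1 then 0 else t q) = T := by
            rw [← hTup, ← Function.update_eq_self i T, hTi, hz]
            simp
          rw [reaches_skip]
          refine ⟨ht₂, Or.inl ⟨by simpa using h11, hq', ?_, ?_⟩⟩
          · rw [hTT]
            exact ⟨hD₂.digit, hD₂.coeff, hD₂.form⟩
          · rw [hTT]
            simp
            omega
    · replace h : ¬ s₁.ivar 11 = s₁.ivar 2 := h
      rw [hB₁.izero] at h
      rcases hI with ⟨h', -⟩ | ⟨h', p, hp, hlt, hq, hD₁, hc₁⟩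
      · omega
      rw [reaches_skip]
      refine ⟨ht₁, Or.inr ⟨by simpa using h', p, by omega, hlt, hq,
        ⟨hD₁.digit, hD₁.coeff, hD₁.form⟩, ?_⟩⟩
      simp
      omega
  · rintro s' - ⟨ht', ⟨h11, hq, -, hc⟩ | ⟨h11, p, hp, hlt, hq, hD', hc⟩⟩
    · refine ⟨ht', Or.inl ⟨h11, hq, ?_⟩⟩
      simp
      omega
    · refine ⟨ht', Or.inr ⟨h11, p, hp, hlt, hq, ⟨hD'.digit, hD'.coeff, hD'.form⟩, ?_⟩⟩
      simp
      omega

end BosonSampling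

/-! ### Colexicographic enumeration and the simultaneous computation of the minors. -/

namespace BosonSampling

variable {m n : ℕ} {A : Matrix (Fin m) (Fin n) ℂ} {ω : ℕ → unitInterval} {s : MState 16}

/-- The colexicographic order. -/
def Colex (u t : ℕ →₀ ℕ) : Prop := ∃ p, u p < t p ∧ ∀ q, p < q → u q = t q

theorem not_colex_self (t : ℕ →₀ ℕ) : ¬ Colex t t := fun ⟨_, h, _⟩ => lt_irrefl _ h

/-- The largest position at which the two differ decides the order. -/
theorem colex_of_le_of_ne {u t : ℕ →₀ ℕ} (h : u ≤ t) (hne : u ≠ t) : Colex u t := by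
  classical
  have hS : ((u.support ∪ t.support).filter fun i => u i ≠ t i).Nonempty := by
    obtain ⟨i, hi⟩ := Finsupp.ne_iff.mp hne
    refine ⟨i, ?_⟩
    simp only [Finset.mem_filter, Finset.mem_union, Finsupp.mem_support_iff]
    exact ⟨by omega, hi⟩
  refine ⟨_, lt_of_le_of_ne (h _) (Finset.mem_filter.mp (Finset.max'_mem _ hS)).2, fun q hq => ?_⟩
  by_contra hne'
  refine absurd (Finset.le_max' _ q ?_) (not_le.mpr hq)
  simp only [Finset.mem_filter, Finset.mem_union, Finsupp.mem_support_iff]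
  exact ⟨by omega, hne'⟩

/-- Nothing lies strictly between `t` and its odometer successor: if `u` precedes `t'` with deciding
position `p`, then `u` agrees with `t` above `p`, does not exceed it at `p`, and below `p` the
digits of `t` are at their bounds. So `u ≤ t`. -/
theorem colex_next_iff {σ t t' u : ℕ →₀ ℕ} {p : ℕ} (ht : ∀ i < p, t i = σ i)
    (ht' : ⇑t' = nextDigits p t) (hu : u ≤ σ) : Colex u t' ↔ Colex u t ∨ u = t := by
  have hlo : ∀ q, q < p → t' q = 0 := fun q hq => by rw [ht', nextDigits, if_pos hq]
  have hp : t' p = t p + 1 := by rw [ht']; simp [nextDigits]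
  have hhi : ∀ q, p < q → t' q = t q := fun q hq => by
    rw [ht', nextDigits, if_neg (by omega), if_neg (by omega)]
  constructor
  · rintro ⟨q, hq, hr⟩
    rcases lt_trichotomy q p with hqp | rfl | hqp
    · rw [hlo q hqp] at hq
      omega
    · by_cases hut : u = t
      · exact Or.inr hut
      refine Or.inl (colex_of_le_of_ne (fun i => ?_) hut)
      rcases lt_trichotomy i q with hi | rfl | hi
      · rw [ht i hi]
        exact hu i
      · omega
      · exact (hr i hi).trans (hhi i hi) |>.le
    · exact Or.inl ⟨q, by rwa [← hhi q hqp], fun r hqr => by rw [hr r hqr, hhi r (by omega)]⟩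
  · rintro (⟨q, hq, hr⟩ | rfl)
    · rcases lt_or_ge p q with hqp | hqp
      · exact ⟨q, by rwa [hhi q hqp], fun r hqr => by rw [hr r hqr, hhi r (by omega)]⟩
      · refine ⟨p, ?_, fun r hqr => by rw [hr r (by omega), hhi r hqr]⟩
        rw [hp]
        rcases hqp.lt_or_eq with h | rfl
        · rw [hr p h]
          omega
        · omega
    · exact ⟨p, by omega, fun r hqr => (hhi r hqr).symm⟩

/-- The term of the digits `t` in the formula for the permanent of a matrix with repeated rows. -/
noncomputable def ryserTerm (a : ℕ → ℕ → ℂ) (m : ℕ) (σ : ℕ →₀ ℕ) (c : Finset ℕ) (t : ℕ →₀ ℕ) : ℂ :=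
  (∏ i ∈ Finset.range m, signedChoose (σ i) (t i)) *
    ∏ j ∈ c, ∑ i ∈ Finset.range m, (t i : ℂ) * a i j

/-- Up to sign, the permanent of the matrix with row `i` of `a` repeated `σ i` times and the
columns in `c`. -/
noncomputable def ryser (a : ℕ → ℕ → ℂ) (m : ℕ) (σ : ℕ →₀ ℕ) (c : Finset ℕ) : ℂ :=
  ∑ t ∈ Finset.Iic σ, ryserTerm a m σ c t

theorem prod_factor {c : Finset ℕ} {v : ℕ → ℂ} {l : ℕ} (hl : l < n) (hc : c ⊆ Finset.range n) :
    (∏ q ∈ Finset.range l, factor c v q) * ∏ q ∈ Finset.Ico (l + 1) n, factor c v q =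
      ∏ j ∈ c.erase l, v j := by
  have h1 : ∏ j ∈ c.erase l, v j = ∏ j ∈ (Finset.range n).erase l, factor c v j := by
    rw [← Finset.prod_subset (Finset.erase_subset_erase l hc)]
    · exact Finset.prod_congr rfl fun j hj => by rw [factor, if_pos (Finset.mem_of_mem_erase hj)]
    · intro j hj hj'
      rw [factor, if_neg fun h => hj' (Finset.mem_erase.mpr ⟨Finset.ne_of_mem_erase hj, h⟩)]
  have h2 : (Finset.range n).erase l = Finset.range l ∪ Finset.Ico (l + 1) n := by
    ext q
    simp only [Finset.mem_erase, Finset.mem_range, Finset.mem_union, Finset.mem_Ico]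
    omega
  rw [h1, h2, Finset.prod_union]
  rw [Finset.disjoint_left]
  intro q hq hq'
  simp only [Finset.mem_range, Finset.mem_Ico] at hq hq'
  omega

theorem minors_spec {σ : ℕ →₀ ℕ} {c : Finset ℕ} (hσ : ∀ i < m, s.iarr 0 i = σ i)
    (hσm : σ.support ⊆ Finset.range m) (hc : Marks n c s) (hcn : c ⊆ Finset.range n) (hnm : n ≤ m)
    (hB : Base m n s) (ht : s.top ≤ m) :
    Reaches A ω minors (fun s' =>
      (∀ l < n, s'.carr 3 l = ryser (entryOrZero A) m σ (c.erase l)) ∧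
      s'.clock ≤ s.clock + (4 * m + 4 * n + 10 + (Finset.Iic σ).card * (14 * m + 35 * n + 60)) ∧
      s'.top ≤ m) s := by
  classical
  rw [minors, reaches_seq]
  refine (startOdometer_spec hnm hB ht).mono ?_
  rintro s₁ hF₁ ⟨hdig, hacc, hc₁, ht₁⟩
  have hB₁ := hB.frame hF₁ ⟨rfl, rfl, rfl, rfl, rfl, rfl⟩
  rw [reaches_seq, reaches_instr]
  simp only [Instr.effect]
  set s₂ : MState 16 := (s₁.setI 11 1).tick with hs₂
  have hB₂ : Base m n s₂ := hB₁.setI (by decide) _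
  have hm₂ : s₂.iarr 2 = s.iarr 2 := hF₁.iarr 2 rfl
  have hσ₂ : s₂.iarr 0 = s.iarr 0 := hF₁.iarr 0 rfl
  have hcl₂ : s₂.clock ≤ s.clock + (4 * m + 4 * n + 5) := by
    simp [hs₂]
    omega
  -- The sum of `4m+3`, `7n+3` and `12n+3` for the three subroutines of a term, `10m+10+2(8n+20)`
  -- for the amortised advance, and 1 for the loop test.
  set E := 14 * m + 35 * n + 60 with hE
  set L := 8 * n + 20 with hL
  -- The iteration number is the colexicographic rank of the current digits, and the accumulators
  -- hold the terms of all predecessors. The second alternative is the state after overflow.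
  refine reaches_while (fun i s' => s'.top ≤ m ∧
      ((s'.ivar 11 = 1 ∧ ∃ t : ℕ →₀ ℕ, t ≤ σ ∧ Digits A σ t s' ∧
        i = ((Finset.Iic σ).filter fun u => Colex u t).card ∧
        (∀ l < n, s'.carr 3 l = ∑ u ∈ (Finset.Iic σ).filter fun u => Colex u t,
          ryserTerm (entryOrZero A) m σ (c.erase l) u) ∧
        s'.clock + L * numNonzero m t ≤ s₂.clock + i * E) ∨
      (s'.ivar 11 = 0 ∧ i = (Finset.Iic σ).card ∧
        (∀ l < n, s'.carr 3 l = ryser (entryOrZero A) m σ (c.erase l)) ∧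
        s'.clock ≤ s₂.clock + i * E)))
    (Finset.Iic σ).card ?_ ?_ ?_
  · have hempty : ((Finset.Iic σ).filter fun u => Colex u 0) = ∅ := by
      refine Finset.filter_eq_empty_iff.mpr fun u _ => ?_
      rintro ⟨p, hp, -⟩
      simp at hp
    refine ⟨ht₁, Or.inl ⟨by simp [hs₂], 0, fun _ => Nat.zero_le _, ⟨?_, ?_, ?_⟩, ?_, ?_, ?_⟩⟩
    · intro i hi
      simpa [hs₂] using (hdig i hi).1
    · intro i hi
      simpa [hs₂, signedChoose] using (hdig i hi).2
    · intro j hj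
      simpa [hs₂] using (hacc j hj).1
    · rw [hempty]; rfl
    · intro l hl
      rw [hempty]
      simpa [hs₂] using (hacc l hl).2
    · simp [numNonzero]
  · rintro i s₃ hF₃ ⟨ht₃, hI⟩ hrun
    have hB₃ := hB₂.frame hF₃ ⟨rfl, rfl, rfl, rfl, rfl, rfl⟩
    have hm₃ : Marks n c s₃ := by
      rw [Marks, hF₃.iarr 2 rfl, hm₂]; exact hc
    have hσ₃ : ∀ i < m, s₃.iarr 0 i = σ i := by
      rw [hF₃.iarr 0 rfl, hσ₂]; exact hσ
    replace hrun : s₃.ivar 11 = s₃.ivar 3 := hrun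
    rw [hB₃.ione] at hrun
    rcases hI with ⟨-, t, htσ, hD₃, hi, hacc₃, hc₃⟩ | ⟨h, -⟩
    swap
    · omega
    have hmem : t ∈ Finset.Iic σ := Finset.mem_Iic.mpr htσ
    refine ⟨?_, ?_⟩
    · rw [hi]
      refine Finset.card_lt_card (Finset.ssubset_iff_subset_ne.mpr ⟨Finset.filter_subset _ _, ?_⟩)
      intro h
      rw [← h] at hmem
      exact not_colex_self t (Finset.mem_filter.mp hmem).2
    rw [reaches_seq]
    refine (termCoeff_spec (s := s₃.tick) (β := fun i => signedChoose (σ i) (t i)) hD₃.coeff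
      hB₃.tick ht₃).mono ?_
    rintro s₄ hF₄ ⟨h9, hc₄, ht₄⟩
    have hB₄ := hB₃.tick.frame hF₄ ⟨rfl, rfl, rfl, rfl, rfl, rfl⟩
    have hD₄ : Digits A σ t s₄ :=
      Digits.frame (s := s₃.tick) ⟨hD₃.digit, hD₃.coeff, hD₃.form⟩ hF₄ rfl rfl rfl
    have hm₄ : Marks n c s₄ := by rw [Marks, hF₄.iarr 2 rfl]; exact hm₃
    rw [reaches_seq]
    refine (prefixProds_spec hD₄.form hm₄ hnm hB₄ ht₄).mono ?_
    rintro s₅ hF₅ ⟨hpre, hc₅, ht₅⟩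
    have hB₅ := hB₄.frame hF₅ ⟨rfl, rfl, rfl, rfl, rfl, rfl⟩
    have hD₅ := hD₄.frame hF₅ rfl rfl rfl
    have hm₅ : Marks n c s₅ := by rw [Marks, hF₅.iarr 2 rfl]; exact hm₄
    rw [reaches_seq]
    refine (addTerm_spec hD₅.form hpre ((hF₅.cvar 9 rfl).trans h9) hm₅ hnm hB₅ ht₅).mono ?_
    rintro s₆ hF₆ ⟨hacc₆, hc₆, ht₆⟩
    have hB₆ := hB₅.frame hF₆ ⟨rfl, rfl, rfl, rfl, rfl, rfl⟩
    have hD₆ := hD₅.frame hF₆ rfl rfl rfl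
    have hσ₆ : ∀ i < m, s₆.iarr 0 i = σ i := by
      rw [hF₆.iarr 0 rfl, hF₅.iarr 0 rfl, hF₄.iarr 0 rfl]; exact hσ₃
    have hacc₅ : ∀ l < n, s₆.carr 3 l = ∑ u ∈ (Finset.Iic σ).filter fun u => Colex u t,
        ryserTerm (entryOrZero A) m σ (c.erase l) u + ryserTerm (entryOrZero A) m σ (c.erase l) t := by
      intro l hl
      rw [hacc₆ l hl, hF₅.carr 3 rfl, hF₄.carr 3 rfl]
      simp only [MState.tick_carr]
      rw [hacc₃ l hl, ryserTerm, ← prod_factor hl hcn]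
      ring
    refine (advance_spec hσ₆ hD₆ (fun i _ => htσ i) hnm hB₆ ht₆).mono ?_
    rintro s₇ hF₇ ⟨ht₇, ⟨h11, hall, hc₇⟩ | ⟨h11, p, hp, hlt, heq, hD₇, hc₇⟩⟩
    -- Overflow means that all digits are at their bounds. Then `t` is the last vector of the box,
    -- and with its predecessors it exhausts the box.
    · have hts : t = σ := by
        ext q
        by_cases hq : q < m
        · exact hall q hq
        · have h0 : σ q = 0 := by
            by_contra h
            exact hq (Finset.mem_range.mp (hσm (Finsupp.mem_support_iff.mpr h)))
          have := htσ q
          omega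
      have hfil : insert t ((Finset.Iic σ).filter fun u => Colex u t) = Finset.Iic σ := by
        ext u
        simp only [Finset.mem_insert, Finset.mem_filter, Finset.mem_Iic]
        constructor
        · rintro (rfl | h)
          · exact htσ
          · exact h.1
        · intro hu
          by_cases hut : u = t
          · exact Or.inl hut
          · exact Or.inr ⟨hu, colex_of_le_of_ne (hts ▸ hu) hut⟩
      have hnot : t ∉ (Finset.Iic σ).filter fun u => Colex u t := fun h =>
        not_colex_self t (Finset.mem_filter.mp h).2
      refine ⟨ht₇, Or.inr ⟨h11, ?_, ?_, ?_⟩⟩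
      · rw [← hfil, Finset.card_insert_of_notMem hnot, hi]
      · intro l hl
        rw [hF₇.carr 3 rfl, hacc₅ l hl, ryser]
        conv_rhs => rw [← hfil, Finset.sum_insert hnot, add_comm]
      · simp at hc₄
        rw [← hL] at hc₇
        rw [add_mul i, one_mul]
        omega
    · have hsupp : ∀ q, nextDigits p t q ≠ 0 → q ∈ Finset.range m := by
        intro q hq
        rw [Finset.mem_range]
        rcases eq_or_ne q p with rfl | hne
        · exact hp
        · by_contra hqm
          refine hq ?_
          rw [nextDigits, if_neg (by omega), if_neg hne]
          have h0 : σ q = 0 := by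
            by_contra h
            exact hqm (Finset.mem_range.mp (hσm (Finsupp.mem_support_iff.mpr h)))
          have := htσ q
          omega
      set t' : ℕ →₀ ℕ := Finsupp.onFinset (Finset.range m) (nextDigits p t) hsupp with ht'
      have ht'c : ⇑t' = nextDigits p t := rfl
      have hfil : ((Finset.Iic σ).filter fun u => Colex u t') =
          insert t ((Finset.Iic σ).filter fun u => Colex u t) := by
        ext u
        simp only [Finset.mem_insert, Finset.mem_filter, Finset.mem_Iic]
        constructor
        · rintro ⟨hu, h⟩
          rcases (colex_next_iff heq ht'c hu).mp h with h | h
          · exact Or.inr ⟨hu, h⟩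
          · exact Or.inl h
        · rintro (rfl | ⟨hu, h⟩)
          · exact ⟨htσ, (colex_next_iff heq ht'c htσ).mpr (Or.inr rfl)⟩
          · exact ⟨hu, (colex_next_iff heq ht'c hu).mpr (Or.inl h)⟩
      have hnot : t ∉ (Finset.Iic σ).filter fun u => Colex u t := fun h =>
        not_colex_self t (Finset.mem_filter.mp h).2
      refine ⟨ht₇, Or.inl ⟨h11, t', ?_, hD₇, ?_, ?_, ?_⟩⟩
      · intro q
        rw [ht'c, nextDigits]
        split_ifs with h1 h2
        · exact Nat.zero_le _
        · subst h2
          exact hlt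
        · exact htσ q
      · rw [hfil, Finset.card_insert_of_notMem hnot, hi]
      · intro l hl
        rw [hF₇.carr 3 rfl, hacc₅ l hl, hfil, Finset.sum_insert hnot, add_comm]
      · rw [ht'c]
        simp at hc₄
        rw [← hL] at hc₇
        rw [add_mul i, one_mul]
        omega
  · rintro i s₃ hF₃ ⟨ht₃, ⟨h, -⟩ | ⟨h, hi, hacc₃, hc₃⟩⟩ hrun
    · exact absurd (h.trans (hB₂.frame hF₃ ⟨rfl, rfl, rfl, rfl, rfl, rfl⟩).ione.symm) hrun
    · refine ⟨hacc₃, ?_, ht₃⟩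
      rw [← hi]
      simp
      omega

end BosonSampling

/-! ### Row weights, one sampling step and the complete program. -/

namespace BosonSampling

variable {m n : ℕ} {A : Matrix (Fin m) (Fin n) ℂ} {ω : ℕ → unitInterval} {s : MState 16}

theorem rowWeights_spec {c : Finset ℕ} {M : ℕ → ℂ} (hM : ∀ l < n, s.carr 3 l = M l)
    (hc : Marks n c s) (hcn : c ⊆ Finset.range n) (hnm : n ≤ m)
    (hB : Base m n s) (ht : s.top ≤ m) :
    Reaches A ω rowWeights (fun s' =>
      (∀ i < m, s'.carr 0 i = ((‖∑ l ∈ c, entryOrZero A i l * M l‖ ^ 2 : ℝ) : ℂ)) ∧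
      s'.clock ≤ s.clock + (m * (10 * n + 10) + 2) ∧ s'.top ≤ m) s := by
  refine reaches_for_time
    (fun i s' => ∀ q < i, s'.carr 0 q = ((‖∑ l ∈ c, entryOrZero A q l * M l‖ ^ 2 : ℝ) : ℂ))
    (10 * n + 8) m (by exact hB.rows) (by decide) rfl rfl (by exact ht) (by simp) ?_ ?_
  · intro i s₁ hi hF hx hI ht₁
    have hB₁ := hB.frame hF ⟨rfl, rfl, rfl, rfl, rfl, rfl⟩
    rw [reaches_seq, reaches_instr, reaches_seq]
    simp only [Instr.effect]
    have hB₂ : Base m n (s₁.tick.setC 2 (s₁.tick.cvar 0)).tick := hB₁.tick.setC (by decide) _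
    refine reaches_for_time
      (fun j s' => s'.cvar 2 = ∑ l ∈ Finset.range j, if l ∈ c then entryOrZero A i l * M l else 0)
      8 m (by exact hB₁.cols) (by decide) rfl rfl (by exact ht₁) (by simp [hB₁.czero]) ?_ ?_
    · intro j s₂ hj hF₂ hxj hI₂ ht₂
      have hB₃ := hB₂.frame hF₂ ⟨rfl, rfl, rfl, rfl, rfl, rfl⟩
      have h5 : s₂.ivar 5 = i := by rw [hF₂.ivar 5 rfl]; exact hx
      have h3 : s₂.carr 3 = s.carr 3 := (hF₂.carr 3 rfl).trans (hF.carr 3 rfl)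
      have hm : s₂.iarr 2 = s.iarr 2 := (hF₂.iarr 2 rfl).trans (hF.iarr 2 rfl)
      have hcj := hc j hj
      simp only [block, reaches_seq, reaches_instr, reaches_ite, reaches_skip, Instr.effect,
        Test.Holds]
      simp only [Finset.sum_range_succ _ j]
      simp [hxj, h5, h3, hm, hM j hj, hI₂, hcj, hB₃.izero]
      constructor <;> intro h
      · exact ⟨fun h' => absurd h' h, by omega, by omega⟩
      · exact ⟨by simp [h], by omega, by omega⟩
    · intro s₂ hF₂ hI₂ ht₂ hc₂
      have h5 : s₂.ivar 5 = i := by rw [hF₂.ivar 5 rfl]; exact hx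
      have h0 : s₂.carr 0 = s₁.carr 0 := hF₂.carr 0 rfl
      have hsum : s₂.cvar 2 = ∑ l ∈ c, entryOrZero A i l * M l := by
        rw [hI₂, ← Finset.sum_filter]
        congr 1
        ext l
        simp only [Finset.mem_filter, Finset.mem_range]
        exact ⟨fun h => h.2, fun h => ⟨Finset.mem_range.mp (hcn h), h⟩⟩
      simp at hc₂
      simp only [block, reaches_seq, reaches_instr, Instr.effect]
      simp [h5, h0, hsum, Complex.mul_conj', -map_sum]
      exact ⟨by simpa using hI, by omega, by omega⟩
  · intro s' hF hI ht' hc'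
    refine ⟨hI, ?_, ht'⟩
    simpa using hc'

/-- The weights of the columns, given the chosen columns. -/
def colWeight (c : Finset ℕ) (j : ℕ) : ℝ := if j ∈ c then 0 else 1

/-- The weights of the rows, given the multiset of the rows sampled so far and the chosen
columns. -/
noncomputable def rowWeight (a : ℕ → ℕ → ℂ) (m : ℕ) (σ : ℕ →₀ ℕ) (c : Finset ℕ) (i : ℕ) : ℝ :=
  ‖∑ l ∈ c, a i l * ryser a m σ (c.erase l)‖ ^ 2

/-- The columns chosen and the multiset of the rows sampled after `k` steps. -/
noncomputable def chain (a : ℕ → ℕ → ℂ) (m n : ℕ) (ω : ℕ → unitInterval) :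
    ℕ → Finset ℕ × (ℕ →₀ ℕ)
  | 0 => (∅, 0)
  | k + 1 =>
    let x := chain a m n ω k
    -- Step `k` consumes the random numbers `2k` for the column and `2k + 1` for the row, both
    -- independent of the state before it.
    let c := insert (pick (colWeight x.1) n (ω (2 * k))) x.1
    (c, x.2 + Finsupp.single (pick (rowWeight a m x.2 c) m (ω (2 * k + 1))) 1)

theorem step_spec {σ : ℕ →₀ ℕ} {c : Finset ℕ} (hσ : ∀ i < m, s.iarr 0 i = σ i)
    (hσm : σ.support ⊆ Finset.range m) (hc : Marks n c s) (hcn : c ⊆ Finset.range n) (hn : 0 < n)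
    (hnm : n ≤ m) (hB : Base m n s) (ht : s.top ≤ m) :
    Reaches A ω step (fun s' =>
      Marks n (insert (pick (colWeight c) n (ω s.drawn)) c) s' ∧
      (∀ i < m, s'.iarr 0 i = (σ + Finsupp.single (pick (rowWeight (entryOrZero A) m σ
        (insert (pick (colWeight c) n (ω s.drawn)) c)) m (ω (s.drawn + 1))) 1 : ℕ →₀ ℕ) i) ∧
      s'.drawn = s.drawn + 2 ∧
      s'.clock ≤ s.clock + (m * (10 * n + 10) + 14 * m + 20 * n + 60 +
        (Finset.Iic σ).card * (14 * m + 35 * n + 60)) ∧ s'.top ≤ m) s := by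
  have hm : 0 < m := hn.trans_le hnm
  rw [step, reaches_seq, reaches_instr, reaches_seq]
  simp only [Instr.effect, hB.cols]
  have hB₁ : Base m n (s.setI 12 n).tick := hB.setI (by decide) _
  refine (colWeights_spec hnm hB₁ ht).mono ?_
  rintro s₂ hF₂ ⟨hw, hc₂, ht₂⟩
  have hB₂ := hB₁.frame hF₂ ⟨rfl, rfl, rfl, rfl, rfl, rfl⟩
  rw [reaches_seq]
  refine (sample_spec (N := n) (w := colWeight c) (by rw [hF₂.ivar 12 rfl]; simp) hn hnm hB₂ ht₂
    ?_).mono ?_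
  · intro j hj
    rw [hw j hj]
    have := hc j hj
    simp [this, colWeight]
    split_ifs <;> simp
  rintro s₃ hF₃ ⟨h7, hd₃, hc₃, ht₃⟩
  have hB₃ := hB₂.frame hF₃ ⟨rfl, rfl, rfl, rfl, rfl, rfl⟩
  have hd₂ : s₂.drawn = s.drawn := hF₂.drawn rfl
  rw [hd₂] at h7 hd₃
  set x := pick (colWeight c) n (ω s.drawn) with hx
  have hxn : x < n := pick_lt _ hn _
  rw [reaches_seq, reaches_instr, reaches_seq]
  simp only [Instr.effect, h7, hB₃.ione]
  set s₄ : MState 16 := ((s₃.setIArr 2 x 1).touch x).tick with hs₄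
  have hB₄ : Base m n s₄ := ⟨hB₃.rows, hB₃.cols, hB₃.izero, hB₃.ione, hB₃.czero, hB₃.cone⟩
  have hm₄ : Marks n (insert x c) s₄ := by
    intro j hj
    have h2 : s₃.iarr 2 = s.iarr 2 := (hF₃.iarr 2 rfl).trans (hF₂.iarr 2 rfl)
    rcases eq_or_ne j x with h | h
    · simp [hs₄, h]
    · have := hc j hj
      simp [hs₄, h, h2, this]
  have h0₄ : ∀ i < m, s₄.iarr 0 i = σ i := by
    have h2 : s₄.iarr 0 = s.iarr 0 := (hF₃.iarr 0 rfl).trans (hF₂.iarr 0 rfl)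
    rw [h2]
    exact hσ
  have hcn' : insert x c ⊆ Finset.range n :=
    Finset.insert_subset (Finset.mem_range.mpr hxn) hcn
  have ht₄ : s₄.top ≤ m := by
    simp [hs₄]
    omega
  refine (minors_spec h0₄ hσm hm₄ hcn' hnm hB₄ ht₄).mono ?_
  rintro s₅ hF₅ ⟨hmin, hc₅, ht₅⟩
  have hB₅ := hB₄.frame hF₅ ⟨rfl, rfl, rfl, rfl, rfl, rfl⟩
  have hm₅ : Marks n (insert x c) s₅ := by rw [Marks, hF₅.iarr 2 rfl]; exact hm₄
  rw [reaches_seq]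
  refine (rowWeights_spec hmin hm₅ hcn' hnm hB₅ ht₅).mono ?_
  rintro s₆ hF₆ ⟨hrow, hc₆, ht₆⟩
  have hB₆ := hB₅.frame hF₆ ⟨rfl, rfl, rfl, rfl, rfl, rfl⟩
  rw [reaches_seq, reaches_instr, reaches_seq]
  simp only [Instr.effect, hB₆.rows]
  have hB₇ : Base m n (s₆.setI 12 m).tick := hB₆.setI (by decide) _
  refine (sample_spec (N := m) (w := rowWeight (entryOrZero A) m σ (insert x c)) (by simp) hm le_rfl
    hB₇ ht₆ hrow).mono ?_
  rintro s₇ hF₇ ⟨h7', hd₇, hc₇, ht₇⟩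
  have hd₆ : (s₆.setI 12 m).tick.drawn = s.drawn + 1 :=
    (hF₆.drawn rfl).trans ((hF₅.drawn rfl).trans hd₃)
  rw [hd₆] at h7' hd₇
  set y := pick (rowWeight (entryOrZero A) m σ (insert x c)) m (ω (s.drawn + 1)) with hy
  have hym : y < m := pick_lt _ hm _
  have h0₇ : s₇.iarr 0 = s₄.iarr 0 := (hF₇.iarr 0 rfl).trans ((hF₆.iarr 0 rfl).trans (hF₅.iarr 0 rfl))
  have hm₇ : s₇.iarr 2 = s₄.iarr 2 := (hF₇.iarr 2 rfl).trans ((hF₆.iarr 2 rfl).trans (hF₅.iarr 2 rfl))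
  simp only [block, reaches_seq, reaches_instr, Instr.effect]
  refine ⟨?_, ?_, ?_, ?_, ?_⟩
  · intro j hj
    simpa [hm₇] using hm₄ j hj
  · intro i hi
    rcases eq_or_ne i y with h | h
    · simp [h7', h, h0₇, h0₄ y hym]
    · simp [h7', h, h0₇, h0₄ i hi]
  · simpa using hd₇
  · simp [hs₄] at hc₂ hc₅ hc₇ ⊢
    omega
  · simp [h7']
    omega

/-- The output for the multiset `σ`. -/
def outputList (m : ℕ) (σ : ℕ → ℕ) : List ℕ :=
  (List.range m).flatMap fun i => List.replicate (σ i) i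

theorem output_spec {σ : ℕ → ℕ} {D : ℕ} (hσ : ∀ i < m, s.iarr 0 i = σ i) (hD : ∀ i < m, σ i ≤ D)
    (hout : s.out = []) (hB : Base m n s) (ht : s.top ≤ m) :
    Reaches A ω output (fun s' => s'.out = outputList m σ ∧
      s'.clock ≤ s.clock + (m * (3 * D + 5) + 2) ∧ s'.top ≤ m) s := by
  refine reaches_for_time
    (fun i s' => s'.out = (List.range i).flatMap fun i => List.replicate (σ i) i)
    (3 * D + 3) m (by exact hB.rows) (by decide) rfl rfl (by exact ht) (by simpa using hout) ?_ ?_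
  · intro i s₁ hi hF hx hI ht₁
    have h0 : s₁.iarr 0 = s.iarr 0 := hF.iarr 0 rfl
    rw [reaches_seq, reaches_instr]
    simp only [Instr.effect]
    have hDi := hD i hi
    refine reaches_for_time (N := σ i)
      (fun j s' => s'.out = ((List.range i).flatMap fun i => List.replicate (σ i) i) ++
        List.replicate j i) 1 m (by simp [h0, hx, hσ i hi]) (by decide) rfl rfl
      (by simp [hx]; omega) (by simpa using hI) ?_ ?_
    · intro j s₂ hj hF₂ hxj hI₂ ht₂
      have h5 : s₂.ivar 5 = i := by rw [hF₂.ivar 5 rfl]; simpa using hx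
      rw [reaches_instr]
      simp [Instr.effect, hI₂, h5, ht₂, List.replicate_succ']
    · intro s₂ hF₂ hI₂ ht₂ hc₂
      simp at hc₂
      refine ⟨?_, ?_, ht₂⟩
      · simp [hI₂, List.range_succ]
      · simp
        omega
  · intro s' hF hI ht' hc'
    refine ⟨hI, ?_, ht'⟩
    simpa using hc'

theorem chain_fst_subset (a : ℕ → ℕ → ℂ) (hn : 0 < n) (ω : ℕ → unitInterval) (k : ℕ) :
    (chain a m n ω k).1 ⊆ Finset.range n := by
  induction k with
  | zero => simp [chain]
  | succ k ih => exact Finset.insert_subset (Finset.mem_range.mpr (pick_lt _ hn _)) ih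

theorem chain_snd_support (a : ℕ → ℕ → ℂ) (hm : 0 < m) (ω : ℕ → unitInterval) (k : ℕ) :
    (chain a m n ω k).2.support ⊆ Finset.range m := by
  classical
  induction k with
  | zero => simp [chain]
  | succ k ih =>
    refine Finsupp.support_add.trans (Finset.union_subset ih ?_)
    refine Finsupp.support_single_subset.trans ?_
    simpa using pick_lt _ hm _

/-- True for every `ω`, whereas the number of chosen columns can fall short on a null set, where the
cap in `pick` may repeat a column. -/
theorem chain_snd_degree (a : ℕ → ℕ → ℂ) (ω : ℕ → unitInterval) (k : ℕ) :
    (chain a m n ω k).2.degree = k := by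
  induction k with
  | zero => simp [chain]
  | succ k ih =>
    rw [chain]
    simp only [map_add, ih, Finsupp.degree_single]

/-- The link between machine and mathematics: everything probabilistic is proved for `chain`. The
time bound depends on the random numbers only through the sizes of the Ryser sums. -/
theorem sampler_spec (hn : 0 < n) (hnm : n ≤ m) :
    Reaches A ω sampler (fun s' => s'.out = outputList m (chain (entryOrZero A) m n ω n).2 ∧
      s'.clock ≤ n * (m * (10 * n + 10) + 14 * m + 20 * n + 62) + m * (3 * n + 5) + 8 +
        ∑ k ∈ Finset.range n, (Finset.Iic (chain (entryOrZero A) m n ω k).2).card *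
          (14 * m + 35 * n + 60) ∧ s'.top ≤ m) (MState.init 16) := by
  have hm : 0 < m := hn.trans_le hnm
  rw [sampler, reaches_seq]
  have hblock : Reaches A ω (block (.rows 0) [.cols 1, .iconst 3 1, .ccast 1 3]) (fun s' =>
      Base m n s' ∧ s'.iarr = (fun _ _ => 0) ∧ s'.out = [] ∧ s'.drawn = 0 ∧ s'.clock = 4 ∧
        s'.top = 0) (MState.init 16) := by
    simp only [block, reaches_seq, reaches_instr, Instr.effect]
    refine ⟨?_, ?_⟩
    · constructor <;> simp [MState.init]
    · simp [MState.init]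
  refine hblock.mono ?_
  rintro s₁ - ⟨hB₁, hi₁, ho₁, hd₁, hc₁, ht₁⟩
  rw [reaches_seq]
  refine reaches_for (fun k s' => Marks n (chain (entryOrZero A) m n ω k).1 s' ∧
      (∀ i < m, s'.iarr 0 i = (chain (entryOrZero A) m n ω k).2 i) ∧ s'.drawn = 2 * k ∧
      s'.clock ≤ 5 + k * (m * (10 * n + 10) + 14 * m + 20 * n + 62) +
        ∑ k ∈ Finset.range k, (Finset.Iic (chain (entryOrZero A) m n ω k).2).card *
          (14 * m + 35 * n + 60) ∧ s'.top ≤ m)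
    (by exact hB₁.cols) (by decide) rfl rfl ?_ ?_ ?_
  · refine ⟨fun j _ => ?_, fun i _ => ?_, ?_, ?_, ?_⟩
    · simp [hi₁, chain]
    · simp [hi₁, chain]
    · simpa using hd₁
    · simp [hc₁]
    · simp [ht₁]
  · rintro k s₂ hk hF₂ hx ⟨hM, hS, hd, hc, ht⟩
    have hB₂ := hB₁.frame hF₂ ⟨rfl, rfl, rfl, rfl, rfl, rfl⟩
    refine (step_spec (s := s₂.tick) hS (chain_snd_support _ hm ω k) hM
      (chain_fst_subset _ hn ω k) hn hnm hB₂.tick ht).mono ?_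
    rintro s₃ hF₃ ⟨hM', hS', hd', hc', ht'⟩
    simp only [MState.tick_drawn, hd] at hM' hS' hd'
    refine ⟨hM', hS', ?_, ?_, ht'⟩
    · simp only [MState.tick_drawn, MState.setI_drawn, hd']
      ring
    · rw [Finset.sum_range_succ, add_mul k]
      simp only [MState.tick_clock, MState.setI_clock] at hc' ⊢
      omega
  · rintro s₂ hF₂ ⟨hM, hS, hd, hc, ht⟩
    have hB₂ := hB₁.frame hF₂ ⟨rfl, rfl, rfl, rfl, rfl, rfl⟩
    refine (output_spec (s := s₂.tick) (D := n) hS (fun i _ => ?_)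
      ((hF₂.out rfl).trans ho₁) hB₂.tick ht).mono ?_
    · exact (Finsupp.le_degree i _).trans (chain_snd_degree _ ω n).le
    · rintro s₃ - ⟨ho, hc', ht'⟩
      refine ⟨ho, ?_, ht'⟩
      simp only [MState.tick_clock] at hc'
      omega

end BosonSampling

namespace BosonSampling

/-! ### Permanents as coefficients of products of linear forms -/

theorem sum_Iic_prod {R : Type*} [CommSemiring R] {m : ℕ} {σ : ℕ →₀ ℕ}
    (hσ : σ.support ⊆ Finset.range m) (g : ℕ → ℕ → R) :
    ∑ t ∈ Finset.Iic σ, ∏ i ∈ Finset.range m, g i (t i) =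
      ∏ i ∈ Finset.range m, ∑ x ∈ Finset.range (σ i + 1), g i x := by
  classical
  rw [Finset.prod_sum]
  refine Finset.sum_bij' (fun t _ => fun i _ => t i)
    (fun p _ => Finsupp.onFinset (Finset.range m)
      (fun i => if h : i ∈ Finset.range m then p i h else 0) (fun i hi => by
        by_contra h
        simp [h] at hi)) ?_ ?_ ?_ ?_ ?_
  · intro t ht
    rw [Finset.mem_pi]
    intro i _
    exact Finset.mem_range.mpr (Nat.lt_succ_of_le (Finset.mem_Iic.mp ht i))
  · intro p hp
    rw [Finset.mem_Iic]
    intro i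
    rw [Finset.mem_pi] at hp
    simp only [Finsupp.onFinset_apply]
    split_ifs with h
    · exact Nat.le_of_lt_succ (Finset.mem_range.mp (hp i h))
    · exact Nat.zero_le _
  · intro t ht
    ext i
    simp only [Finsupp.onFinset_apply]
    split_ifs with h
    · rfl
    · have h1 := Finset.mem_Iic.mp ht i
      have h2 : σ i = 0 := by
        by_contra h0
        exact h (hσ (Finsupp.mem_support_iff.mpr h0))
      omega
  · intro p hp
    funext i hi
    simp only [Finsupp.onFinset_apply, dif_pos hi]
  · intro t ht
    exact (Finset.prod_attach (Finset.range m) fun i => g i (t i)).symm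

theorem card_Iic {m : ℕ} {σ : ℕ →₀ ℕ} (hσ : σ.support ⊆ Finset.range m) :
    (Finset.Iic σ).card = ∏ i ∈ Finset.range m, (σ i + 1) := by
  have := sum_Iic_prod (R := ℕ) hσ fun _ _ => 1
  simpa using this

/-- Up to the sign (-1)^s, the sum is the s-th forward difference of x^u at 0, which is s! for u = s
and vanishes for u < s. -/
theorem sum_signedChoose_mul_pow {s u : ℕ} (hu : u ≤ s) :
    ∑ x ∈ Finset.range (s + 1), signedChoose s x * (x : ℂ) ^ u =
      if u = s then (-1) ^ s * (s.factorial : ℂ) else 0 := by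
  have h := fwdDiff_iter_eq_sum_shift (1 : ℂ) (fun x : ℂ => x ^ u) s 0
  have h2 : ∑ x ∈ Finset.range (s + 1), signedChoose s x * (x : ℂ) ^ u =
      (-1) ^ s * (fwdDiff (1 : ℂ))^[s] (fun x : ℂ => x ^ u) 0 := by
    rw [h, Finset.mul_sum]
    refine Finset.sum_congr rfl fun x hx => ?_
    have hxs : x ≤ s := Nat.le_of_lt_succ (Finset.mem_range.mp hx)
    have hpow : (-1 : ℂ) ^ s * (-1) ^ (s - x) = (-1) ^ x := by
      rw [← pow_add, show s + (s - x) = 2 * (s - x) + x by omega, pow_add, pow_mul]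
      simp
    simp only [signedChoose, zero_add, nsmul_eq_mul, mul_one, zsmul_eq_mul]
    push_cast
    linear_combination (-(s.choose x : ℂ) * (x : ℂ) ^ u) * hpow
  rw [h2]
  split_ifs with hus
  · subst hus
    rw [fwdDiff_iter_eq_factorial]
    simp
  · rw [fwdDiff_iter_pow_eq_zero_of_lt (lt_of_le_of_ne hu hus)]
    simp

/-- The product of the factorials of the multiplicities. -/
def factorials (m : ℕ) (σ : ℕ →₀ ℕ) : ℕ := ∏ i ∈ Finset.range m, (σ i).factorial

theorem factorials_pos (m : ℕ) (σ : ℕ →₀ ℕ) : 0 < factorials m σ :=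
  Finset.prod_pos fun _ _ => Nat.factorial_pos _

theorem factorials_add_single {m i : ℕ} (hi : i < m) (σ : ℕ →₀ ℕ) :
    factorials m (σ + Finsupp.single i 1) = factorials m σ * (σ i + 1) := by
  have hi' := Finset.mem_range.mpr hi
  rw [factorials, factorials, ← Finset.mul_prod_erase _ _ hi',
    ← Finset.mul_prod_erase _ (fun i => (σ i).factorial) hi']
  have : ∏ x ∈ (Finset.range m).erase i, ((σ + Finsupp.single i 1 : ℕ →₀ ℕ) x).factorial =
      ∏ x ∈ (Finset.range m).erase i, (σ x).factorial :=
    Finset.prod_congr rfl fun x hx => by simp [Finset.ne_of_mem_erase hx]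
  rw [this]
  simp [Nat.factorial_succ]
  ring

theorem degree_eq_sum {m : ℕ} {σ : ℕ →₀ ℕ} (hσ : σ.support ⊆ Finset.range m) :
    σ.degree = ∑ i ∈ Finset.range m, σ i := by
  rw [Finsupp.degree_apply]
  exact Finset.sum_subset hσ fun i _ hi => by simpa using hi

/-- A homogeneous polynomial is turned into a coefficient by taking differences. -/
theorem sum_signedChoose_mul_eval {m : ℕ} {σ : ℕ →₀ ℕ} (hσ : σ.support ⊆ Finset.range m)
    {p : MvPolynomial ℕ ℂ} (hp : p.IsHomogeneous σ.degree) :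
    ∑ t ∈ Finset.Iic σ, (∏ i ∈ Finset.range m, signedChoose (σ i) (t i)) *
        MvPolynomial.eval (fun i => (t i : ℂ)) p =
      (-1) ^ σ.degree * (factorials m σ : ℂ) * p.coeff σ := by
  classical
  -- The sum factors over the variables. A monomial of the same degree as `σ` but different from it,
  -- in the first `m` variables, has some exponent below that of `σ`, and the difference in that
  -- variable kills it. A variable outside the range is evaluated at `t i = 0`.
  have hmon : ∀ u : ℕ →₀ ℕ, u.degree = σ.degree →
      ∑ t ∈ Finset.Iic σ, (∏ i ∈ Finset.range m, signedChoose (σ i) (t i)) *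
        ∏ i ∈ u.support, (t i : ℂ) ^ u i =
      if u = σ then (-1) ^ σ.degree * (factorials m σ : ℂ) else 0 := by
    intro u hu
    by_cases hum : u.support ⊆ Finset.range m
    · have h1 : ∀ t ∈ Finset.Iic σ, (∏ i ∈ Finset.range m, signedChoose (σ i) (t i)) *
          ∏ i ∈ u.support, (t i : ℂ) ^ u i =
          ∏ i ∈ Finset.range m, signedChoose (σ i) (t i) * (t i : ℂ) ^ u i := by
        intro t _
        rw [Finset.prod_mul_distrib]
        congr 1
        exact Finset.prod_subset hum fun i _ hi => by
          rw [Finsupp.notMem_support_iff.mp hi, pow_zero]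
      rw [Finset.sum_congr rfl h1,
        sum_Iic_prod hσ fun i x => signedChoose (σ i) x * (x : ℂ) ^ u i]
      split_ifs with huσ
      · subst huσ
        rw [Finset.prod_congr rfl fun i _ => by
          rw [sum_signedChoose_mul_pow (le_refl (u i)), if_pos rfl]]
        rw [Finset.prod_mul_distrib, Finset.prod_pow_eq_pow_sum, ← degree_eq_sum hσ, factorials]
        push_cast
        rfl
      · have : ∃ i ∈ Finset.range m, u i < σ i := by
          by_contra! hcon
          have hle : σ ≤ u := fun i => by
            by_cases hi : i ∈ Finset.range m
            · exact hcon i hi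
            · rw [Finsupp.notMem_support_iff.mp fun h => hi (hσ h)]
              exact Nat.zero_le _
          obtain ⟨v, rfl⟩ := le_iff_exists_add.mp hle
          rw [map_add] at hu
          have hv : v = 0 := by
            rw [← Finsupp.degree_eq_zero_iff]
            omega
          exact huσ (by simp [hv])
        obtain ⟨i, hi, hlt⟩ := this
        refine Finset.prod_eq_zero hi ?_
        rw [sum_signedChoose_mul_pow hlt.le, if_neg hlt.ne]
    · rw [if_neg (fun h : u = σ => hum (h ▸ hσ))]
      obtain ⟨i, hi, him⟩ := Finset.not_subset.mp hum
      refine Finset.sum_eq_zero fun t ht => ?_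
      have hti : t i = 0 := by
        have h1 := Finset.mem_Iic.mp ht i
        rw [Finsupp.notMem_support_iff.mp fun h => him (hσ h)] at h1
        omega
      rw [Finset.prod_eq_zero hi, mul_zero]
      rw [hti, Nat.cast_zero, zero_pow (Finsupp.mem_support_iff.mp hi)]
  simp_rw [MvPolynomial.eval_eq, Finset.mul_sum]
  rw [Finset.sum_comm]
  have h2 : ∀ u ∈ p.support, ∑ t ∈ Finset.Iic σ,
      (∏ i ∈ Finset.range m, signedChoose (σ i) (t i)) *
        (p.coeff u * ∏ i ∈ u.support, (t i : ℂ) ^ u i) =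
      if u = σ then (-1) ^ σ.degree * (factorials m σ : ℂ) * p.coeff u else 0 := by
    intro u hu
    have hd : u.degree = σ.degree := by
      by_contra h
      exact MvPolynomial.mem_support_iff.mp hu (hp.coeff_eq_zero h)
    have := congrArg (p.coeff u * ·) (hmon u hd)
    simp only [Finset.mul_sum, mul_ite, mul_zero] at this
    rw [mul_comm _ (p.coeff u), ← this]
    exact Finset.sum_congr rfl fun t _ => by ring
  rw [Finset.sum_congr rfl h2, Finset.sum_ite_eq']
  split_ifs with h
  · rfl
  · rw [MvPolynomial.notMem_support_iff.mp h, mul_zero]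

/-- The linear form of column `j`. -/
noncomputable def linForm (a : ℕ → ℕ → ℂ) (m j : ℕ) : MvPolynomial ℕ ℂ :=
  ∑ i ∈ Finset.range m, MvPolynomial.C (a i j) * MvPolynomial.X i

/-- The coefficient of the product of the linear forms of the columns in `c` at the exponents
`σ`. -/
noncomputable def amp (a : ℕ → ℕ → ℂ) (m : ℕ) (σ : ℕ →₀ ℕ) (c : Finset ℕ) : ℂ :=
  (∏ j ∈ c, linForm a m j).coeff σ

theorem prod_linForm_isHomogeneous (a : ℕ → ℕ → ℂ) (m : ℕ) (c : Finset ℕ) :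
    (∏ j ∈ c, linForm a m j).IsHomogeneous c.card := by
  have := MvPolynomial.IsHomogeneous.prod c (linForm a m) (fun _ => 1) fun j _ =>
    MvPolynomial.IsHomogeneous.sum _ _ _ fun i _ => by
      simpa using (MvPolynomial.isHomogeneous_C ℕ (a i j)).mul (MvPolynomial.isHomogeneous_X ℂ i)
  simpa using this

/-- The Ryser sum is the mixed finite difference of order `σ` of the product of the linear forms, a
homogeneous polynomial of the right degree. -/
theorem ryser_eq (a : ℕ → ℕ → ℂ) {m : ℕ} {σ : ℕ →₀ ℕ} {c : Finset ℕ}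
    (hσ : σ.support ⊆ Finset.range m) (hc : c.card = σ.degree) :
    ryser a m σ c = (-1) ^ σ.degree * (factorials m σ : ℂ) * amp a m σ c := by
  rw [amp, ← sum_signedChoose_mul_eval hσ (hc ▸ prod_linForm_isHomogeneous a m c), ryser]
  refine Finset.sum_congr rfl fun t _ => ?_
  rw [ryserTerm, map_prod]
  congr 1
  refine Finset.prod_congr rfl fun j _ => ?_
  simp [linForm, mul_comm]

theorem derivation_prod {R : Type*} [CommRing R] [Algebra ℂ R] (D : Derivation ℂ R R)
    (f : ℕ → R) (c : Finset ℕ) :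
    D (∏ j ∈ c, f j) = ∑ l ∈ c, D (f l) * ∏ j ∈ c.erase l, f j := by
  classical
  induction c using Finset.induction_on with
  | empty => simp
  | insert x c hx ih =>
    rw [Finset.prod_insert hx, D.leibniz, ih, Finset.sum_insert hx, Finset.erase_insert hx]
    simp only [smul_eq_mul, Finset.mul_sum]
    rw [add_comm, mul_comm]
    congr 1
    refine Finset.sum_congr rfl fun l hl => ?_
    have hne : l ≠ x := fun h => hx (h ▸ hl)
    rw [Finset.erase_insert_of_ne hne.symm, Finset.prod_insert fun h => hx (Finset.mem_of_mem_erase h)]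
    ring

/-- Laplace expansion. -/
theorem amp_add_single (a : ℕ → ℕ → ℂ) {m i : ℕ} (hi : i < m) (σ : ℕ →₀ ℕ) (c : Finset ℕ) :
    amp a m (σ + Finsupp.single i 1) c * (σ i + 1) = ∑ l ∈ c, a i l * amp a m σ (c.erase l) := by
  have hD : ∀ l, MvPolynomial.pderiv i (linForm a m l) = MvPolynomial.C (a i l) := by
    intro l
    rw [linForm, map_sum, Finset.sum_eq_single i]
    · rw [MvPolynomial.pderiv_C_mul]
      simp
    · intro j _ hj
      rw [MvPolynomial.pderiv_C_mul, MvPolynomial.pderiv_X_of_ne hj, mul_zero]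
    · intro h
      exact absurd (Finset.mem_range.mpr hi) h
  -- Expansion along row `i` is the product rule for ∂/∂x_i: the derivative of the form of column
  -- `l` is the constant `a i l`, and differentiation turns the coefficient at `σ + e_i` into `σ i +
  -- 1` times it at `σ`.
  rw [amp, ← MvPolynomial.coeff_pderiv, derivation_prod, MvPolynomial.coeff_sum]
  exact Finset.sum_congr rfl fun l _ => by rw [hD, MvPolynomial.coeff_C_mul, amp]

/-- The weight of the multiset `σ` for the columns in `c`. -/
noncomputable def weight (a : ℕ → ℕ → ℂ) (m : ℕ) (σ : ℕ →₀ ℕ) (c : Finset ℕ) : ℝ :=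
  factorials m σ * ‖amp a m σ c‖ ^ 2

theorem weight_nonneg (a : ℕ → ℕ → ℂ) (m : ℕ) (σ : ℕ →₀ ℕ) (c : Finset ℕ) : 0 ≤ weight a m σ c := by
  unfold weight
  positivity

/-- By Laplace expansion the combined minors are, up to sign, `(σ + e_i)!` times the coefficient at
`σ + e_i`. One of the two factors `(σ + e_i)!` in the square is part of `weight`. -/
theorem rowWeight_eq (a : ℕ → ℕ → ℂ) {m i : ℕ} {σ : ℕ →₀ ℕ} {c : Finset ℕ} (hi : i < m)
    (hσ : σ.support ⊆ Finset.range m) (hc : c.card = σ.degree + 1) :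
    rowWeight a m σ c i = factorials m σ * (σ i + 1) * weight a m (σ + Finsupp.single i 1) c := by
  have h1 : ∑ l ∈ c, a i l * ryser a m σ (c.erase l) = (-1) ^ σ.degree *
      ((factorials m σ * (σ i + 1) : ℕ) : ℂ) * amp a m (σ + Finsupp.single i 1) c := by
    have : ∑ l ∈ c, a i l * ryser a m σ (c.erase l) =
        (-1) ^ σ.degree * (factorials m σ : ℂ) * ∑ l ∈ c, a i l * amp a m σ (c.erase l) := by
      rw [Finset.mul_sum]
      refine Finset.sum_congr rfl fun l hl => ?_
      rw [ryser_eq a hσ (by rw [Finset.card_erase_of_mem hl, hc]; simp)]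
      ring
    rw [this, ← amp_add_single a hi]
    push_cast
    ring
  rw [rowWeight, h1, weight, factorials_add_single hi, norm_mul, norm_mul, norm_pow, norm_neg,
    norm_one, one_pow, one_mul, Complex.norm_natCast]
  push_cast
  ring

/-- The first `n` columns are orthonormal. -/
def OrthonormalCols (a : ℕ → ℕ → ℂ) (m n : ℕ) : Prop :=
  ∀ l < n, ∀ l' < n, ∑ i ∈ Finset.range m, a i l * starRingEnd ℂ (a i l') = if l = l' then 1 else 0

/-- A matrix with orthonormal columns is an isometry. -/
theorem OrthonormalCols.sum_norm_sq {a : ℕ → ℕ → ℂ} {m n : ℕ} (h : OrthonormalCols a m n)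
    {c : Finset ℕ} (hc : c ⊆ Finset.range n) (M : ℕ → ℂ) :
    ∑ i ∈ Finset.range m, ‖∑ l ∈ c, a i l * M l‖ ^ 2 = ∑ l ∈ c, ‖M l‖ ^ 2 := by
  have key : ((∑ i ∈ Finset.range m, ‖∑ l ∈ c, a i l * M l‖ ^ 2 : ℝ) : ℂ) =
      ((∑ l ∈ c, ‖M l‖ ^ 2 : ℝ) : ℂ) := by
    push_cast
    simp_rw [← Complex.mul_conj', map_sum, map_mul, Finset.sum_mul_sum]
    rw [Finset.sum_comm]
    refine Finset.sum_congr rfl fun l hl => ?_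
    rw [Finset.sum_comm]
    have : ∀ l' ∈ c, ∑ i ∈ Finset.range m, a i l * M l *
        (starRingEnd ℂ (a i l') * starRingEnd ℂ (M l')) =
        if l = l' then M l * starRingEnd ℂ (M l') else 0 := by
      intro l' hl'
      have := h l (Finset.mem_range.mp (hc hl)) l' (Finset.mem_range.mp (hc hl'))
      calc _ = (∑ i ∈ Finset.range m, a i l * starRingEnd ℂ (a i l')) *
            (M l * starRingEnd ℂ (M l')) := by
            rw [Finset.sum_mul]
            exact Finset.sum_congr rfl fun i _ => by ring
        _ = _ := by rw [this]; split_ifs <;> simp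
    rw [Finset.sum_congr rfl this, Finset.sum_ite_eq, if_pos hl]
  exact_mod_cast key

/-- The normalising constant of the row draw is symmetric in the columns of `c`: it does not
remember which of them was added last. The exactness of the sampler rests on this. -/
theorem OrthonormalCols.sum_rowWeight {a : ℕ → ℕ → ℂ} {m n : ℕ} (h : OrthonormalCols a m n)
    {σ : ℕ →₀ ℕ} {c : Finset ℕ} (hc : c ⊆ Finset.range n) (hσ : σ.support ⊆ Finset.range m)
    (hcard : c.card = σ.degree + 1) :
    ∑ i ∈ Finset.range m, rowWeight a m σ c i =
      factorials m σ * ∑ l ∈ c, weight a m σ (c.erase l) := by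
  simp_rw [rowWeight]
  rw [h.sum_norm_sq hc, Finset.mul_sum]
  refine Finset.sum_congr rfl fun l hl => ?_
  rw [ryser_eq a hσ (by rw [Finset.card_erase_of_mem hl, hcard]; simp), weight, norm_mul, norm_mul,
    norm_pow, norm_neg, norm_one, one_pow, one_mul, Complex.norm_natCast]
  ring

end BosonSampling

namespace BosonSampling

/-! ### The law of the sampled index -/

instance : IsProbabilityMeasure uniformSeq := by
  unfold uniformSeq
  infer_instance

theorem measurable_pick (w : ℕ → ℝ) (N : ℕ) :
    Measurable fun u : unitInterval => pick w N u := by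
  unfold pick
  simp_rw [Finset.card_filter]
  refine Measurable.min (Finset.measurable_sum _ fun i _ => ?_) measurable_const
  refine Measurable.ite ?_ measurable_const measurable_const
  exact measurableSet_le measurable_const (measurable_subtype_coe.mul_const _)

theorem pick_eq_of_mem {w : ℕ → ℝ} {N i : ℕ} {u : ℝ} (hw : ∀ q, 0 ≤ w q) (hi : i < N)
    (h1 : ∑ q ∈ Finset.range i, w q ≤ u * ∑ q ∈ Finset.range N, w q)
    (h2 : u * ∑ q ∈ Finset.range N, w q < ∑ q ∈ Finset.range (i + 1), w q) : pick w N u = i := by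
  have hmono : Monotone fun i => ∑ q ∈ Finset.range i, w q :=
    monotone_nat_of_le_succ fun i => by
      rw [Finset.sum_range_succ]
      linarith [hw i]
  have : ((Finset.range N).filter fun i =>
      ∑ q ∈ Finset.range (i + 1), w q ≤ u * ∑ q ∈ Finset.range N, w q) = Finset.range i := by
    ext j
    simp only [Finset.mem_filter, Finset.mem_range]
    constructor
    · rintro ⟨-, h⟩
      by_contra hj
      have : ∑ q ∈ Finset.range (i + 1), w q ≤ ∑ q ∈ Finset.range (j + 1), w q :=
        hmono (by omega : i + 1 ≤ j + 1)
      linarith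
    · intro hj
      have : ∑ q ∈ Finset.range (j + 1), w q ≤ ∑ q ∈ Finset.range i, w q :=
        hmono (by omega : j + 1 ≤ i)
      exact ⟨by omega, by linarith⟩
  rw [pick, this, Finset.card_range]
  omega

theorem exists_pick_interval {w : ℕ → ℝ} {N : ℕ} {u : ℝ} (hW : 0 < ∑ q ∈ Finset.range N, w q)
    (hu0 : 0 ≤ u) (hu1 : u < 1) : ∃ i < N,
      ∑ q ∈ Finset.range i, w q ≤ u * ∑ q ∈ Finset.range N, w q ∧
      u * ∑ q ∈ Finset.range N, w q < ∑ q ∈ Finset.range (i + 1), w q := by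
  classical
  have hex : ∃ i, u * ∑ q ∈ Finset.range N, w q < ∑ q ∈ Finset.range i, w q := ⟨N, by nlinarith⟩
  have hpos : Nat.find hex ≠ 0 := by
    intro h
    have := Nat.find_spec hex
    rw [h, Finset.sum_range_zero] at this
    have : 0 ≤ u * ∑ q ∈ Finset.range N, w q := mul_nonneg hu0 hW.le
    linarith
  obtain ⟨i, hi⟩ := Nat.exists_eq_succ_of_ne_zero hpos
  have hle : Nat.find hex ≤ N := Nat.find_min' hex (by nlinarith)
  refine ⟨i, by omega, not_lt.mp (Nat.find_min hex (by omega)), ?_⟩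
  have := Nat.find_spec hex
  rwa [hi] at this

theorem pick_eq_iff {w : ℕ → ℝ} {N i : ℕ} {u : ℝ} (hw : ∀ q, 0 ≤ w q)
    (hW : 0 < ∑ q ∈ Finset.range N, w q) (hu0 : 0 ≤ u) (hu1 : u < 1) (hi : i < N) :
    pick w N u = i ↔ ∑ q ∈ Finset.range i, w q ≤ u * ∑ q ∈ Finset.range N, w q ∧
      u * ∑ q ∈ Finset.range N, w q < ∑ q ∈ Finset.range (i + 1), w q := by
  constructor
  · intro h
    obtain ⟨i', hi', h1, h2⟩ := exists_pick_interval hW hu0 hu1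
    have := pick_eq_of_mem hw hi' h1 h2
    rw [h] at this
    subst this
    exact ⟨h1, h2⟩
  · rintro ⟨h1, h2⟩
    exact pick_eq_of_mem hw hi h1 h2

theorem weight_pick_pos {w : ℕ → ℝ} {N : ℕ} {u : ℝ} (hw : ∀ q, 0 ≤ w q)
    (hW : 0 < ∑ q ∈ Finset.range N, w q) (hu0 : 0 ≤ u) (hu1 : u < 1) : 0 < w (pick w N u) := by
  obtain ⟨i, hi, h1, h2⟩ := exists_pick_interval hW hu0 hu1
  rw [pick_eq_of_mem hw hi h1 h2]
  rw [Finset.sum_range_succ] at h2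
  linarith

theorem ae_lt_one : ∀ᵐ u : unitInterval, (u : ℝ) < 1 := by
  have : (volume : Measure unitInterval) {1} = 0 := by simp
  refine measure_mono_null (fun u hu => ?_) this
  simp only [Set.mem_compl_iff, Set.mem_ofPred_eq, not_lt] at hu
  exact Subtype.ext (le_antisymm u.2.2 hu)

/-- Apart from the null set `u = 1`, the index `i` is picked exactly when `u` lies in the half-open
interval between two consecutive normalised cumulative weights. -/
theorem volume_pick {w : ℕ → ℝ} {N i : ℕ} (hw : ∀ q, 0 ≤ w q)
    (hW : 0 < ∑ q ∈ Finset.range N, w q) (hi : i < N) :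
    volume {u : unitInterval | pick w N u = i} =
      ENNReal.ofReal (w i / ∑ q ∈ Finset.range N, w q) := by
  set W := ∑ q ∈ Finset.range N, w q with hWdef
  have hcum : ∀ j ≤ N, (∑ q ∈ Finset.range j, w q) / W ∈ unitInterval := by
    intro j hj
    have h0 : 0 ≤ ∑ q ∈ Finset.range j, w q := Finset.sum_nonneg fun q _ => hw q
    have h1 : ∑ q ∈ Finset.range j, w q ≤ W :=
      Finset.sum_le_sum_of_subset_of_nonneg (Finset.range_mono hj) fun q _ _ => hw q
    exact ⟨div_nonneg h0 hW.le, (div_le_one hW).mpr h1⟩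
  have hset : {u : unitInterval | pick w N u = i} =ᵐ[volume]
      Set.Ico (⟨_, hcum i hi.le⟩ : unitInterval) ⟨_, hcum (i + 1) hi⟩ := by
    filter_upwards [ae_lt_one] with u hu
    refine propext ?_
    change pick w N u = i ↔ _ ≤ (u : ℝ) ∧ (u : ℝ) < _
    rw [pick_eq_iff hw hW u.2.1 hu hi, div_le_iff₀ hW, lt_div_iff₀ hW]
  rw [measure_congr hset, unitInterval.volume_Ico]
  congr 1
  simp only
  rw [Finset.sum_range_succ]
  ring

/-! ### The law of the chain -/

/-- An event that depends only on the first `j` coordinates is the preimage, under restriction to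
them, of a measurable set (extend by zero), and this restriction is independent of coordinate `j`.
-/
theorem uniformSeq_inter_coord {E : Set (ℕ → unitInterval)} {j : ℕ} (hE : MeasurableSet E)
    (hdep : ∀ ω ω' : ℕ → unitInterval, (∀ i < j, ω i = ω' i) → ω ∈ E → ω' ∈ E)
    {B : Set unitInterval} (hB : MeasurableSet B) :
    uniformSeq (E ∩ {ω | ω j ∈ B}) = uniformSeq E * volume B := by
  classical
  have hind : ProbabilityTheory.iIndepFun (fun (i : ℕ) (ω : ℕ → unitInterval) => ω i) uniformSeq :=
    ProbabilityTheory.iIndepFun_infinitePi (P := fun _ : ℕ => (volume : Measure unitInterval))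
      (X := fun _ x => x) fun _ => measurable_id
  have h2 := hind.indepFun_finset (Finset.range j) {j} (by simp) fun i => measurable_pi_apply i
  let ext : (Finset.range j → unitInterval) → ℕ → unitInterval :=
    fun y i => if h : i ∈ Finset.range j then y ⟨i, h⟩ else 0
  have hext : Measurable ext := by
    refine measurable_pi_lambda _ fun i => ?_
    by_cases h : i ∈ Finset.range j
    · simp only [ext, h, dite_true]
      exact measurable_pi_apply _
    · simp only [ext, h, dite_false]
      exact measurable_const
  have hpre : E = (fun (ω : ℕ → unitInterval) (i : Finset.range j) => ω i) ⁻¹' (ext ⁻¹' E) := by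
    ext ω
    have hag : ∀ i < j, ω i = ext (fun i : Finset.range j => ω i) i := by
      intro i hi
      simp [ext, hi]
    exact ⟨hdep _ _ hag, hdep _ _ fun i hi => (hag i hi).symm⟩
  have hpreB : {ω : ℕ → unitInterval | ω j ∈ B} =
      (fun (ω : ℕ → unitInterval) (i : ({j} : Finset ℕ)) => ω i) ⁻¹'
        {y | y ⟨j, Finset.mem_singleton_self j⟩ ∈ B} := rfl
  have hmB : MeasurableSet {y : ({j} : Finset ℕ) → unitInterval |
      y ⟨j, Finset.mem_singleton_self j⟩ ∈ B} := measurable_pi_apply _ hB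
  have h3 := h2.measure_inter_preimage_eq_mul _ _ (hext hE) hmB
  rw [← hpre, ← hpreB] at h3
  rw [h3]
  congr 1
  have := Measure.infinitePi_map_eval (fun _ : ℕ => (volume : Measure unitInterval)) j
  conv_rhs => rw [← this]
  rw [Measure.map_apply (measurable_pi_apply j) hB]
  rfl

variable (a : ℕ → ℕ → ℂ) (m n : ℕ)

theorem chain_congr {k : ℕ} {ω ω' : ℕ → unitInterval} (h : ∀ i < 2 * k, ω i = ω' i) :
    chain a m n ω k = chain a m n ω' k := by
  induction k with
  | zero => rfl
  | succ k ih =>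
    rw [chain, chain, ih fun i hi => h i (by omega), h (2 * k) (by omega),
      h (2 * k + 1) (by omega)]

/-- The states are countably many, so the event for `k + 1` is a countable union over the previous
state and the two picks. -/
theorem measurableSet_chain (k : ℕ) (x : Finset ℕ × (ℕ →₀ ℕ)) :
    MeasurableSet {ω | chain a m n ω k = x} := by
  induction k generalizing x with
  | zero => exact MeasurableSet.const ((∅, 0) = x)
  | succ k ih =>
    have : {ω | chain a m n ω (k + 1) = x} = ⋃ (y : Finset ℕ × (ℕ →₀ ℕ)) (l : ℕ) (i : ℕ),
        {ω | chain a m n ω k = y} ∩ ({ω | pick (colWeight y.1) n (ω (2 * k)) = l} ∩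
          ({ω | pick (rowWeight a m y.2 (insert l y.1)) m (ω (2 * k + 1)) = i} ∩
          {_ω | (insert l y.1, y.2 + Finsupp.single i 1) = x})) := by
      ext ω
      simp only [Set.mem_iUnion, Set.mem_inter_iff, Set.mem_ofPred_eq]
      constructor
      · intro h
        exact ⟨_, _, _, rfl, rfl, rfl, h⟩
      · rintro ⟨y, l, i, rfl, rfl, rfl, h⟩
        exact h
    rw [this]
    refine MeasurableSet.iUnion fun y => MeasurableSet.iUnion fun l => MeasurableSet.iUnion fun i =>
      (ih y).inter (MeasurableSet.inter ?_ (MeasurableSet.inter ?_ (MeasurableSet.const _)))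
    · exact (measurable_pick _ _).comp (measurable_pi_apply (2 * k)) (measurableSet_singleton l)
    · exact (measurable_pick _ _).comp (measurable_pi_apply (2 * k + 1)) (measurableSet_singleton i)

theorem card_chain_le (ω : ℕ → unitInterval) (k : ℕ) : (chain a m n ω k).1.card ≤ k := by
  induction k with
  | zero => simp [chain]
  | succ k ih => exact (Finset.card_insert_le _ _).trans (Nat.succ_le_succ ih)

variable {m n}

theorem colWeight_nonneg (c : Finset ℕ) (j : ℕ) : 0 ≤ colWeight c j := by
  unfold colWeight
  split_ifs <;> norm_num

theorem sum_colWeight {c : Finset ℕ} (hc : c ⊆ Finset.range n) :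
    ∑ j ∈ Finset.range n, colWeight c j = n - c.card := by
  have h : ∀ j, colWeight c j = 1 - if j ∈ c then 1 else 0 := by
    intro j
    unfold colWeight
    split_ifs <;> norm_num
  simp_rw [h]
  rw [Finset.sum_sub_distrib, ← Finset.sum_filter, Finset.filter_mem_eq_inter,
    Finset.inter_eq_right.mpr hc]
  simp

/-- Almost surely no random number equals 1, and then `pick` returns an index of positive weight,
that is, an unused column. -/
theorem ae_card_chain (hn : 0 < n) {k : ℕ} (hk : k ≤ n) :
    ∀ᵐ ω ∂uniformSeq, (chain a m n ω k).1.card = k := by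
  have hall : ∀ i : ℕ, ∀ᵐ ω ∂uniformSeq, ((ω i : unitInterval) : ℝ) < 1 := by
    intro i
    have hmap := Measure.infinitePi_map_eval (fun _ : ℕ => (volume : Measure unitInterval)) i
    have := ae_lt_one
    rw [← hmap] at this
    exact ae_of_ae_map (measurable_pi_apply i).aemeasurable this
  filter_upwards [ae_all_iff.mpr hall] with ω hω
  induction k with
  | zero => simp [chain]
  | succ k ih =>
    have ih' := ih (by omega)
    have hsub := chain_fst_subset (m := m) a hn ω k
    have hpos : 0 < ∑ j ∈ Finset.range n, colWeight (chain a m n ω k).1 j := by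
      rw [sum_colWeight hsub, ih', sub_pos]
      exact_mod_cast hk
    have := weight_pick_pos (colWeight_nonneg _) hpos (ω (2 * k)).2.1 (hω (2 * k))
    have hnot : pick (colWeight (chain a m n ω k).1) n (ω (2 * k)) ∉ (chain a m n ω k).1 := by
      intro h
      rw [colWeight, if_pos h] at this
      exact lt_irrefl _ this
    rw [chain]
    simp only
    rw [Finset.card_insert_of_notMem hnot, ih']

variable {a}

theorem uniformSeq_chain_step {c : Finset ℕ} {σ : ℕ →₀ ℕ} {k l i : ℕ}
    (h : OrthonormalCols a m n) (hc : insert l c ⊆ Finset.range n) (hl : l ∉ c) (hcard : c.card = k)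
    (hσ : σ.support ⊆ Finset.range m) (hdeg : σ.degree = k) (hi : i < m) {p : ℝ} (hp : 0 ≤ p)
    (hμ : uniformSeq {ω | chain a m n ω k = (c, σ)} = ENNReal.ofReal (p * weight a m σ c)) :
    uniformSeq ({ω | chain a m n ω k = (c, σ)} ∩
        {ω | ω (2 * k) ∈ {u : unitInterval | pick (colWeight c) n u = l}} ∩
        {ω | ω (2 * k + 1) ∈
          {u : unitInterval | pick (rowWeight a m σ (insert l c)) m u = i}}) =
      ENNReal.ofReal (p * weight a m σ c * (1 / (n - k)) *
        (rowWeight a m σ (insert l c) i /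
          ∑ i ∈ Finset.range m, rowWeight a m σ (insert l c) i)) := by
  have hmE := measurableSet_chain a m n k (c, σ)
  have hm1 : MeasurableSet {u : unitInterval | pick (colWeight c) n u = l} :=
    measurable_pick _ _ (measurableSet_singleton l)
  have hm2 : MeasurableSet {u : unitInterval | pick (rowWeight a m σ (insert l c)) m u = i} :=
    measurable_pick _ _ (measurableSet_singleton i)
  have hln : l < n := Finset.mem_range.mp (hc (Finset.mem_insert_self _ _))
  have hkn : k < n := by
    have := Finset.card_le_card hc
    rw [Finset.card_insert_of_notMem hl, Finset.card_range] at this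
    omega
  have hkn' : (0 : ℝ) < n - k := sub_pos.mpr (by exact_mod_cast hkn)
  have hnonneg : ∀ i, 0 ≤ rowWeight a m σ (insert l c) i := fun i => sq_nonneg _
  have hmE' : MeasurableSet ({ω | chain a m n ω k = (c, σ)} ∩
      {ω | ω (2 * k) ∈ {u : unitInterval | pick (colWeight c) n u = l}}) :=
    hmE.inter (measurable_pi_apply (2 * k) hm1)
  rw [uniformSeq_inter_coord hmE' ?_ hm2,
    uniformSeq_inter_coord hmE ?_ hm1, hμ]
  · have hsum := sum_colWeight ((Finset.subset_insert l c).trans hc)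
    rw [hcard] at hsum
    rw [volume_pick (colWeight_nonneg c) (by rw [hsum]; exact hkn') hln, hsum, colWeight, if_neg hl,
      ← ENNReal.ofReal_mul (mul_nonneg hp (weight_nonneg _ _ _ _))]
    -- If all row weights vanish, the drawn row is arbitrary. But `weight a m σ c` is a summand (the
    -- one for `l`) of their sum, up to `factorials m σ`, so the previous state has probability zero
    -- and both sides vanish.
    rcases (Finset.sum_nonneg fun i (_ : i ∈ Finset.range m) => hnonneg i).eq_or_lt with h0 | hpos
    · have hw : weight a m σ c = 0 := by
        rw [h.sum_rowWeight hc hσ (by rw [Finset.card_insert_of_notMem hl, hcard, hdeg])] at h0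
        rcases mul_eq_zero.mp h0.symm with h1 | h1
        · exact absurd h1 (by exact_mod_cast (factorials_pos m σ).ne')
        · have := (Finset.sum_eq_zero_iff_of_nonneg fun l' _ => weight_nonneg _ _ _ _).mp h1 l
            (Finset.mem_insert_self _ _)
          rwa [Finset.erase_insert hl] at this
      simp [hw]
    · rw [volume_pick hnonneg hpos hi, ← ENNReal.ofReal_mul]
      exact mul_nonneg (mul_nonneg hp (weight_nonneg _ _ _ _)) (div_nonneg zero_le_one hkn'.le)
  · intro ω ω' hag hω
    exact (chain_congr a m n hag).symm.trans hω
  · rintro ω ω' hag ⟨hω, hω2⟩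
    refine ⟨(chain_congr a m n fun i hi => hag i (by omega)).symm.trans hω, ?_⟩
    change pick _ _ _ = _
    rw [← hag (2 * k) (by omega)]
    exact hω2

end BosonSampling

/-! ### The joint law of the chosen columns and the sampled rows. -/

namespace BosonSampling

variable {a : ℕ → ℕ → ℂ} {m n : ℕ}

theorem exists_eq_add_single {σ : ℕ →₀ ℕ} {i : ℕ} (h : σ i ≠ 0) :
    ∃ τ : ℕ →₀ ℕ, σ = τ + Finsupp.single i 1 := by
  refine ⟨σ - Finsupp.single i 1, ?_⟩
  rw [tsub_add_cancel_of_le]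
  rw [Finsupp.single_le_iff]
  omega

/-- Summed over the column added last, the old weights give the normalising constant `W` divided by
`factorials m σ`, so `W` cancels. If `W = 0`, the row weight is zero as well, and the cancellation
survives division by zero. -/
theorem sum_step_eq (h : OrthonormalCols a m n) {c : Finset ℕ} {σ : ℕ →₀ ℕ} {k i : ℕ}
    (hc : c ⊆ Finset.range n) (hcard : c.card = k + 1) (hσ : σ.support ⊆ Finset.range m)
    (hdeg : σ.degree = k) (hi : i < m) (p : ℝ) :
    ∑ l ∈ c, p * weight a m σ (c.erase l) * (1 / (n - k)) *
      (rowWeight a m σ c i / ∑ i ∈ Finset.range m, rowWeight a m σ c i) =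
    p / (n - k) * ((σ i + 1) * weight a m (σ + Finsupp.single i 1) c) := by
  have hW := h.sum_rowWeight hc hσ (by rw [hcard, hdeg])
  have hr := rowWeight_eq a hi hσ (by rw [hcard, hdeg])
  have hf : (factorials m σ : ℝ) ≠ 0 := by exact_mod_cast (factorials_pos m σ).ne'
  set W := ∑ i ∈ Finset.range m, rowWeight a m σ c i with hWdef
  have hnonneg : ∀ i ∈ Finset.range m, 0 ≤ rowWeight a m σ c i := fun i _ => sq_nonneg _
  rw [← Finset.sum_mul, ← Finset.sum_mul, ← Finset.mul_sum]
  have hS : ∑ l ∈ c, weight a m σ (c.erase l) = W / factorials m σ := by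
    rw [hW]
    field_simp
  rw [hS]
  have hWr : W * (rowWeight a m σ c i / W) = rowWeight a m σ c i := by
    rcases eq_or_ne W 0 with h0 | h0
    · have := (Finset.sum_eq_zero_iff_of_nonneg hnonneg).mp (hWdef ▸ h0) i
        (Finset.mem_range.mpr hi)
      simp [this]
    · field_simp
  calc p * (W / factorials m σ) * (1 / (n - k)) * (rowWeight a m σ c i / W)
      = p / (n - k) * ((W * (rowWeight a m σ c i / W)) / factorials m σ) := by ring
    _ = _ := by
        rw [hWr, hr]
        congr 1
        field_simp

/-- Induction, splitting by the last column `l` and the last row `i`. The sum over `l` leaves a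
multiple of `σ i` times the weight, the `σ i` add up to `k + 1`, and C(n,k+1)·(k+1) = C(n,k)·(n-k).
-/
theorem chain_law (h : OrthonormalCols a m n) {k : ℕ} {c : Finset ℕ} {σ : ℕ →₀ ℕ}
    (hc : c ⊆ Finset.range n) (hcard : c.card = k) (hσ : σ.support ⊆ Finset.range m)
    (hdeg : σ.degree = k) :
    uniformSeq {ω | chain a m n ω k = (c, σ)} =
      ENNReal.ofReal ((n.choose k : ℝ)⁻¹ * weight a m σ c) := by
  classical
  induction k generalizing c σ with
  | zero =>
    obtain rfl := Finset.card_eq_zero.mp hcard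
    obtain rfl := (Finsupp.degree_eq_zero_iff σ).mp hdeg
    have h1 : weight a m 0 ∅ = 1 := by simp [weight, amp, factorials]
    simp [chain, h1]
  | succ k ih =>
    have hkn : k < n := by
      have := Finset.card_le_card hc
      rw [hcard, Finset.card_range] at this
      omega
    have hkn' : (0 : ℝ) < n - k := sub_pos.mpr (by exact_mod_cast hkn)
    set S := (c ×ˢ Finset.range m).filter fun x => σ x.2 ≠ 0 with hS
    set Ev : ℕ × ℕ → Set (ℕ → unitInterval) := fun x =>
      {ω | chain a m n ω k = (c.erase x.1, σ - Finsupp.single x.2 1)} ∩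
        {ω | ω (2 * k) ∈ {u : unitInterval | pick (colWeight (c.erase x.1)) n u = x.1}} ∩
        {ω | ω (2 * k + 1) ∈ {u : unitInterval | pick (rowWeight a m (σ - Finsupp.single x.2 1)
          (insert x.1 (c.erase x.1))) m u = x.2}} with hEv
    have hset : {ω | chain a m n ω (k + 1) = (c, σ)} = ⋃ x ∈ S, Ev x := by
      ext ω
      simp only [Set.mem_iUnion, exists_prop, hEv, Set.mem_inter_iff, Set.mem_ofPred_eq]
      constructor
      · intro hω
        rw [chain] at hω
        simp only [Prod.mk.injEq] at hω
        obtain ⟨h1, h2⟩ := hω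
        set x := chain a m n ω k with hx
        set l := pick (colWeight x.1) n (ω (2 * k)) with hl
        -- Drawing a column that is already present would leave at most `k` columns, but `c` has `k
        -- + 1`.
        have hlx : l ∉ x.1 := by
          intro hmem
          rw [Finset.insert_eq_of_mem hmem] at h1
          have := card_chain_le a m n ω k
          rw [← hx, h1] at this
          omega
        rw [h1] at h2
        set i := pick (rowWeight a m x.2 c) m (ω (2 * k + 1)) with hi
        have hcl : c.erase l = x.1 := by rw [← h1, Finset.erase_insert hlx]
        have hσi : σ - Finsupp.single i 1 = x.2 := by rw [← h2, add_tsub_cancel_right]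
        have hσ0 : σ i ≠ 0 := by rw [← h2]; simp
        have hlc : l ∈ c := h1 ▸ Finset.mem_insert_self _ _
        refine ⟨(l, i), ?_, ⟨?_, ?_⟩, ?_⟩
        · simp only [hS, Finset.mem_filter, Finset.mem_product]
          exact ⟨⟨hlc, hσ (Finsupp.mem_support_iff.mpr hσ0)⟩, hσ0⟩
        · simp only [hcl, hσi]
        · simp only [hcl]
          exact hl.symm
        · simp only [Finset.insert_erase hlc, hσi]
          exact hi.symm
      · rintro ⟨⟨l, i⟩, hmem, ⟨h1, h2⟩, h3⟩
        simp only [hS, Finset.mem_filter, Finset.mem_product] at hmem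
        obtain ⟨⟨hlc, -⟩, hσ0⟩ := hmem
        simp only at h1 h2 h3
        rw [chain, h1]
        simp only [h2, Finset.insert_erase hlc]
        rw [Finset.insert_erase hlc] at h3
        rw [h3, tsub_add_cancel_of_le]
        rw [Finsupp.single_le_iff]
        omega
    have hdisj : (S : Set (ℕ × ℕ)).PairwiseDisjoint Ev := by
      rintro ⟨l, i⟩ hx ⟨l', i'⟩ hx' hne
      refine Set.disjoint_left.mpr ?_
      rintro ω ⟨⟨h1, -⟩, -⟩ ⟨⟨h1', -⟩, -⟩
      simp only [hS, Finset.coe_filter, Set.mem_ofPred_eq, Finset.mem_product] at hx hx'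
      have heq := (h1.symm.trans h1')
      simp only [Prod.mk.injEq] at heq
      refine hne (Prod.ext ?_ ?_)
      · exact (Finset.erase_injOn c) hx.1.1 hx'.1.1 heq.1
      · by_contra hii
        obtain ⟨τ, hτ⟩ := exists_eq_add_single hx.2
        have := DFunLike.congr_fun heq.2 i
        simp only [Finsupp.coe_tsub, Pi.sub_apply, Finsupp.single_eq_same] at this
        rw [Finsupp.single_eq_of_ne hii] at this
        have := hx.2
        omega
    have hmeas : ∀ x ∈ S, MeasurableSet (Ev x) := fun x _ =>
      ((measurableSet_chain a m n k _).inter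
        (measurable_pi_apply (2 * k) (measurable_pick _ _ (measurableSet_singleton _)))).inter
        (measurable_pi_apply (2 * k + 1) (measurable_pick _ _ (measurableSet_singleton _)))
    have hval : ∀ x ∈ S, uniformSeq (Ev x) = ENNReal.ofReal ((n.choose k : ℝ)⁻¹ *
        weight a m (σ - Finsupp.single x.2 1) (c.erase x.1) * (1 / (n - k)) *
        (rowWeight a m (σ - Finsupp.single x.2 1) c x.2 /
          ∑ i ∈ Finset.range m, rowWeight a m (σ - Finsupp.single x.2 1) c i)) := by
      rintro ⟨l, i⟩ hx
      simp only [hS, Finset.mem_filter, Finset.mem_product] at hx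
      obtain ⟨⟨hl, hi⟩, hσi⟩ := hx
      obtain ⟨τ, rfl⟩ := exists_eq_add_single hσi
      have hτ : τ.support ⊆ Finset.range m := fun j hj => hσ (by
        rw [Finsupp.mem_support_iff] at hj ⊢
        simp only [Finsupp.coe_add, Pi.add_apply]
        omega)
      have hτd : τ.degree = k := by
        rw [map_add, Finsupp.degree_single] at hdeg
        omega
      have hcl : (c.erase l).card = k := by rw [Finset.card_erase_of_mem hl, hcard]; rfl
      have hcn : c.erase l ⊆ Finset.range n := (Finset.erase_subset _ _).trans hc
      have hins := Finset.insert_erase hl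
      have := uniformSeq_chain_step (l := l) (i := i) h (by rw [hins]; exact hc)
        (Finset.notMem_erase l c) hcl hτ hτd (Finset.mem_range.mp hi)
        (inv_nonneg.mpr (Nat.cast_nonneg _)) (ih hcn hcl hτ hτd)
      simp only [hEv, add_tsub_cancel_right]
      rw [hins] at this
      rw [hins]
      exact this
    rw [hset, measure_biUnion_finset hdisj hmeas, Finset.sum_congr rfl hval,
      ← ENNReal.ofReal_sum_of_nonneg]
    · congr 1
      rw [hS, Finset.sum_filter, Finset.sum_product_right]
      -- The factor `σ i` on the right makes the formula valid for rows outside the support too; for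
      -- the others write `σ = τ + e_i`, so that `τ i + 1 = σ i`.
      have hinner : ∀ i ∈ Finset.range m, (∑ l ∈ c, if σ i ≠ 0 then (n.choose k : ℝ)⁻¹ *
          weight a m (σ - Finsupp.single i 1) (c.erase l) * (1 / (n - k)) *
          (rowWeight a m (σ - Finsupp.single i 1) c i /
            ∑ i' ∈ Finset.range m, rowWeight a m (σ - Finsupp.single i 1) c i') else 0) =
          (n.choose k : ℝ)⁻¹ / (n - k) * (σ i * weight a m σ c) := by
        intro i hi
        by_cases hσi : σ i = 0
        · simp [hσi]
        · simp only [ne_eq, hσi, not_false_eq_true, if_true]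
          obtain ⟨τ, rfl⟩ := exists_eq_add_single hσi
          have hτ : τ.support ⊆ Finset.range m := fun j hj => hσ (by
            rw [Finsupp.mem_support_iff] at hj ⊢
            simp only [Finsupp.coe_add, Pi.add_apply]
            omega)
          have hτd : τ.degree = k := by
            rw [map_add, Finsupp.degree_single] at hdeg
            omega
          simp only [add_tsub_cancel_right]
          rw [sum_step_eq h hc hcard hτ hτd (Finset.mem_range.mp hi)]
          simp
      rw [Finset.sum_congr rfl hinner, ← Finset.mul_sum, ← Finset.sum_mul, ← Nat.cast_sum,
        ← degree_eq_sum hσ, hdeg]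
      have hch : ((n.choose (k + 1) : ℕ) : ℝ) * (k + 1) = n.choose k * (n - k) := by
        have := congrArg (Nat.cast : ℕ → ℝ) (Nat.choose_succ_right_eq n k)
        push_cast [Nat.cast_sub hkn.le] at this
        exact this
      have h1 : (n.choose k : ℝ) ≠ 0 := by exact_mod_cast (Nat.choose_pos hkn.le).ne'
      have h2 : (n.choose (k + 1) : ℝ) ≠ 0 := by exact_mod_cast (Nat.choose_pos hkn).ne'
      push_cast
      field_simp
      linear_combination (weight a m σ c) * hch
    · intro x _
      refine mul_nonneg (mul_nonneg (mul_nonneg (inv_nonneg.mpr (Nat.cast_nonneg _))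
        (weight_nonneg _ _ _ _)) (div_nonneg zero_le_one hkn'.le)) (div_nonneg (sq_nonneg _)
        (Finset.sum_nonneg fun i _ => sq_nonneg _))

/-- The possible states after `k` steps, up to null sets. -/
def states (m n k : ℕ) : Finset (Finset ℕ × (ℕ →₀ ℕ)) :=
  (Finset.range n).powersetCard k ×ˢ (Finset.range m).finsuppAntidiag k

theorem mem_states {k : ℕ} {x : Finset ℕ × (ℕ →₀ ℕ)} : x ∈ states m n k ↔
    (x.1 ⊆ Finset.range n ∧ x.1.card = k) ∧ x.2.support ⊆ Finset.range m ∧ x.2.degree = k := by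
  rw [states, Finset.mem_product, Finset.mem_powersetCard, Finset.mem_finsuppAntidiag]
  refine and_congr Iff.rfl ⟨fun h => ⟨h.2, by rw [degree_eq_sum h.2, h.1]⟩,
    fun h => ⟨by rw [← h.2, degree_eq_sum h.1], h.1⟩⟩

theorem lintegral_chain (h : OrthonormalCols a m n) (hn : 0 < n) (hm : 0 < m) {k : ℕ} (hk : k ≤ n)
    (f : Finset ℕ × (ℕ →₀ ℕ) → ℝ≥0∞) :
    ∫⁻ ω, f (chain a m n ω k) ∂uniformSeq =
      ∑ x ∈ states m n k, f x * ENNReal.ofReal ((n.choose k : ℝ)⁻¹ * weight a m x.2 x.1) := by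
  classical
  have h1 : (fun ω => f (chain a m n ω k)) =ᵐ[uniformSeq] fun ω =>
      ∑ x ∈ states m n k, {ω | chain a m n ω k = x}.indicator (fun _ => f x) ω := by
    filter_upwards [ae_card_chain a (m := m) hn hk] with ω hω
    have hmem : chain a m n ω k ∈ states m n k := mem_states.mpr
      ⟨⟨chain_fst_subset a hn ω k, hω⟩, chain_snd_support a hm ω k, chain_snd_degree a ω k⟩
    rw [Finset.sum_eq_single_of_mem _ hmem]
    · simp
    · intro x _ hx
      simp [Set.indicator, hx.symm]
  rw [lintegral_congr_ae h1, lintegral_finsetSum]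
  · refine Finset.sum_congr rfl fun x hx => ?_
    obtain ⟨⟨h2, h3⟩, h4, h5⟩ := mem_states.mp hx
    rw [lintegral_indicator_const (measurableSet_chain a m n k x)]
    congr 1
    exact chain_law h h2 h3 h4 h5
  · intro x _
    exact measurable_const.indicator (measurableSet_chain a m n k x)

end BosonSampling

namespace BosonSampling

variable {m n : ℕ}

/-! ### The output and the boson sampling distribution -/

/-- The multiplicities of the values of `f`. -/
noncomputable def multiplicities (f : Fin n → Fin m) : ℕ →₀ ℕ :=
  ∑ j, Finsupp.single (f j : ℕ) 1

theorem multiplicities_apply (f : Fin n → Fin m) (i : ℕ) :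
    multiplicities f i = (Finset.univ.filter fun j => (f j : ℕ) = i).card := by
  rw [multiplicities, Finsupp.finsetSum_apply, Finset.card_filter]
  exact Finset.sum_congr rfl fun j _ => Finsupp.single_apply

theorem support_multiplicities (f : Fin n → Fin m) :
    (multiplicities f).support ⊆ Finset.range m := by
  intro i hi
  rw [Finsupp.mem_support_iff, multiplicities_apply, Finset.card_ne_zero] at hi
  obtain ⟨j, hj⟩ := hi
  rw [← (Finset.mem_filter.mp hj).2]
  exact Finset.mem_range.mpr (f j).2

theorem degree_multiplicities (f : Fin n → Fin m) : (multiplicities f).degree = n := by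
  simp [multiplicities, map_sum, Finsupp.degree_single]

theorem count_outputList (σ : ℕ → ℕ) (i : ℕ) :
    (outputList m σ).count i = if i < m then σ i else 0 := by
  induction m with
  | zero => simp [outputList]
  | succ m ih =>
    have : outputList (m + 1) σ = outputList m σ ++ List.replicate (σ m) m := by
      simp [outputList, List.range_succ]
    rw [this, List.count_append, ih, List.count_replicate]
    rcases lt_trichotomy i m with h | rfl | h
    · simp [h, h.ne', h.trans (Nat.lt_succ_self m)]
    · simp
    · simp [h.ne, not_lt.mpr h.le, not_lt.mpr (Nat.succ_le_of_lt h)]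

theorem sortedLE_outputList (σ : ℕ → ℕ) : (outputList m σ).SortedLE := by
  rw [List.sortedLE_iff_pairwise, outputList, List.pairwise_flatMap]
  refine ⟨fun i _ => ?_, ?_⟩
  · rw [List.pairwise_replicate]
    exact Or.inr le_rfl
  · refine List.pairwise_lt_range.imp ?_
    intro i j hij x hx y hy
    rw [List.eq_of_mem_replicate hx, List.eq_of_mem_replicate hy]
    exact hij.le

theorem count_ofFn (f : Fin n → Fin m) (i : ℕ) :
    (List.ofFn fun j => (f j : ℕ)).count i = multiplicities f i := by
  rw [multiplicities_apply, List.ofFn_eq_map, List.count_eq_countP, List.countP_map,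
    List.countP_eq_length_filter,
    ← List.toFinset_card_of_nodup ((List.nodup_finRange n).filter _)]
  congr 1
  ext j
  simp

/-- Both lists are sorted, so they agree once every number occurs equally often. -/
theorem outputList_eq_iff {σ : ℕ →₀ ℕ} (hσ : σ.support ⊆ Finset.range m) (z : Fin n →o Fin m) :
    outputList m σ = (List.ofFn fun j => (z j : ℕ)) ↔ σ = multiplicities z := by
  have hc : ∀ i, (outputList m σ).count i = σ i := by
    intro i
    rw [count_outputList]
    split_ifs with h
    · rfl
    · exact (Finsupp.notMem_support_iff.mp fun hi => h (Finset.mem_range.mp (hσ hi))).symm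
  constructor
  · intro h
    ext i
    rw [← hc, h, count_ofFn]
  · rintro rfl
    refine List.Perm.eq_of_sortedLE (sortedLE_outputList _) ?_ ?_
    · rw [List.sortedLE_ofFn_iff]
      exact fun i j hij => z.monotone hij
    · rw [List.perm_iff_count]
      intro i
      rw [hc, count_ofFn]

theorem multiplicities_eq_iff (f g : Fin n → Fin m) :
    multiplicities f = multiplicities g ↔ ∃ τ : Equiv.Perm (Fin n), g ∘ τ = f := by
  constructor
  · intro h
    have hcard : ∀ i : Fin m, Nonempty ({j // f j = i} ≃ {j // g j = i}) := by
      intro i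
      refine Fintype.card_eq.mp ?_
      have := DFunLike.congr_fun h (i : ℕ)
      rw [multiplicities_apply, multiplicities_apply] at this
      rw [Fintype.card_subtype, Fintype.card_subtype]
      simpa only [Fin.ext_iff] using this
    have e' : ∀ i, {j // f j = i} ≃ {j // g j = i} := fun i => (hcard i).some
    refine ⟨(Equiv.sigmaFiberEquiv f).symm.trans
      ((Equiv.sigmaCongrRight e').trans (Equiv.sigmaFiberEquiv g)), ?_⟩
    funext j
    exact (e' (f j) ⟨j, rfl⟩).2
  · rintro ⟨τ, rfl⟩
    exact Equiv.sum_comp τ fun j => Finsupp.single (g j : ℕ) 1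

theorem factorials_multiplicities (f : Fin n → Fin m) :
    factorials m (multiplicities f) =
      ∏ i : Fin m, (Finset.univ.filter fun j => f j = i).card.factorial := by
  rw [factorials, Finset.prod_range]
  refine Finset.prod_congr rfl fun i _ => ?_
  rw [multiplicities_apply]
  simp only [Fin.ext_iff]

/-- A non-empty fibre is a coset of the stabiliser of `g`, whose order is the product of the
factorials of the fibre sizes of `g`. -/
theorem card_perm_comp_eq (f g : Fin n → Fin m) :
    (Finset.univ.filter fun τ : Equiv.Perm (Fin n) => g ∘ τ = f).card =
      if multiplicities f = multiplicities g then factorials m (multiplicities g) else 0 := by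
  split_ifs with h
  · obtain ⟨τ, rfl⟩ := (multiplicities_eq_iff f g).mp h
    rw [factorials_multiplicities]
    have h1 := DomMulAct.stabilizer_card g
    simp only [Fintype.card_subtype] at h1
    rw [← h1]
    refine Finset.card_bij' (fun ρ _ => ρ * τ⁻¹) (fun ρ _ => ρ * τ) ?_ ?_ ?_ ?_
    · intro ρ hρ
      simp only [Finset.mem_filter, Finset.mem_univ, true_and] at hρ ⊢
      funext j
      have := congrFun hρ (τ⁻¹ j)
      simpa using this
    · intro ρ hρ
      simp only [Finset.mem_filter, Finset.mem_univ, true_and] at hρ ⊢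
      funext j
      exact congrFun hρ (τ j)
    · intro ρ _
      simp
    · intro ρ _
      simp
  · rw [Finset.card_eq_zero, Finset.filter_eq_empty_iff]
    intro τ _ hτ
    exact h ((multiplicities_eq_iff f g).mpr ⟨τ, hτ⟩)

/-- Expanding the product of linear forms chooses a row `f j` for each column `j`, and the monomial
records how often each row is chosen. -/
theorem amp_range (A : Matrix (Fin m) (Fin n) ℂ) (σ : ℕ →₀ ℕ) :
    amp (entryOrZero A) m σ (Finset.range n) =
      ∑ f : Fin n → Fin m, if multiplicities f = σ then ∏ j, A (f j) j else 0 := by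
  classical
  have h1 : ∏ j ∈ Finset.range n, linForm (entryOrZero A) m j =
      ∑ f : Fin n → Fin m, MvPolynomial.monomial (multiplicities f) (∏ j, A (f j) j) := by
    rw [Finset.prod_range]
    have h2 : ∀ j : Fin n, linForm (entryOrZero A) m j =
        ∑ i : Fin m, MvPolynomial.monomial (Finsupp.single (i : ℕ) 1) (A i j) := by
      intro j
      rw [linForm, Finset.sum_range]
      refine Finset.sum_congr rfl fun i _ => ?_
      rw [MvPolynomial.C_mul_X_eq_monomial]
      simp [entryOrZero]
    simp_rw [h2]
    rw [Fintype.prod_sum]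
    refine Finset.sum_congr rfl fun f _ => ?_
    rw [multiplicities, MvPolynomial.monomial_sum_prod]
  rw [amp, h1, MvPolynomial.coeff_sum]
  exact Finset.sum_congr rfl fun f _ => MvPolynomial.coeff_monomial _ _ _

/-- Group the permutations by `z ∘ τ`: each `f` with the multiplicities of `z` arises from the same
number of permutations, and no other `f` arises. -/
theorem permanent_eq (A : Matrix (Fin m) (Fin n) ℂ) (z : Fin n → Fin m) :
    (A.submatrix z id).permanent =
      factorials m (multiplicities z) * amp (entryOrZero A) m (multiplicities z) (Finset.range n) := by
  classical
  rw [Matrix.permanent, amp_range, Finset.mul_sum]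
  rw [← Finset.sum_fiberwise Finset.univ (fun τ : Equiv.Perm (Fin n) => z ∘ τ)]
  refine Finset.sum_congr rfl fun f _ => ?_
  have h1 : ∀ τ ∈ Finset.univ.filter (fun τ : Equiv.Perm (Fin n) => z ∘ τ = f),
      ∏ i, A.submatrix z id (τ i) i = ∏ j, A (f j) j := by
    intro τ hτ
    rw [← (Finset.mem_filter.mp hτ).2]
    rfl
  rw [Finset.sum_congr rfl h1, Finset.sum_const, card_perm_comp_eq]
  split_ifs <;> simp

theorem bosonPMF_eq_weight (A : Matrix (Fin m) (Fin n) ℂ) (z : Fin n →o Fin m) :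
    bosonPMF A z = weight (entryOrZero A) m (multiplicities z) (Finset.range n) := by
  have hf : (factorials m (multiplicities z) : ℝ) ≠ 0 := by
    exact_mod_cast (factorials_pos m (multiplicities z)).ne'
  rw [bosonPMF, weight, permanent_eq, ← factorials_multiplicities, norm_mul, Complex.norm_natCast]
  field_simp

/-- After `n` steps all columns are chosen almost surely, and the factor C(n,n) in the law is 1. -/
theorem uniformSeq_output {A : Matrix (Fin m) (Fin n) ℂ} (h : OrthonormalCols (entryOrZero A) m n)
    (hn : 0 < n) (hm : 0 < m) (z : Fin n →o Fin m) :
    uniformSeq {ω | outputList m (chain (entryOrZero A) m n ω n).2 =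
      List.ofFn fun j => (z j : ℕ)} = ENNReal.ofReal (bosonPMF A z) := by
  have hset : {ω | outputList m (chain (entryOrZero A) m n ω n).2 =
      List.ofFn fun j => (z j : ℕ)} =ᵐ[uniformSeq]
      {ω | chain (entryOrZero A) m n ω n = (Finset.range n, multiplicities z)} := by
    filter_upwards [ae_card_chain (entryOrZero A) (m := m) hn le_rfl] with ω hω
    refine propext ?_
    change outputList m _ = _ ↔ chain _ _ _ _ _ = _
    rw [outputList_eq_iff (chain_snd_support _ hm ω n), Prod.ext_iff]
    refine ⟨fun h => ⟨?_, h⟩, fun h => h.2⟩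
    exact Finset.eq_of_subset_of_card_le (chain_fst_subset _ hn ω n) (by simp [hω])
  rw [measure_congr hset, chain_law h subset_rfl (Finset.card_range n) (support_multiplicities z)
    (degree_multiplicities z), bosonPMF_eq_weight]
  simp

end BosonSampling

namespace BosonSampling

variable {m n : ℕ}

/-! ### Haar averages of the weights -/

instance : IsProbabilityMeasure (haarUnitary m) :=
  ⟨Measure.haarMeasure_self (K₀ := (⊤ : TopologicalSpace.PositiveCompacts _))⟩

instance : (haarUnitary m).IsMulLeftInvariant := by
  unfold haarUnitary
  infer_instance

theorem entryOrZero_firstColumns_le_rfl (A : Matrix (Fin m) (Fin m) ℂ) :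
    entryOrZero (firstColumns le_rfl A) = entryOrZero A := rfl

theorem entryOrZero_mul (V U : Matrix (Fin m) (Fin m) ℂ) (i j : ℕ) :
    entryOrZero (V * U) i j = ∑ q ∈ Finset.range m, entryOrZero V i q * entryOrZero U q j := by
  rw [Finset.sum_range]
  unfold entryOrZero
  by_cases hi : i < m <;> by_cases hj : j < m <;> simp [hi, hj, Matrix.mul_apply]

theorem orthonormalCols (h : n ≤ m) (U : Matrix.unitaryGroup (Fin m) ℂ) :
    OrthonormalCols (entryOrZero (firstColumns h U.1)) m n := by
  intro l hl l' hl'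
  have hU := Matrix.mem_unitaryGroup_iff'.mp U.2
  have h1 := congrFun (congrFun hU (Fin.castLE h ⟨l', hl'⟩)) (Fin.castLE h ⟨l, hl⟩)
  rw [Matrix.mul_apply] at h1
  rw [Finset.sum_range]
  calc _ = ∑ i : Fin m, (star U.1) (Fin.castLE h ⟨l', hl'⟩) i * U.1 i (Fin.castLE h ⟨l, hl⟩) := by
        refine Finset.sum_congr rfl fun i _ => ?_
        simp [entryOrZero, hl, hl', firstColumns, Matrix.star_apply, mul_comm]
    _ = _ := by
        rw [h1, Matrix.one_apply]
        simp [Fin.ext_iff, eq_comm]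

theorem continuous_entryOrZero (i j : ℕ) :
    Continuous fun U : Matrix.unitaryGroup (Fin m) ℂ => entryOrZero U.1 i j := by
  unfold entryOrZero
  split_ifs with h
  · exact continuous_subtype_val.matrix_elem _ _
  · exact continuous_const

/-- The Ryser sum exhibits the coefficient as an explicit polynomial in the matrix entries. -/
theorem continuous_amp {σ : ℕ →₀ ℕ} {c : Finset ℕ} (hσ : σ.support ⊆ Finset.range m)
    (hc : c.card = σ.degree) :
    Continuous fun U : Matrix.unitaryGroup (Fin m) ℂ => amp (entryOrZero U.1) m σ c := by
  have hf : (factorials m σ : ℂ) ≠ 0 := by exact_mod_cast (factorials_pos m σ).ne'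
  have h1 : ∀ U : Matrix.unitaryGroup (Fin m) ℂ, amp (entryOrZero U.1) m σ c =
      ((-1) ^ σ.degree * (factorials m σ : ℂ))⁻¹ * ryser (entryOrZero U.1) m σ c := by
    intro U
    rw [ryser_eq _ hσ hc, inv_mul_cancel_left₀]
    exact mul_ne_zero (pow_ne_zero _ (by norm_num)) hf
  simp_rw [h1, ryser, ryserTerm]
  have := fun i j => continuous_entryOrZero (m := m) i j
  fun_prop

theorem integrable_of_continuous {E : Type*} [NormedAddCommGroup E] [SecondCountableTopology E]
    {f : Matrix.unitaryGroup (Fin m) ℂ → E} (hf : Continuous f) : Integrable f (haarUnitary m) :=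
  hf.integrable_of_hasCompactSupport (HasCompactSupport.of_compactSpace f)

theorem coeff_aeval_C_mul_X (d : ℕ → ℂ) (p : MvPolynomial ℕ ℂ) (σ : ℕ →₀ ℕ) :
    (MvPolynomial.aeval (fun i => MvPolynomial.C (d i) * MvPolynomial.X i) p).coeff σ =
      (σ.prod fun i e => d i ^ e) * p.coeff σ := by
  classical
  induction p using MvPolynomial.induction_on' with
  | monomial u r =>
    have h1 : MvPolynomial.aeval (fun i => MvPolynomial.C (d i) * MvPolynomial.X i)
        (MvPolynomial.monomial u r) =
        (MvPolynomial.monomial u (r * u.prod fun i e => d i ^ e) : MvPolynomial ℕ ℂ) := by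
      rw [MvPolynomial.aeval_monomial, MvPolynomial.monomial_eq, map_mul, Finsupp.prod, Finsupp.prod,
        Finsupp.prod, map_prod, MvPolynomial.algebraMap_eq, mul_assoc, ← Finset.prod_mul_distrib]
      simp [mul_pow]
    rw [h1, MvPolynomial.coeff_monomial, MvPolynomial.coeff_monomial]
    split_ifs with h
    · rw [h, mul_comm]
    · simp
  | add p q hp hq =>
    rw [map_add, MvPolynomial.coeff_add, MvPolynomial.coeff_add, hp, hq, mul_add]

/-- Scaling row `i` by `d i` amounts to substituting `d i * X i` for `X i`. -/
theorem amp_mul_row (a : ℕ → ℕ → ℂ) (d : ℕ → ℂ) (m : ℕ) (σ : ℕ →₀ ℕ) (c : Finset ℕ) :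
    amp (fun i j => d i * a i j) m σ c = (σ.prod fun i e => d i ^ e) * amp a m σ c := by
  rw [amp, amp, ← coeff_aeval_C_mul_X, map_prod]
  congr 2
  funext j
  simp only [linForm, map_sum, map_mul]
  refine Finset.sum_congr rfl fun i _ => ?_
  rw [MvPolynomial.algHom_C, MvPolynomial.aeval_X, MvPolynomial.algebraMap_eq]
  ring

/-- The diagonal unitary matrix with entry `ζ` at `i` and one elsewhere. -/
noncomputable def phase (m : ℕ) (i : ℕ) (ζ : ℂ) (hζ : ζ * starRingEnd ℂ ζ = 1) :
    Matrix.unitaryGroup (Fin m) ℂ :=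
  ⟨Matrix.diagonal fun q => if (q : ℕ) = i then ζ else 1, by
    rw [Matrix.mem_unitaryGroup_iff, Matrix.star_eq_conjTranspose, Matrix.diagonal_conjTranspose,
      Matrix.diagonal_mul_diagonal, ← Matrix.diagonal_one]
    congr 1
    funext q
    by_cases h : (q : ℕ) = i <;> simp [h, hζ]⟩

theorem entryOrZero_phase_mul (i : ℕ) (ζ : ℂ) (hζ : ζ * starRingEnd ℂ ζ = 1)
    (U : Matrix.unitaryGroup (Fin m) ℂ) :
    entryOrZero (phase m i ζ hζ * U).1 =
      fun q j => (if q = i then ζ else 1) * entryOrZero U.1 q j := by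
  funext q j
  have : (phase m i ζ hζ * U).1 =
    Matrix.diagonal (fun q : Fin m => if (q : ℕ) = i then ζ else 1) * U.1 := rfl
  rw [this]
  unfold entryOrZero
  split_ifs with h <;> simp_all [Matrix.diagonal_mul]

/-- At a row `i` where `σ` and `τ` differ, multiply by the phase exp(iπ/(σ_i - τ_i)). The integrand
changes sign while Haar measure is invariant, so the integral equals its negative. -/
theorem integral_amp_mul_conj_eq_zero {σ τ : ℕ →₀ ℕ} {c : Finset ℕ} (hne : σ ≠ τ) :
    ∫ U, amp (entryOrZero U.1) m σ c * starRingEnd ℂ (amp (entryOrZero U.1) m τ c)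
      ∂(haarUnitary m) = 0 := by
  obtain ⟨i, hi⟩ := Finsupp.ne_iff.mp hne
  have hsub : ((σ i : ℂ) - τ i) ≠ 0 := sub_ne_zero.mpr (by exact_mod_cast hi)
  set θ : ℝ := Real.pi / ((σ i : ℝ) - τ i) with hθ
  set ζ : ℂ := Complex.exp (θ * Complex.I) with hζdef
  have hconj : starRingEnd ℂ ζ = Complex.exp (-(θ * Complex.I)) := by
    rw [hζdef, ← Complex.exp_conj]
    simp
  have hζ : ζ * starRingEnd ℂ ζ = 1 := by
    rw [hconj, hζdef, ← Complex.exp_add]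
    simp
  have hpow : ζ ^ σ i * starRingEnd ℂ (ζ ^ τ i) = -1 := by
    rw [map_pow, hconj, hζdef, ← Complex.exp_nat_mul, ← Complex.exp_nat_mul, ← Complex.exp_add,
      ← Complex.exp_pi_mul_I]
    congr 1
    rw [hθ]
    push_cast
    field_simp
    ring
  have hprod : ∀ ρ : ℕ →₀ ℕ, (ρ.prod fun q e => (if q = i then ζ else 1) ^ e) = ζ ^ ρ i := by
    intro ρ
    rw [Finsupp.prod, Finset.prod_eq_single i]
    · simp
    · intro q _ hq
      simp [hq]
    · intro h
      simp [Finsupp.notMem_support_iff.mp h]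
  have hinv := integral_mul_left_eq_self (μ := haarUnitary m) (fun U =>
    amp (entryOrZero U.1) m σ c * starRingEnd ℂ (amp (entryOrZero U.1) m τ c)) (phase m i ζ hζ)
  have hstep : ∀ U : Matrix.unitaryGroup (Fin m) ℂ,
      amp (entryOrZero (phase m i ζ hζ * U).1) m σ c *
        starRingEnd ℂ (amp (entryOrZero (phase m i ζ hζ * U).1) m τ c) =
      -(amp (entryOrZero U.1) m σ c * starRingEnd ℂ (amp (entryOrZero U.1) m τ c)) := by
    intro U
    rw [entryOrZero_phase_mul, amp_mul_row (entryOrZero U.1) (fun q => if q = i then ζ else 1),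
      amp_mul_row (entryOrZero U.1) (fun q => if q = i then ζ else 1), hprod, hprod, map_mul]
    linear_combination (amp (entryOrZero U.1) m σ c *
      starRingEnd ℂ (amp (entryOrZero U.1) m τ c)) * hpow
  simp_rw [hstep] at hinv
  rw [integral_neg] at hinv
  exact self_eq_neg.mp hinv.symm

/-- Extend x/|x| to an orthonormal basis, placed at index 0, and take the conjugated basis vectors
as columns. The vector x = 0 needs the separate case. -/
theorem exists_unitary_map (x : ℕ → ℝ) (hm : 0 < m) : ∃ V : Matrix.unitaryGroup (Fin m) ℂ,
    ∀ q < m, ∑ i ∈ Finset.range m, entryOrZero V.1 i q * (x i : ℂ) =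
      if q = 0 then ((√(∑ i ∈ Finset.range m, x i ^ 2) : ℝ) : ℂ) else 0 := by
  set r := √(∑ i ∈ Finset.range m, x i ^ 2) with hr
  have hr2 : r ^ 2 = ∑ i ∈ Finset.range m, x i ^ 2 :=
    Real.sq_sqrt (Finset.sum_nonneg fun _ _ => sq_nonneg _)
  rcases eq_or_ne r 0 with h0 | h0
  · refine ⟨1, fun q _ => ?_⟩
    have hx : ∀ i ∈ Finset.range m, x i = 0 := by
      rw [h0] at hr2
      intro i hi
      have := (Finset.sum_eq_zero_iff_of_nonneg fun i _ => sq_nonneg (x i)).mp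
        (by rw [← hr2]; ring) i hi
      exact pow_eq_zero_iff two_ne_zero |>.mp this
    rw [Finset.sum_eq_zero fun i hi => by rw [hx i hi]; simp]
    simp [h0]
  · set v : EuclideanSpace ℂ (Fin m) := WithLp.toLp 2 fun i => ((x i / r : ℝ) : ℂ) with hv
    have hnorm : ‖v‖ = 1 := by
      rw [EuclideanSpace.norm_eq, Real.sqrt_eq_one]
      simp only [hv, Complex.norm_real, Real.norm_eq_abs, sq_abs, div_pow]
      rw [← Finset.sum_div, hr2, Finset.sum_range, div_self]
      rw [← Finset.sum_range (fun i => x i ^ 2), ← hr2]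
      exact pow_ne_zero 2 h0
    let z : Fin m := ⟨0, hm⟩
    obtain ⟨b, hb⟩ := Orthonormal.exists_orthonormalBasis_extension_of_card_eq (𝕜 := ℂ)
      (v := fun _ : Fin m => v) (s := {z}) (by simp) (by
        rw [orthonormal_iff_ite]
        rintro ⟨i, hi⟩ ⟨j, hj⟩
        obtain rfl : i = z := hi
        obtain rfl : j = z := hj
        simp [hnorm])
    have hbz : b z = v := hb z rfl
    refine ⟨⟨Matrix.of fun i q => starRingEnd ℂ (b q i), ?_⟩, ?_⟩
    · rw [Matrix.mem_unitaryGroup_iff']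
      ext q q'
      rw [Matrix.mul_apply, Matrix.one_apply]
      have := orthonormal_iff_ite.mp b.orthonormal q' q
      rw [PiLp.inner_apply] at this
      simp only [Matrix.star_apply, Matrix.of_apply, RCLike.inner_apply] at this ⊢
      simp only [eq_comm (a := q) (b := q')]
      rw [← this]
      refine Finset.sum_congr rfl fun i _ => ?_
      simp
    · intro q hq
      rw [Finset.sum_range]
      have := orthonormal_iff_ite.mp b.orthonormal ⟨q, hq⟩ z
      rw [hbz, PiLp.inner_apply] at this
      simp only [RCLike.inner_apply, hv] at this
      have hrc : (r : ℂ) ≠ 0 := by exact_mod_cast h0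
      calc _ = (r : ℂ) * ∑ i : Fin m, ((x i / r : ℝ) : ℂ) * starRingEnd ℂ (b ⟨q, hq⟩ i) := by
            rw [Finset.mul_sum]
            refine Finset.sum_congr rfl fun i _ => ?_
            simp only [entryOrZero, hq, i.2, and_self, dite_true, Matrix.of_apply]
            push_cast
            field_simp
        _ = _ := by
            rw [this]
            simp [Fin.ext_iff, z]

end BosonSampling

/-! ### Second moments under Haar measure and uniformity of the occupation numbers. -/

namespace BosonSampling

variable {m n : ℕ}

theorem support_subset_of_amp_ne_zero {a : ℕ → ℕ → ℂ} {σ : ℕ →₀ ℕ} {c : Finset ℕ}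
    (h : amp a m σ c ≠ 0) : σ.support ⊆ Finset.range m := by
  have hmem : (∏ j ∈ c, linForm a m j) ∈ MvPolynomial.supported ℂ (Finset.range m : Set ℕ) :=
    Subalgebra.prod_mem _ fun j _ => Subalgebra.sum_mem _ fun i hi =>
      Subalgebra.mul_mem _ (Subalgebra.algebraMap_mem _ _)
        (MvPolynomial.X_mem_supported.mpr hi)
  intro i hi
  have := MvPolynomial.mem_supported.mp hmem
  exact this ((MvPolynomial.mem_vars_iff_mem_support i).mpr
    ⟨σ, MvPolynomial.mem_support_iff.mpr h, hi⟩)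

theorem prod_sum_mul_eq_sum_amp (a : ℕ → ℕ → ℂ) (m : ℕ) (c : Finset ℕ) (x : ℕ → ℂ) :
    ∏ j ∈ c, ∑ i ∈ Finset.range m, a i j * x i =
      ∑ σ ∈ (Finset.range m).finsuppAntidiag c.card,
        amp a m σ c * ∏ i ∈ Finset.range m, x i ^ σ i := by
  have h1 : ∏ j ∈ c, ∑ i ∈ Finset.range m, a i j * x i =
      MvPolynomial.eval x (∏ j ∈ c, linForm a m j) := by
    simp [linForm, map_prod, map_sum]
  have hsub : (∏ j ∈ c, linForm a m j).support ⊆ (Finset.range m).finsuppAntidiag c.card := by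
    intro σ hσ
    have hne := MvPolynomial.mem_support_iff.mp hσ
    have hs : σ.support ⊆ Finset.range m := support_subset_of_amp_ne_zero hne
    have hd := (prod_linForm_isHomogeneous a m c) hne
    rw [Finset.mem_finsuppAntidiag, ← degree_eq_sum hs]
    exact ⟨by rwa [Finsupp.degree_eq_weight_one], hs⟩
  rw [h1, MvPolynomial.eval_eq, Finset.sum_subset hsub]
  · refine Finset.sum_congr rfl fun σ hσ => ?_
    rw [amp]
    congr 1
    refine Finset.prod_subset (Finset.mem_finsuppAntidiag.mp hσ).2 fun i _ hi => ?_
    rw [Finsupp.notMem_support_iff.mp hi, pow_zero]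
  · intro σ _ hσ
    rw [MvPolynomial.notMem_support_iff.mp hσ, zero_mul]

/-- The multinomial coefficients of (∑ x_i)^|c|, obtained by Laplace expansion of the all-ones
matrix: each of the `k + 1` minors contributes `k!`. -/
theorem factorials_mul_amp_one {σ : ℕ →₀ ℕ} {c : Finset ℕ} (hσ : σ.support ⊆ Finset.range m)
    (hc : c.card = σ.degree) :
    (factorials m σ : ℂ) * amp (fun _ _ => 1) m σ c = (c.card.factorial : ℂ) := by
  induction hk : c.card generalizing σ c with
  | zero =>
    have hc0 : c = ∅ := Finset.card_eq_zero.mp hk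
    have hσ0 : σ = 0 := by rwa [hk, eq_comm, Finsupp.degree_eq_zero_iff] at hc
    subst hc0 hσ0
    simp [factorials, amp]
  | succ k ih =>
    have hne : σ ≠ 0 := by
      rintro rfl
      simp [hk] at hc
    obtain ⟨i, hi⟩ := Finsupp.support_nonempty_iff.mpr hne
    have him := Finset.mem_range.mp (hσ hi)
    have hle : Finsupp.single i 1 ≤ σ := by
      rw [Finsupp.single_le_iff]
      exact Nat.one_le_iff_ne_zero.mpr (Finsupp.mem_support_iff.mp hi)
    obtain ⟨τ, rfl⟩ := exists_add_of_le hle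
    rw [add_comm] at hσ hc ⊢
    have hτ : τ.support ⊆ Finset.range m := fun q hq => hσ (by
      rw [Finsupp.mem_support_iff] at hq ⊢
      simp only [Finsupp.add_apply]
      omega)
    have hdeg : τ.degree = k := by
      rw [map_add, Finsupp.degree_single, hk] at hc
      omega
    have hlap := amp_add_single (fun _ _ => 1) him τ c
    rw [factorials_add_single him]
    push_cast
    calc _ = (factorials m τ : ℂ) * (amp (fun _ _ => 1) m (τ + Finsupp.single i 1) c *
          ((τ i : ℂ) + 1)) := by ring
      _ = ∑ l ∈ c, (factorials m τ : ℂ) * amp (fun _ _ => 1) m τ (c.erase l) := by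
          rw [hlap, Finset.mul_sum]
          simp
      _ = ∑ l ∈ c, (k.factorial : ℂ) := by
          refine Finset.sum_congr rfl fun l hl => ?_
          have hcard : (c.erase l).card = k := by rw [Finset.card_erase_of_mem hl, hk]; rfl
          exact ih hτ (by rw [hcard, hdeg]) hcard
      _ = _ := by
          rw [Finset.sum_const, hk, Nat.factorial_succ]
          push_cast
          simp

/-- Second moment of the coefficients of the product of linear forms. -/
noncomputable def secondMoment (m : ℕ) (σ : ℕ →₀ ℕ) (c : Finset ℕ) : ℂ :=
  ∫ U, amp (entryOrZero U.1) m σ c * starRingEnd ℂ (amp (entryOrZero U.1) m σ c) ∂(haarUnitary m)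

/-- After expansion the cross terms vanish by orthogonality. As `x` is real, only the squares of its
coordinates remain. -/
theorem integral_prod_sum_eq_sum (c : Finset ℕ) (x : ℕ → ℝ) :
    ∫ U, (∏ j ∈ c, ∑ i ∈ Finset.range m, entryOrZero U.1 i j * (x i : ℂ)) *
        starRingEnd ℂ (∏ j ∈ c, ∑ i ∈ Finset.range m, entryOrZero U.1 i j * (x i : ℂ))
        ∂(haarUnitary m) =
      ∑ σ ∈ (Finset.range m).finsuppAntidiag c.card,
        secondMoment m σ c * ∏ i ∈ Finset.range m, ((x i : ℂ) ^ 2) ^ σ i := by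
  have hcont : ∀ σ ∈ (Finset.range m).finsuppAntidiag c.card,
      Continuous fun U : Matrix.unitaryGroup (Fin m) ℂ => amp (entryOrZero U.1) m σ c := by
    intro σ hσ
    rw [Finset.mem_finsuppAntidiag] at hσ
    exact continuous_amp hσ.2 (by rw [degree_eq_sum hσ.2, hσ.1])
  simp_rw [prod_sum_mul_eq_sum_amp, map_sum, Finset.sum_mul_sum]
  rw [integral_finsetSum]
  swap
  · intro σ hσ
    refine integrable_of_continuous (continuous_finsetSum _ fun τ hτ => ?_)
    have h1 := hcont σ hσ
    have h2 := Complex.continuous_conj.comp (hcont τ hτ)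
    simp only [map_mul]
    exact (h1.mul continuous_const).mul (h2.mul continuous_const)
  refine Finset.sum_congr rfl fun σ hσ => ?_
  rw [integral_finsetSum]
  swap
  · intro τ hτ
    refine integrable_of_continuous ?_
    have h1 := hcont σ hσ
    have h2 := Complex.continuous_conj.comp (hcont τ hτ)
    simp only [map_mul]
    exact (h1.mul continuous_const).mul (h2.mul continuous_const)
  have hsplit : ∀ τ (U : Matrix.unitaryGroup (Fin m) ℂ),
      (amp (entryOrZero U.1) m σ c * ∏ i ∈ Finset.range m, (x i : ℂ) ^ σ i) *
        starRingEnd ℂ (amp (entryOrZero U.1) m τ c * ∏ i ∈ Finset.range m, (x i : ℂ) ^ τ i) =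
      (amp (entryOrZero U.1) m σ c * starRingEnd ℂ (amp (entryOrZero U.1) m τ c)) *
        ∏ i ∈ Finset.range m, ((x i : ℂ) ^ σ i * (x i : ℂ) ^ τ i) := by
    intro τ U
    rw [map_mul, map_prod, Finset.prod_mul_distrib]
    simp only [map_pow, Complex.conj_ofReal]
    ring
  simp_rw [hsplit, integral_mul_const]
  rw [Finset.sum_eq_single σ]
  · rw [secondMoment]
    congr 1
    refine Finset.prod_congr rfl fun i _ => ?_
    rw [← pow_mul, two_mul, pow_add]
  · intro τ _ hτ
    rw [integral_amp_mul_conj_eq_zero hτ.symm, zero_mul]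
  · exact fun h => absurd hσ h

/-- Invariance allows replacing U by VU with V rotating x to the first axis. Every linear form then
becomes the entry in row 0 times the length of x. -/
theorem integral_prod_sum_eq_pow (hm : 0 < m) (c : Finset ℕ) (x : ℕ → ℝ) :
    ∫ U, (∏ j ∈ c, ∑ i ∈ Finset.range m, entryOrZero U.1 i j * (x i : ℂ)) *
        starRingEnd ℂ (∏ j ∈ c, ∑ i ∈ Finset.range m, entryOrZero U.1 i j * (x i : ℂ))
        ∂(haarUnitary m) =
      (∫ U, (∏ j ∈ c, entryOrZero U.1 0 j) * starRingEnd ℂ (∏ j ∈ c, entryOrZero U.1 0 j)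
        ∂(haarUnitary m)) * (∑ i ∈ Finset.range m, (x i : ℂ) ^ 2) ^ c.card := by
  obtain ⟨V, hV⟩ := exists_unitary_map x hm
  set r := √(∑ i ∈ Finset.range m, x i ^ 2) with hr
  have hr2 : (r : ℂ) * r = ∑ i ∈ Finset.range m, (x i : ℂ) ^ 2 := by
    have : r * r = ∑ i ∈ Finset.range m, x i ^ 2 :=
      Real.mul_self_sqrt (Finset.sum_nonneg fun _ _ => sq_nonneg _)
    exact_mod_cast this
  rw [← integral_mul_left_eq_self _ V, ← integral_mul_const]
  congr 1
  funext U
  have hlin : ∀ j, ∑ i ∈ Finset.range m, entryOrZero (V * U).1 i j * (x i : ℂ) =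
      entryOrZero U.1 0 j * r := by
    intro j
    calc _ = ∑ i ∈ Finset.range m, ∑ q ∈ Finset.range m,
          entryOrZero U.1 q j * (entryOrZero V.1 i q * (x i : ℂ)) := by
            refine Finset.sum_congr rfl fun i _ => ?_
            rw [Submonoid.coe_mul, entryOrZero_mul, Finset.sum_mul]
            exact Finset.sum_congr rfl fun q _ => by ring
      _ = ∑ q ∈ Finset.range m, entryOrZero U.1 q j * if q = 0 then (r : ℂ) else 0 := by
            rw [Finset.sum_comm]
            refine Finset.sum_congr rfl fun q hq => ?_
            rw [← Finset.mul_sum, hV q (Finset.mem_range.mp hq)]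
      _ = _ := by
            rw [Finset.sum_eq_single_of_mem 0 (Finset.mem_range.mpr hm)
              fun q _ hq => by rw [if_neg hq, mul_zero], if_pos rfl]
  simp_rw [hlin]
  rw [Finset.prod_mul_distrib, Finset.prod_const, map_mul, map_pow, Complex.conj_ofReal, ← hr2,
    mul_pow]
  ring

/-- The Haar average of a weight does not depend on the occupation numbers. -/
theorem factorials_mul_secondMoment (hm : 0 < m) {σ : ℕ →₀ ℕ} {c : Finset ℕ}
    (hσ : σ.support ⊆ Finset.range m) (hc : c.card = σ.degree) :
    (factorials m σ : ℂ) * secondMoment m σ c = (c.card.factorial : ℂ) *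
      ∫ U, (∏ j ∈ c, entryOrZero U.1 0 j) * starRingEnd ℂ (∏ j ∈ c, entryOrZero U.1 0 j)
        ∂(haarUnitary m) := by
  classical
  set K := ∫ U, (∏ j ∈ c, entryOrZero U.1 0 j) * starRingEnd ℂ (∏ j ∈ c, entryOrZero U.1 0 j)
        ∂(haarUnitary m)
  -- `p` and `q` are the two evaluations of the same mean, read as polynomials in the squares of the
  -- x_i. Taking x_i = √(t_i) shows that they agree at natural numbers, and the finite difference
  -- formula recovers coefficients from such values.
  set p : MvPolynomial ℕ ℂ := ∑ τ ∈ (Finset.range m).finsuppAntidiag c.card,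
    MvPolynomial.monomial τ (secondMoment m τ c) with hp
  set q : MvPolynomial ℕ ℂ := MvPolynomial.C K * ∏ j ∈ c, linForm (fun _ _ => 1) m j with hq
  have hdeg : ∀ τ ∈ (Finset.range m).finsuppAntidiag c.card, τ.degree = c.card := by
    intro τ hτ
    rw [Finset.mem_finsuppAntidiag] at hτ
    rw [degree_eq_sum hτ.2, hτ.1]
  have hph : p.IsHomogeneous σ.degree := by
    rw [← hc]
    exact MvPolynomial.IsHomogeneous.sum _ _ _ fun τ hτ =>
      MvPolynomial.isHomogeneous_monomial _ (hdeg τ hτ)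
  have hqh : q.IsHomogeneous σ.degree := by
    rw [← hc]
    simpa using (MvPolynomial.isHomogeneous_C ℕ K).mul
      (prod_linForm_isHomogeneous (fun _ _ => 1) m c)
  have heval : ∀ t : ℕ →₀ ℕ, MvPolynomial.eval (fun i => (t i : ℂ)) p =
      MvPolynomial.eval (fun i => (t i : ℂ)) q := by
    intro t
    have hsq : ∀ i, (((√(t i : ℝ) : ℝ) : ℂ)) ^ 2 = (t i : ℂ) := by
      intro i
      have : (√(t i : ℝ)) ^ 2 = t i := Real.sq_sqrt (Nat.cast_nonneg _)
      exact_mod_cast this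
    have h := (integral_prod_sum_eq_sum (m := m) c fun i => √(t i : ℝ)).symm.trans
      (integral_prod_sum_eq_pow hm c fun i => √(t i : ℝ))
    simp only [hsq] at h
    rw [hp, hq, map_sum, map_mul, map_prod, MvPolynomial.eval_C]
    simp only [linForm, map_sum, map_mul, MvPolynomial.eval_C, MvPolynomial.eval_X, one_mul,
      Finset.prod_const]
    rw [← h]
    refine Finset.sum_congr rfl fun τ hτ => ?_
    rw [MvPolynomial.eval_monomial, Finsupp.prod_of_support_subset _
      (Finset.mem_finsuppAntidiag.mp hτ).2 _ fun _ _ => pow_zero _]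
  have hcoeff : p.coeff σ = q.coeff σ := by
    have h1 := sum_signedChoose_mul_eval hσ hph
    have h2 := sum_signedChoose_mul_eval hσ hqh
    simp_rw [heval] at h1
    have h3 := h1.symm.trans h2
    have hf : (factorials m σ : ℂ) ≠ 0 := by exact_mod_cast (factorials_pos m σ).ne'
    exact mul_left_cancel₀ (mul_ne_zero (pow_ne_zero _ (by norm_num)) hf) h3
  have hpc : p.coeff σ = secondMoment m σ c := by
    rw [hp, MvPolynomial.coeff_sum, Finset.sum_eq_single σ]
    · simp
    · intro τ _ hτ
      rw [MvPolynomial.coeff_monomial, if_neg hτ]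
    · intro h
      exact absurd (Finset.mem_finsuppAntidiag.mpr ⟨by rw [← degree_eq_sum hσ, hc], hσ⟩) h
  rw [← hpc, hcoeff, hq, MvPolynomial.coeff_C_mul, ← factorials_mul_amp_one hσ hc, amp]
  ring

theorem integral_weight_eq (hm : 0 < m) {σ τ : ℕ →₀ ℕ} {c : Finset ℕ}
    (hσ : σ.support ⊆ Finset.range m) (hτ : τ.support ⊆ Finset.range m)
    (hc : c.card = σ.degree) (hc' : c.card = τ.degree) :
    ∫ U, weight (entryOrZero U.1) m σ c ∂(haarUnitary m) =
      ∫ U, weight (entryOrZero U.1) m τ c ∂(haarUnitary m) := by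
  have key : ∀ ρ : ℕ →₀ ℕ, ((∫ U, weight (entryOrZero U.1) m ρ c ∂(haarUnitary m) : ℝ) : ℂ) =
      (factorials m ρ : ℂ) * secondMoment m ρ c := by
    intro ρ
    rw [← integral_complex_ofReal, secondMoment, ← integral_const_mul]
    congr 1
    funext U
    rw [weight, Complex.mul_conj, Complex.normSq_eq_norm_sq]
    push_cast
    rfl
  have := (key σ).trans ((factorials_mul_secondMoment hm hσ hc).trans
    ((factorials_mul_secondMoment hm hτ hc').symm.trans (key τ).symm))
  exact_mod_cast this

theorem continuous_weight {σ : ℕ →₀ ℕ} {c : Finset ℕ} (hσ : σ.support ⊆ Finset.range m)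
    (hc : c.card = σ.degree) :
    Continuous fun U : Matrix.unitaryGroup (Fin m) ℂ => weight (entryOrZero U.1) m σ c :=
  continuous_const.mul ((continuous_amp hσ hc).norm.pow 2)

theorem measurable_ofReal_weight (r : ℝ) {k : ℕ} {x : Finset ℕ × (ℕ →₀ ℕ)}
    (hx : x ∈ states m n k) : Measurable fun U : Matrix.unitaryGroup (Fin m) ℂ =>
      ENNReal.ofReal (r * weight (entryOrZero U.1) m x.2 x.1) := by
  obtain ⟨⟨_, h2⟩, h3, h4⟩ := mem_states.mp hx
  exact ENNReal.measurable_ofReal.comp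
    (continuous_const.mul (continuous_weight h3 (h2.trans h4.symm))).measurable

theorem measurable_lintegral_chain (hn : 0 < n) {k : ℕ} (hk : k ≤ n) (f : (ℕ →₀ ℕ) → ℝ≥0∞) :
    Measurable fun U : Matrix.unitaryGroup (Fin n) ℂ =>
      ∫⁻ ω, f (chain (entryOrZero U.1) n n ω k).2 ∂uniformSeq := by
  have h1 : ∀ U : Matrix.unitaryGroup (Fin n) ℂ, _ := fun U =>
    lintegral_chain (orthonormalCols le_rfl U) hn hn hk fun x => f x.2
  simp_rw [entryOrZero_firstColumns_le_rfl] at h1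
  simp_rw [h1]
  exact Finset.measurable_fun_sum _ fun x hx => (measurable_ofReal_weight _ hx).const_mul _

/-- For a Haar random unitary matrix, the occupation numbers after `k` steps are uniformly
distributed. -/
theorem lintegral_haar_chain (hn : 0 < n) {k : ℕ} (hk : k ≤ n) (f : (ℕ →₀ ℕ) → ℝ≥0∞) :
    (((Finset.range n).finsuppAntidiag k).card : ℝ≥0∞) *
      ∫⁻ U, ∫⁻ ω, f (chain (entryOrZero U.1) n n ω k).2 ∂uniformSeq ∂(haarUnitary n) =
      ∑ σ ∈ (Finset.range n).finsuppAntidiag k, f σ := by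
  have hdeg : ∀ {τ : ℕ →₀ ℕ}, τ ∈ (Finset.range n).finsuppAntidiag k →
      τ.support ⊆ Finset.range n ∧ τ.degree = k := by
    intro τ hτ
    rw [Finset.mem_finsuppAntidiag] at hτ
    exact ⟨hτ.2, by rw [degree_eq_sum hτ.2, hτ.1]⟩
  obtain ⟨τ, hτ⟩ : ∃ τ, τ ∈ (Finset.range n).finsuppAntidiag k := by
    refine ⟨Finsupp.single 0 k, Finset.mem_finsuppAntidiag.mpr ⟨?_, ?_⟩⟩
    · rw [Finset.sum_eq_single_of_mem 0 (Finset.mem_range.mpr hn) fun i _ hi => by simp [hi.symm]]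
      simp
    · exact Finsupp.support_single_subset.trans (by simpa using hn)
  set W : Finset ℕ → ℝ≥0∞ := fun c => ENNReal.ofReal ((n.choose k : ℝ)⁻¹ *
    ∫ U, weight (entryOrZero U.1) n τ c ∂(haarUnitary n)) with hW
  have main : ∀ f : (ℕ →₀ ℕ) → ℝ≥0∞,
      ∫⁻ U, ∫⁻ ω, f (chain (entryOrZero U.1) n n ω k).2 ∂uniformSeq ∂(haarUnitary n) =
      (∑ c ∈ (Finset.range n).powersetCard k, W c) *
        ∑ σ ∈ (Finset.range n).finsuppAntidiag k, f σ := by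
    intro f
    have h1 : ∀ U : Matrix.unitaryGroup (Fin n) ℂ, _ := fun U =>
      lintegral_chain (orthonormalCols le_rfl U) hn hn hk fun x => f x.2
    simp_rw [entryOrZero_firstColumns_le_rfl] at h1
    simp_rw [h1]
    rw [lintegral_finsetSum' _ fun x hx => ((measurable_ofReal_weight _ hx).const_mul _).aemeasurable, states,
      Finset.sum_product, Finset.sum_mul_sum]
    refine Finset.sum_congr rfl fun c hc => Finset.sum_congr rfl fun σ hσ => ?_
    have hcc := (Finset.mem_powersetCard.mp hc).2
    rw [lintegral_const_mul _ (measurable_ofReal_weight _ (x := (c, σ))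
      (Finset.mk_mem_product hc hσ)), mul_comm]
    simp only [hW]
    congr 1
    rw [← integral_weight_eq hn (hdeg hσ).1 (hdeg hτ).1 (hcc.trans (hdeg hσ).2.symm)
      (hcc.trans (hdeg hτ).2.symm), ← integral_const_mul, ofReal_integral_eq_lintegral_ofReal]
    · exact integrable_of_continuous (continuous_const.mul
        (continuous_weight (hdeg hσ).1 (hcc.trans (hdeg hσ).2.symm)))
    · exact Filter.Eventually.of_forall fun U => mul_nonneg (by positivity) (weight_nonneg _ _ _ _)
  -- The constant function identifies `∑ W c` as the reciprocal of the number of multisets, so the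
  -- Haar moment itself never has to be computed.
  have hone := main fun _ => 1
  simp only [lintegral_const, measure_univ, mul_one, Finset.sum_const, nsmul_eq_mul] at hone
  rw [main f, ← mul_assoc, mul_comm (Finset.card _ : ℝ≥0∞), ← hone, one_mul]

end BosonSampling

namespace BosonSampling

/-! ### The expected running time -/

/-- Both sides are the coefficient of X^k in (1-X)^-(d+1). -/
theorem card_finsuppAntidiag_range (d k : ℕ) :
    ((Finset.range (d + 1)).finsuppAntidiag k).card = (d + k).choose k := by
  have h := PowerSeries.coeff_prod (fun _ : ℕ => (PowerSeries.mk 1 : PowerSeries ℤ)) k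
    (Finset.range (d + 1))
  rw [Finset.prod_const, Finset.card_range, PowerSeries.mk_one_pow_eq_mk_choose_add,
    PowerSeries.coeff_mk, Nat.choose_symm_add] at h
  simp only [PowerSeries.coeff_mk, Pi.one_apply, Finset.prod_const_one, Finset.sum_const,
    nsmul_eq_mul, mul_one] at h
  exact_mod_cast h.symm

/-- As ∑ (e+1) X^e = (1-X)^-2, both sides are the coefficient of X^k in (1-X)^-(2d+2). -/
theorem sum_finsuppAntidiag_range (d k : ℕ) :
    ∑ σ ∈ (Finset.range (d + 1)).finsuppAntidiag k, ∏ i ∈ Finset.range (d + 1), (σ i + 1) =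
      (2 * d + 1 + k).choose k := by
  have h := PowerSeries.coeff_prod (fun _ : ℕ => (PowerSeries.mk 1 : PowerSeries ℤ) ^ (1 + 1)) k
    (Finset.range (d + 1))
  rw [Finset.prod_const, Finset.card_range, ← pow_mul,
    show (1 + 1) * (d + 1) = 2 * d + 1 + 1 by ring, PowerSeries.mk_one_pow_eq_mk_choose_add,
    PowerSeries.mk_one_pow_eq_mk_choose_add, PowerSeries.coeff_mk, Nat.choose_symm_add] at h
  simp only [PowerSeries.coeff_mk, Nat.choose_one_right] at h
  have h' : ∑ σ ∈ (Finset.range (d + 1)).finsuppAntidiag k,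
      ∏ i ∈ Finset.range (d + 1), (1 + σ i) = (2 * d + 1 + k).choose k := by
    exact_mod_cast h.symm
  simpa only [add_comm 1] using h'

/-- The expected number of terms of the Ryser sum for `k` particles in `d + 1` modes, if the
occupation numbers are uniformly distributed. -/
noncomputable def meanTerms (d k : ℕ) : ℝ :=
  ((2 * d + 1 + k).factorial * d.factorial : ℝ) / ((2 * d + 1).factorial * (d + k).factorial)

theorem meanTerms_pos (d k : ℕ) : 0 < meanTerms d k := by
  unfold meanTerms
  positivity

theorem choose_mul_meanTerms (d k : ℕ) :
    ((d + k).choose k : ℝ) * meanTerms d k = ((2 * d + 1 + k).choose k : ℝ) := by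
  have h1 : ((d + k).choose k * d.factorial * k.factorial : ℝ) = (d + k).factorial := by
    exact_mod_cast Nat.add_choose_mul_factorial_mul_factorial d k
  have h2 : ((2 * d + 1 + k).choose k * (2 * d + 1).factorial * k.factorial : ℝ) =
      (2 * d + 1 + k).factorial := by
    exact_mod_cast Nat.add_choose_mul_factorial_mul_factorial (2 * d + 1) k
  have p1 : (0 : ℝ) < (d + k).factorial := by positivity
  have p2 : (0 : ℝ) < (2 * d + 1).factorial := by positivity
  rw [meanTerms, mul_div_assoc', div_eq_iff (mul_pos p2 p1).ne', ← h1, ← h2]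
  ring

theorem meanTerms_succ (d k : ℕ) :
    meanTerms d (k + 1) * (d + k + 1) = meanTerms d k * (2 * d + 2 + k) := by
  unfold meanTerms
  rw [← add_assoc, ← add_assoc, Nat.factorial_succ, Nat.factorial_succ (d + k)]
  have p1 : ((d + k).factorial : ℝ) ≠ 0 := by positivity
  have p2 : ((2 * d + 1).factorial : ℝ) ≠ 0 := by positivity
  have p3 : (d + k + 1 : ℝ) ≠ 0 := by positivity
  push_cast
  field_simp
  ring

/-- For k ≤ d the ratio (2d+2+k)/(d+k+1) of consecutive values is at least 3/2, so the sum is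
dominated by a geometric series ending at the next value. -/
theorem sum_meanTerms_le (d : ℕ) {j : ℕ} (hj : j ≤ d + 1) :
    ∑ k ∈ Finset.range j, meanTerms d k ≤ 2 * meanTerms d j := by
  induction j with
  | zero => simpa using (meanTerms_pos d 0).le
  | succ j ih =>
    rw [Finset.sum_range_succ]
    have h1 := ih (by omega)
    have h2 := meanTerms_succ d j
    have h3 : (j : ℝ) ≤ d := by exact_mod_cast Nat.le_of_succ_le_succ hj
    have h4 := meanTerms_pos d j
    have h5 : 3 * meanTerms d j ≤ 2 * meanTerms d (j + 1) := by
      have hpos : (0 : ℝ) < d + j + 1 := by positivity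
      refine le_of_mul_le_mul_right ?_ hpos
      calc 3 * meanTerms d j * (d + j + 1) ≤ 2 * (meanTerms d j * (2 * d + 2 + j)) := by
            nlinarith
        _ = _ := by rw [← h2]; ring
    linarith

/-- The value at d = 0 is 2, and the ratio of consecutive diagonal values stays below 27/16: after
cross-multiplication only the constants 960 < 972 differ. -/
theorem meanTerms_diag_le (d : ℕ) : meanTerms d (d + 1) ≤ 2 * (27 / 16) ^ d := by
  induction d with
  | zero => norm_num [meanTerms, Nat.factorial]
  | succ d ih =>
    have h : meanTerms (d + 1) (d + 1 + 1) =
        meanTerms d (d + 1) * (3 * (3 * d + 4) * (3 * d + 5) / (4 * (2 * d + 3) ^ 2)) := by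
      unfold meanTerms
      rw [show 2 * (d + 1) + 1 + (d + 1 + 1) = 3 * d + 2 + 1 + 1 + 1 by ring,
        show 2 * d + 1 + (d + 1) = 3 * d + 2 by ring,
        show 2 * (d + 1) + 1 = 2 * d + 1 + 1 + 1 by ring,
        show d + 1 + (d + 1 + 1) = 2 * d + 1 + 1 + 1 by ring,
        show d + (d + 1) = 2 * d + 1 by ring]
      simp only [Nat.factorial_succ (3 * d + 2), Nat.factorial_succ (3 * d + 2 + 1),
        Nat.factorial_succ (3 * d + 2 + 1 + 1), Nat.factorial_succ (2 * d + 1),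
        Nat.factorial_succ (2 * d + 1 + 1), Nat.factorial_succ d]
      have p1 : ((2 * d + 1).factorial : ℝ) ≠ 0 := by positivity
      push_cast
      field_simp
      ring
    have h2 : (3 * (3 * d + 4) * (3 * d + 5) / (4 * (2 * d + 3) ^ 2) : ℝ) ≤ 27 / 16 := by
      rw [div_le_div_iff₀ (by positivity) (by norm_num)]
      nlinarith
    rw [h, pow_succ (27 / 16 : ℝ), ← mul_assoc]
    exact mul_le_mul ih h2 (by positivity) (by positivity)

/-- It absorbs the cubic overhead of the sampler into n(27/16)^n. -/
theorem sq_le_two_mul_pow (n : ℕ) : (n : ℝ) ^ 2 ≤ 2 * (27 / 16) ^ n := by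
  rcases lt_or_ge n 4 with h | h
  · interval_cases n <;> norm_num
  · induction n, h using Nat.le_induction with
    | base => norm_num
    | succ n hn ih =>
      have : (4 : ℝ) ≤ n := by exact_mod_cast hn
      push_cast
      rw [pow_succ (27 / 16 : ℝ)]
      nlinarith

theorem lintegral_card_Iic_chain {n k : ℕ} (hn : 0 < n) (hk : k ≤ n) :
    ∫⁻ U, ∫⁻ ω, ((Finset.Iic (chain (entryOrZero U.1) n n ω k).2).card : ℝ≥0∞)
      ∂uniformSeq ∂(haarUnitary n) = ENNReal.ofReal (meanTerms (n - 1) k) := by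
  obtain ⟨d, rfl⟩ := Nat.exists_eq_succ_of_ne_zero hn.ne'
  rw [Nat.succ_eq_add_one, Nat.add_sub_cancel]
  have h := lintegral_haar_chain hn hk fun σ => ((Finset.Iic σ).card : ℝ≥0∞)
  have hs : ∑ σ ∈ (Finset.range (d + 1)).finsuppAntidiag k, ((Finset.Iic σ).card : ℝ≥0∞) =
      ((2 * d + 1 + k).choose k : ℝ≥0∞) := by
    rw [← sum_finsuppAntidiag_range, Nat.cast_sum]
    refine Finset.sum_congr rfl fun σ hσ => ?_
    rw [card_Iic (Finset.mem_finsuppAntidiag.mp hσ).2]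
  rw [Nat.succ_eq_add_one, hs, card_finsuppAntidiag_range] at h
  have h0 : (d + k).choose k ≠ 0 := (Nat.choose_pos (Nat.le_add_left _ _)).ne'
  refine (ENNReal.mul_right_inj (Nat.cast_ne_zero.mpr h0) (ENNReal.natCast_ne_top _)).mp ?_
  rw [h, ← ENNReal.ofReal_natCast, ← ENNReal.ofReal_natCast, ← ENNReal.ofReal_mul (by positivity),
    choose_mul_meanTerms]

theorem measurable_chain_snd (a : ℕ → ℕ → ℂ) (m n k : ℕ) (f : (ℕ →₀ ℕ) → ℝ≥0∞) :
    Measurable fun ω => f (chain a m n ω k).2 := by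
  let _ : MeasurableSpace (Finset ℕ × (ℕ →₀ ℕ)) := ⊤
  have h : Measurable fun ω => chain a m n ω k :=
    measurable_to_countable' fun x => measurableSet_chain _ _ _ k x
  exact (measurable_from_top (f := fun x : Finset ℕ × (ℕ →₀ ℕ) => f x.2)).comp h

theorem lintegral_runTime_le {n : ℕ} (hn : 0 < n) :
    ∫⁻ A : Matrix.unitaryGroup (Fin n) ℂ,
        ∫⁻ ω, runTime sampler (firstColumns le_rfl A.1) ω ∂uniformSeq ∂(haarUnitary n) ≤
      ((700 : ℕ) : ℝ≥0∞) * n * (27 / 16) ^ n := by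
  set B : ℕ := n * (n * (10 * n + 10) + 14 * n + 20 * n + 62) + n * (3 * n + 5) + 8 with hB
  set E : ℕ := 14 * n + 35 * n + 60 with hE
  -- A pointwise bound suffices: the lower integral is monotone for arbitrary functions, so
  -- `runTime` need not be measurable.
  have hpt : ∀ (A : Matrix.unitaryGroup (Fin n) ℂ) ω,
      runTime sampler (firstColumns le_rfl A.1) ω ≤ (B : ℝ≥0∞) + ∑ k ∈ Finset.range n,
        ((Finset.Iic (chain (entryOrZero A.1) n n ω k).2).card : ℝ≥0∞) * E := by
    intro A ω
    obtain ⟨s, hs, -, hclock, -⟩ := sampler_spec (A := firstColumns le_rfl A.1) (ω := ω) hn le_rfl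
    refine (iInf₂_le s hs).trans ?_
    exact_mod_cast hclock
  have hin : ∀ A : Matrix.unitaryGroup (Fin n) ℂ,
      ∫⁻ ω, ((B : ℝ≥0∞) + ∑ k ∈ Finset.range n,
        ((Finset.Iic (chain (entryOrZero A.1) n n ω k).2).card : ℝ≥0∞) * E) ∂uniformSeq =
      (B : ℝ≥0∞) + ∑ k ∈ Finset.range n, (∫⁻ ω,
        ((Finset.Iic (chain (entryOrZero A.1) n n ω k).2).card : ℝ≥0∞) ∂uniformSeq) * E := by
    intro A
    have hmeas := fun k => measurable_chain_snd (entryOrZero A.1) n n k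
      fun σ => ((Finset.Iic σ).card : ℝ≥0∞)
    rw [lintegral_add_left measurable_const, lintegral_const, measure_univ, mul_one,
      lintegral_finsetSum _ fun k _ => (hmeas k).mul_const _]
    congr 1
    exact Finset.sum_congr rfl fun k _ => lintegral_mul_const _ (hmeas k)
  have hout : ∫⁻ A : Matrix.unitaryGroup (Fin n) ℂ, ((B : ℝ≥0∞) + ∑ k ∈ Finset.range n, (∫⁻ ω,
        ((Finset.Iic (chain (entryOrZero A.1) n n ω k).2).card : ℝ≥0∞) ∂uniformSeq) * E)
        ∂(haarUnitary n) =
      (B : ℝ≥0∞) + ∑ k ∈ Finset.range n, ENNReal.ofReal (meanTerms (n - 1) k) * E := by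
    have hmeas : ∀ k ∈ Finset.range n, _ := fun k hk => measurable_lintegral_chain hn
      (Finset.mem_range.mp hk).le fun σ => ((Finset.Iic σ).card : ℝ≥0∞)
    rw [lintegral_add_left measurable_const, lintegral_const, measure_univ, mul_one,
      lintegral_finsetSum' _ fun k hk => ((hmeas k hk).mul_const _).aemeasurable]
    congr 1
    refine Finset.sum_congr rfl fun k hk => ?_
    rw [lintegral_mul_const _ (hmeas k hk),
      lintegral_card_Iic_chain hn (Finset.mem_range.mp hk).le]
  -- Since 10+47+67+8 = 132 are the coefficients of `B`, and `E = 49n + 60 ≤ 109n`, the total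
  -- constant is 4·109 + 2·132 = 700.
  have hreal : (B : ℝ) + (∑ k ∈ Finset.range n, meanTerms (n - 1) k) * E ≤
      700 * n * (27 / 16) ^ n := by
    have hn1 : (1 : ℝ) ≤ n := by exact_mod_cast hn
    have hB' : (B : ℝ) ≤ 132 * n * n ^ 2 := by
      rw [hB]
      push_cast
      nlinarith [mul_nonneg (sub_nonneg.mpr hn1) (sub_nonneg.mpr hn1),
        mul_nonneg (sub_nonneg.mpr hn1) (sq_nonneg (n : ℝ))]
    have hE' : (E : ℝ) ≤ 109 * n := by
      rw [hE]
      push_cast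
      linarith
    have hsum : ∑ k ∈ Finset.range n, meanTerms (n - 1) k ≤ 4 * (27 / 16) ^ n := by
      obtain ⟨d, rfl⟩ := Nat.exists_eq_succ_of_ne_zero hn.ne'
      rw [Nat.succ_eq_add_one, Nat.add_sub_cancel]
      have h1 := sum_meanTerms_le d le_rfl
      have h2 := meanTerms_diag_le d
      have h3 : (0 : ℝ) < (27 / 16) ^ d := by positivity
      rw [pow_succ (27 / 16 : ℝ)]
      linarith
    have hsq := sq_le_two_mul_pow n
    have hprod := mul_le_mul hsum hE' (Nat.cast_nonneg _) (by positivity)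
    have hcube := mul_le_mul_of_nonneg_left hsq (show (0 : ℝ) ≤ 132 * n by positivity)
    linarith
  calc _ ≤ ∫⁻ A : Matrix.unitaryGroup (Fin n) ℂ, ∫⁻ ω, ((B : ℝ≥0∞) + ∑ k ∈ Finset.range n,
        ((Finset.Iic (chain (entryOrZero A.1) n n ω k).2).card : ℝ≥0∞) * E) ∂uniformSeq
        ∂(haarUnitary n) := lintegral_mono fun A => lintegral_mono fun ω => hpt A ω
    _ = (B : ℝ≥0∞) + ∑ k ∈ Finset.range n, ENNReal.ofReal (meanTerms (n - 1) k) * E := by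
        rw [← hout]
        exact lintegral_congr hin
    _ = ENNReal.ofReal ((B : ℝ) + (∑ k ∈ Finset.range n, meanTerms (n - 1) k) * E) := by
        have hnn : ∀ k ∈ Finset.range n, 0 ≤ meanTerms (n - 1) k :=
          fun k _ => (meanTerms_pos _ k).le
        rw [ENNReal.ofReal_add (Nat.cast_nonneg _)
          (mul_nonneg (Finset.sum_nonneg hnn) (Nat.cast_nonneg _)),
          ENNReal.ofReal_mul (Finset.sum_nonneg hnn), ENNReal.ofReal_sum_of_nonneg hnn,
          ENNReal.ofReal_natCast, ENNReal.ofReal_natCast, Finset.sum_mul]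
    _ ≤ ENNReal.ofReal (700 * n * (27 / 16) ^ n) := ENNReal.ofReal_le_ofReal hreal
    _ = _ := by
        rw [ENNReal.ofReal_mul (by positivity), ENNReal.ofReal_mul (by norm_num),
          ENNReal.ofReal_pow (by norm_num), ENNReal.ofReal_div_of_pos (by norm_num)]
        simp

end BosonSampling

open BosonSampling in
theorem theorem1 :
    ∃ (d : ℕ) (p : Prog d) (C : ℕ),
      (∀ (m n : ℕ) (_ : 1 ≤ n) (hnm : n ≤ m) (A : Matrix.unitaryGroup (Fin m) ℂ),
        (∀ z : Fin n →o Fin m,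
          uniformSeq {ω | ∃ s : MState d, HaltsIn p (firstColumns hnm A.1) ω s ∧
              s.out = List.ofFn fun k => (z k : ℕ)} =
            ENNReal.ofReal (bosonPMF (firstColumns hnm A.1) z)) ∧
        (∀ ω : ℕ → unitInterval, ∃ s : MState d, HaltsIn p (firstColumns hnm A.1) ω s ∧
          s.space ≤ C * m)) ∧
      (∀ n : ℕ, 1 ≤ n →
        ∫⁻ A : Matrix.unitaryGroup (Fin n) ℂ,
            ∫⁻ ω, runTime p (firstColumns le_rfl A.1) ω ∂uniformSeq ∂(haarUnitary n) ≤
          (C : ℝ≥0∞) * n * (27 / 16) ^ n) := by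
  refine ⟨16, sampler, 700, fun m n hn hnm A => ⟨fun z => ?_, fun ω => ?_⟩,
    fun n hn => lintegral_runTime_le hn⟩
  · rw [← uniformSeq_output (orthonormalCols hnm A) hn (hn.trans hnm) z]
    congr 1
    ext ω
    obtain ⟨s, hs, hout, -, -⟩ :=
      sampler_spec (A := firstColumns hnm A.1) (ω := ω) hn hnm
    constructor
    · rintro ⟨s', hs', hout'⟩
      obtain rfl : s' = s := Run.det hs' hs
      exact hout.symm.trans hout'
    · exact fun h => ⟨s, hs, hout.trans h⟩
  · obtain ⟨s, hs, -, -, htop⟩ :=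
      sampler_spec (A := firstColumns hnm A.1) (ω := ω) hn hnm
    refine ⟨s, hs, ?_⟩
    have hm : 1 ≤ m := hn.trans hnm
    -- With 16 variables and arrays of each kind and `top ≤ m`, the space is at most 32 + 32m, and
    -- `m ≥ 1`.
    unfold MState.space
    omega
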